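/- Let $\mathcal H$ be a complex Hilbert space with unit sphere $S_{\mathcal H}$, let $\mathcal D_A\subset\mathcal H$ be a linear subspace, and let $H_i(t):\mathcal D_A\to\mathcal D_A$ ($i=0,\dots,r$, $t\in\mathbb R$) be (possibly unbounded) skew-Hermitian operators. Assume: (a) (Smooth time dependence.) There is a real Lie algebra of families $t\mapsto X(t)$ of linear operators $\mathcal D_A\to\mathcal D_A$ (with the pointwise commutator) which contains $H_0,\dots,H_r$ and, with each family $X$, also a family $\partial X/\partial t$ satisfying $\frac{d}{dt}\big(X(t)\psi\big)=\frac{\partial X}{\partial t}(t)\,\psi$ in norm for all $t\in\mathbb R$ and $\psi\in\mathcal D_A$. (b) (Analytic domain.) $\mathcal D_A$ is dense, and for every $t$, each element $X$ of the real Lie algebra $\mathcal L\{H_0(t),\dots,H_r(t)\}$ generates a one-parameter group of unitaries $U_X(s)$, $s\in\mathbb R$, on $\mathcal H$ that leaves $\mathcal D_A$ invariant and satisfies, for every $\psi\in\mathcal D_A$, $U_X(s)\psi=\sum_{n\ge0}\frac{s^n}{n!}X^n\psi$ for all sufficiently small $|s|$, with absolute convergence. (c) (State manifold.) $M\subset S_{\mathcal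 H}$ is a nonempty connected smooth embedded (real) submanifold of dimension $m<\infty$, with the topology inherited from $\mathcal H$, and $M\cap\mathcal D_A$ is dense in $M$. (d) (System on $M$.) Consider $$\frac{\partial}{\partial t}\psi(t)=\Big[H_0(t)+\sum_{l=1}^r u_l(t)H_l(t)\Big]\psi(t),\qquad \psi(t_0)=\psi_0,\qquad \psi(t)\in M\cap\mathcal D_A\ \ \forall t\ge t_0,$$ where the real controls $u_l$ are piecewise constant (finitely many switching times in every bounded interval), and a solution is continuous in norm on $[t_0,\infty)$ and differentiable with the stated derivative except at switching times (one-sidedly at $t_0$). For all $t_0\in\mathbb R$, all $\psi_0\in M\cap\mathcal D_A$ and all such controls, a solution exists. Let $\mathcal B$ be the real Lie algebra of operator families generated by $H_1,\dots,H_r$, and $\mathcal B(t)=\mathcal L(H_1(t),\dots,H_r(t))$. Put $B_0=\mathcal B$ and, for $n\ge1$, $$B_n=-[H_0,B_{n-1}]+\frac{\partial}{\partial t}B_{n-1}=\Big\{-[H_0,X]+\frac{\partial X}{\partial t}: X\in B_{n-1}\Big\},$$ and let $\mathcal C$ be the real Lie algebra of operator families generated by $\mathcal B,B_1,B_2,\dots$.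 Suppose that $\dim_{\mathbb R}\{Y(t)\psi: Y\in\mathcal C\}=m$ for all $t\in\mathbb R$ and all $\psi\in M\cap\mathcal D_A$, and that $[X,Y](t)\in\mathcal B(t)$ for all $X\in\mathcal B$, $Y\in\mathcal C$ and all $t\in\mathbb R$. Then the system is strongly analytically controllable on $M$: for every initial time $t_0$, every $\psi_0\in M\cap\mathcal D_A$ and every $t>t_0$, the set $R_t(\psi_0)$ of all states $\psi(t)$, where $\psi$ runs through the solutions with $\psi(t_0)=\psi_0$ under arbitrary piecewise constant controls, equals $M\cap\mathcal D_A$. -/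

import Mathlib

open Set Filter Topology
open scoped ContDiff InnerProductSpace

attribute [local instance 100] LieRing.ofAssociativeRing

namespace QuantumControl

variable {E : Type*} [NormedAddCommGroup E] [InnerProductSpace ℂ E]

/-- Time-dependent (possibly unbounded) operators with common invariant domain `D`.  With the
pointwise commutator they form a real Lie algebra. -/
abbrev OpFamily (D : Submodule ℂ E) : Type _ := ℝ → Module.End ℂ D

/-- `M` is an `m`-dimensional smooth submanifold of `E` (regarded as a real space) carrying the
topology inherited from `E`: near each of its points it is the homeomorphic image of an open
subset of `ℝ^m` under a smooth immersion. -/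
def IsEmbeddedSubmanifold (m : ℕ) (M : Set E) : Prop :=
  ∀ p ∈ M, ∃ (V : Set (EuclideanSpace ℝ (Fin m))) (W : Set E)
    (f : EuclideanSpace ℝ (Fin m) → E) (g : E → EuclideanSpace ℝ (Fin m)),
    IsOpen V ∧ IsOpen W ∧ p ∈ W ∧ ContDiffOn ℝ ∞ f V ∧
    (∀ x ∈ V, Function.Injective (fderiv ℝ f x)) ∧
    f '' V = M ∩ W ∧ LeftInvOn g f V ∧ ContinuousOn g (M ∩ W)

/-- The operator `X` with domain `D` is skew-Hermitian. -/
def IsSkewHermitian {D : Submodule ℂ E} (X : Module.End ℂ D) : Prop :=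
  ∀ φ ψ : D, ⟪(X φ : E), (ψ : E)⟫_ℂ = -⟪(φ : E), (X ψ : E)⟫_ℂ

/-- `U` is the one-parameter unitary group `s ↦ exp (s X)`.  It is defined for all real `s`, it
leaves `D` invariant, every vector of `D` is an analytic vector for `X`, and on `D` the group is
given for small `s` by the exponential series.
(Consequently `d/ds U(s)ψ = X U(s)ψ` for all `s` and all `ψ ∈ D`.) -/
structure IsExpGroup {D : Submodule ℂ E} (X : Module.End ℂ D) (U : ℝ → (E ≃ₗᵢ[ℂ] E)) :
    Prop where
  map_zero : U 0 = 1
  map_add : ∀ s s' : ℝ, U (s + s') = U s * U s'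
  invariant : ∀ s : ℝ, ∀ ψ ∈ D, U s ψ ∈ D
  exp_series : ∀ ψ : D, ∃ ρ : ℝ, 0 < ρ ∧
    Summable (fun n : ℕ => ‖(((X ^ n) ψ : D) : E)‖ / (n.factorial : ℝ) * ρ ^ n) ∧
    ∀ s : ℝ, |s| < ρ →
      HasSum (fun n : ℕ => (s ^ n / (n.factorial : ℝ)) • (((X ^ n) ψ : D) : E)) (U s ψ)

/-- `D` is an analytic domain for the operators `X i`: it is dense, it is invariant under the
real Lie algebra generated by the `X i` (this is built into the type of `X`), and every element
of that Lie algebra exponentiates, locally by the exponential series on `D`, to a global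
one-parameter unitary group leaving `D` invariant. -/
structure IsAnalyticDomain {ι : Type*} (D : Submodule ℂ E) (X : ι → Module.End ℂ D) :
    Prop where
  dense : Dense (D : Set E)
  exists_expGroup : ∀ Y ∈ LieSubalgebra.lieSpan ℝ (Module.End ℂ D) (range X),
    ∃ U : ℝ → (E ≃ₗᵢ[ℂ] E), IsExpGroup Y U

/-- `Y = ∂X/∂t`, in the strong sense on `D`. -/
def IsTimeDeriv {D : Submodule ℂ E} (X Y : OpFamily D) : Prop :=
  ∀ (t : ℝ) (ψ : D), HasDerivAt (fun s : ℝ => (X s ψ : E)) (Y t ψ : E) t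

/-- The families `H i` depend smoothly on time: starting from them one can form commutators, real
linear combinations and time derivatives indefinitely, without leaving the operators on `D`. -/
def HasSmoothTimeDependence {ι : Type*} {D : Submodule ℂ E} (H : ι → OpFamily D) : Prop :=
  ∃ S : LieSubalgebra ℝ (OpFamily D), (∀ i, H i ∈ S) ∧ ∀ X ∈ S, ∃ Y ∈ S, IsTimeDeriv X Y

section algebras

variable {D : Submodule ℂ E} {r : ℕ} (H : Fin (r + 1) → OpFamily D)

/-- The Lie algebra `𝓑` of time-dependent operators generated by `H₁, …, H_r`. -/
noncomputable def algB : LieSubalgebra ℝ (OpFamily D) :=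
  LieSubalgebra.lieSpan ℝ (OpFamily D) (range fun l : Fin r => H l.succ)

/-- `𝓑(t) = 𝓛(H₁(t), …, H_r(t))`. -/
noncomputable def algBAt (t : ℝ) : LieSubalgebra ℝ (Module.End ℂ D) :=
  LieSubalgebra.lieSpan ℝ (Module.End ℂ D) (range fun l : Fin r => H l.succ t)

/-- `B₀ = 𝓑` and `B_{n+1} = -[H₀, B_n] + ∂B_n/∂t`. -/
def setB : ℕ → Set (OpFamily D)
  | 0 => (algB H : Set (OpFamily D))
  | n + 1 => {Z | ∃ X ∈ setB n, ∃ Y : OpFamily D, IsTimeDeriv X Y ∧ Z = -⁅H 0, X⁆ + Y}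

/-- The Lie algebra `𝓒` generated by `𝓑, B₁, B₂, …`. -/
noncomputable def algC : LieSubalgebra ℝ (OpFamily D) :=
  LieSubalgebra.lieSpan ℝ (OpFamily D) (⋃ n : ℕ, setB H n)

/-- The real-linear map `Y ↦ Y(t)ψ`. -/
def evalMap (t : ℝ) (ψ : D) : OpFamily D →ₗ[ℝ] D where
  toFun Y := Y t ψ
  map_add' _ _ := rfl
  map_smul' _ _ := rfl

/-- The real vector space `𝓒(t)ψ`. -/
noncomputable def algCAt (t : ℝ) (ψ : D) : Submodule ℝ D :=
  (algC H).toSubmodule.map (evalMap t ψ)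

/-- The times near which `u` is not constant. -/
def switchingTimes (u : ℝ → Fin r → ℝ) : Set ℝ :=
  {t | ¬ ∀ᶠ s in 𝓝 t, u s = u t}

/-- Piecewise constant controls: finitely many switching times in each bounded interval. -/
def IsPiecewiseConstant (u : ℝ → Fin r → ℝ) : Prop :=
  ∀ a b : ℝ, (switchingTimes u ∩ Icc a b).Finite

/-- `ψ` solves `∂ψ/∂t = [H₀(t) + ∑ u_l(t) H_l(t)] ψ` on `[t₀, ∞)`, and `ψ(t) ∈ M ∩ D` for all
`t ≥ t₀`.  At the switching times of the control only continuity is required. -/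
structure IsTrajectory (M : Set E) (t₀ : ℝ) (u : ℝ → Fin r → ℝ) (ψ : ℝ → D) : Prop where
  mem : ∀ t, t₀ ≤ t → (ψ t : E) ∈ M
  continuousOn : ContinuousOn (fun t => (ψ t : E)) (Ici t₀)
  deriv : ∀ t, t₀ ≤ t → t ∉ switchingTimes u →
    HasDerivWithinAt (fun s => (ψ s : E))
      ((H 0 t (ψ t) + ∑ l : Fin r, u t l • H l.succ t (ψ t) : D) : E) (Ici t₀) t

/-- The control system is a system on `M`: from every initial time and every initial state in
`M ∩ D`, each piecewise constant control steers along a trajectory which stays in `M ∩ D`. -/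
def IsSystemOn (M : Set E) : Prop :=
  ∀ (t₀ : ℝ) (ψ₀ : D), (ψ₀ : E) ∈ M → ∀ u : ℝ → Fin r → ℝ, IsPiecewiseConstant u →
    ∃ ψ : ℝ → D, ψ t₀ = ψ₀ ∧ IsTrajectory H M t₀ u ψ

/-- The set `R_t(ψ₀)` of states reachable at time `t` from the state `ψ₀` at time `t₀`. -/
def reachableSet (M : Set E) (t₀ t : ℝ) (ψ₀ : D) : Set E :=
  {φ | ∃ u : ℝ → Fin r → ℝ, IsPiecewiseConstant u ∧
    ∃ ψ : ℝ → D, ψ t₀ = ψ₀ ∧ IsTrajectory H M t₀ u ψ ∧ (ψ t : E) = φ}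

/-- Strong analytic controllability on `M`, with initial time `t₀`:
`R_t(ψ₀) = M ∩ D` for all `t > t₀` and all `ψ₀ ∈ M ∩ D`. -/
def StronglyAnalyticallyControllable (M : Set E) (t₀ : ℝ) : Prop :=
  ∀ ψ₀ : D, (ψ₀ : E) ∈ M → ∀ t, t₀ < t → reachableSet H M t₀ t ψ₀ = M ∩ (D : Set E)

end algebras

end QuantumControl

/-!
The Hilbert space is regarded as a real Hilbert space. Write `Q` for the set of states `M ∩ D` and
`N` (`chartSet`) for the points near which `closure Q = closure M` is an `m`-dimensional
submanifold; `N` is connected and contains `M`. Since the operators are skew-Hermitian, solutions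
with constant controls extend to isometries of the closed span of `Q`. Their compositions are the
evolution operators `Evo`, and `IsSystemOn.exists_control` realizes each of them on `Q` by a
piecewise constant control. So it suffices to find an evolution operator from time `t₀` to time
`t₁` that takes one given state to another. The other operators that occur are vector fields on
`N`, and are used only through their integral curves there.

**Density.** For a state `x`, let `W z` be the supremum of `⟪z, T x⟫` over the evolution operators
`T` from time `t'` to time `t` (`supp`). This is a sublinear functional, so by Hahn–Banach it is
supported at each `q` by some vector `p` of the closed span of `Q` (`IsOpt`). Call an operator
null if `⟪A q, p⟫ = 0` for all such pairs. A tangent null operator has integral curves in `N` for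
all times, along which `W` is constant (`supp_eq_of_isCurve`, `exists_isCurve_of_isNull`):
constancy of `W` means that evolution operators steer the start of a curve close to its limit
point and back, and limits of these isometries transport a chart, so that the limit point lies in
`N` (`mem_chartSet_of_supp_eq`). It follows that commutators of null operators are null
(`IsNull.commutator`). At the times where the functions `W` of time are differentiable
(`goodTimes`; these times are dense, since drift changes `W` at a bounded rate) the control
operators are null (`isNull_control`), because arbitrarily strong controls move the states along
their flows in arbitrarily short time. Likewise `δ X = -[H₀, X] + ∂X/∂t` is null whenever `X` and
`[X, δ X]` are null at all good times (`isNull_drift`). By assumption `𝓑` contains, pointwise in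
time, its commutators with `𝓒`, so the families with null values contain an ideal of `𝓒` with the
generators in it, and `IsDiffGenerated.mem_of_ideal` shows that all of `𝓒` is null. By the rank
condition null operators then span the tangent spaces, so `W` is constant on the connected set
`N`. As `W` is at least `1` at a reachable state, it is at least `1` everywhere, which means that
the reachable set is dense (`exists_evo_norm_sub_lt`).

**Interior.** Varying the switching times of a piecewise constant control gives finite-dimensional
families of reachable states (`IsAccess`). Take one whose derivative has maximal rank
(`IsMaxAccess`). A further switching time (`IsAccess.switch`) cannot raise the rank, so at all
later states the range of the derivative, transported there, contains the values of the control
operators, and with a family `X` also those of `δ X` (`IsAlong.deriv`) and of the brackets `[H_l,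
X]`. Hence it contains the values of `𝓒` (`IsDiffGenerated.mem_of_stable`), its dimension is `m`,
and by the inverse function theorem the states near some state `y` are all reachable, exactly and
at the same time (`IsAccess.exists_evo_of_finrank`).

**Exactness.** By density some evolution operator `T` on the remaining time interval brings `y`
close to the target `z`. As `T` is an isometry, it takes a compact neighbourhood of `y` in
`closure Q`, whose radius does not depend on `T`, to a set that contains a neighbourhood of `T y`
of the same radius, by an open-closed argument in a chart at `z`. This set contains `z`, so `z` is
reached exactly (`IsControlSystem.exists_evo_eq`).
-/

set_option linter.unusedSectionVars false

namespace QuantumControl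

section Hilbert

variable {E : Type*} [NormedAddCommGroup E] [InnerProductSpace ℝ E]

/-! ### Curves in a real Hilbert space -/

/-- If the velocity of `u` has inner product at most `C ‖u‖` with `u`, then `‖u‖` grows at
rate at most `C`. -/
lemma norm_le_add_of_inner_deriv_le {u u' : ℝ → E} {a b C : ℝ} (hab : a ≤ b)
    (hu : ContinuousOn u (Icc a b)) (hd : ∀ s ∈ Ioo a b, HasDerivAt u (u' s) s) (hC : 0 ≤ C)
    (hb : ∀ s ∈ Ioo a b, ⟪u s, u' s⟫_ℝ ≤ C * ‖u s‖) : ‖u b‖ ≤ ‖u a‖ + C * (b - a) := by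
  -- `‖u‖` need not be differentiable at its zeros, so `√(‖u‖² + ε²)` is used instead
  have key : ∀ ε > 0, ‖u b‖ ≤ ‖u a‖ + ε + C * (b - a) := by
    intro ε hε
    set F : ℝ → ℝ := fun s => √(⟪u s, u s⟫_ℝ + ε ^ 2) with hF
    have hpos : ∀ s, 0 < ⟪u s, u s⟫_ℝ + ε ^ 2 := fun s => by
      have := real_inner_self_nonneg (x := u s); positivity
    have hFd : ∀ s ∈ Ioo a b, HasDerivAt F
        ((⟪u s, u' s⟫_ℝ + ⟪u' s, u s⟫_ℝ) / (2 * √(⟪u s, u s⟫_ℝ + ε ^ 2))) s := by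
      intro s hs
      exact (((hd s hs).inner ℝ (hd s hs)).add_const _).sqrt (hpos s).ne'
    have hmain := Convex.image_sub_le_mul_sub_of_deriv_le (convex_Icc a b) (f := F) (C := C)
      ((((hu.inner hu).add continuousOn_const)).sqrt)
      (by
        intro s hs
        rw [interior_Icc] at hs
        exact (hFd s hs).differentiableAt.differentiableWithinAt)
      (by
        intro s hs
        rw [interior_Icc] at hs
        rw [(hFd s hs).deriv, div_le_iff₀ (by have := Real.sqrt_pos.2 (hpos s); positivity)]
        have h1 := hb s hs
        have h2 : ‖u s‖ ≤ √(⟪u s, u s⟫_ℝ + ε ^ 2) := by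
          apply Real.le_sqrt_of_sq_le
          rw [real_inner_self_eq_norm_sq]; nlinarith
        rw [real_inner_comm (u s) (u' s)]
        nlinarith)
      a (left_mem_Icc.2 hab) b (right_mem_Icc.2 hab) hab
    have h1 : ‖u b‖ ≤ F b := by
      apply Real.le_sqrt_of_sq_le
      rw [real_inner_self_eq_norm_sq]; nlinarith
    have h2 : F a ≤ ‖u a‖ + ε := by
      apply Real.sqrt_le_iff.2
      refine ⟨by positivity, ?_⟩
      rw [real_inner_self_eq_norm_sq]; nlinarith [norm_nonneg (u a)]
    linarith
  refine le_of_forall_pos_le_add fun ε hε => ?_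
  have := key ε hε
  linarith

/-- Two curves with `⟪u', v⟫ + ⟪u, v'⟫ = 0`, off a countable set, have constant inner product. -/
lemma inner_eq_of_deriv_skew [CompleteSpace E] {u v u' v' : ℝ → E} {a b : ℝ} (hab : a ≤ b)
    {c : Set ℝ} (hc : c.Countable)
    (hu : ContinuousOn u (Icc a b)) (hv : ContinuousOn v (Icc a b))
    (hud : ∀ s ∈ Ioo a b \ c, HasDerivAt u (u' s) s)
    (hvd : ∀ s ∈ Ioo a b \ c, HasDerivAt v (v' s) s)
    (h0 : ∀ s ∈ Ioo a b \ c, ⟪u' s, v s⟫_ℝ + ⟪u s, v' s⟫_ℝ = 0) :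
    ⟪u b, v b⟫_ℝ = ⟪u a, v a⟫_ℝ := by
  have := MeasureTheory.integral_eq_of_hasDerivAt_off_countable
    (fun s => ⟪u s, v s⟫_ℝ) (fun _ => 0) (a := a) (b := b) hc
    (by rw [uIcc_of_le hab]; exact hu.inner hv)
    (by
      rw [min_eq_left hab, max_eq_right hab]
      intro s hs
      have := (hud s hs).inner ℝ (hvd s hs)
      rw [add_comm, h0 s hs] at this
      exact this)
    intervalIntegrable_const
  simp only [intervalIntegral.integral_zero] at this
  linarith

/-- Derivatives of a family of functionals pass from a set of vectors to its closed span: if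
`s ↦ g s x` has derivative `κ s x` for all `x ∈ X`, where the `κ s` are uniformly bounded,
then so it is for all `x` in the closed span of `X` for which `κ · x` is continuous. -/
lemma hasDerivWithinAt_of_mem_closure_span {X : Set E} {g κ : ℝ → E →L[ℝ] ℝ} {a b C : ℝ}
    (hκ : ∀ s ∈ Icc a b, ∀ x, |κ s x| ≤ C * ‖x‖)
    (hX : ∀ x ∈ X, ∀ s ∈ Icc a b, HasDerivWithinAt (fun s => g s x) (κ s x) (Icc a b) s)
    {x : E} (hx : x ∈ (Submodule.span ℝ X).topologicalClosure)
    (hxc : ContinuousOn (fun s => κ s x) (Icc a b)) :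
    ∀ s ∈ Icc a b, HasDerivWithinAt (fun s => g s x) (κ s x) (Icc a b) s := by
  have hspan : ∀ x ∈ Submodule.span ℝ X, ∀ s ∈ Icc a b,
      HasDerivWithinAt (fun s => g s x) (κ s x) (Icc a b) s := by
    intro x hx
    induction hx using Submodule.span_induction with
    | mem x hx => exact hX x hx
    | zero => intro s _; simpa using hasDerivWithinAt_const s (Icc a b) (0 : ℝ)
    | add x y _ _ hx hy =>
      intro s hs
      simp only [map_add]
      exact (hx s hs).add (hy s hs)
    | smul c x _ hx =>
      intro s hs
      simp only [map_smul, smul_eq_mul]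
      exact (hx s hs).const_mul c
  intro s hs
  -- the mean value inequality on short intervals, for vectors of the span approximating `x`
  rw [hasDerivWithinAt_iff_isLittleO, Asymptotics.isLittleO_iff]
  intro ε hε
  have hc := hxc s hs
  rw [Metric.continuousWithinAt_iff] at hc
  obtain ⟨δ, hδ, hδ'⟩ := hc ε hε
  filter_upwards [inter_mem_nhdsWithin (Icc a b) (Metric.ball_mem_nhds s hδ)] with s' hs'
  have hconv : Convex ℝ (Icc a b ∩ Metric.ball s δ) := (convex_Icc a b).inter (convex_ball s δ)
  obtain ⟨z, hz, hzx⟩ := mem_closure_iff_seq_limit.1 hx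
  have h1 : ∀ n, ‖g s' (z n) - s' * κ s x - (g s (z n) - s * κ s x)‖
      ≤ (C * ‖z n - x‖ + ε) * ‖s' - s‖ := by
    intro n
    refine Convex.norm_image_sub_le_of_norm_hasDerivWithin_le
      (f := fun σ => g σ (z n) - σ * κ s x) (f' := fun σ => κ σ (z n) - 1 * κ s x)
      (s := Icc a b ∩ Metric.ball s δ) ?_ ?_ hconv ⟨hs, Metric.mem_ball_self hδ⟩ hs'
    · intro σ hσ
      refine HasDerivWithinAt.sub ((hspan (z n) (hz n) σ hσ.1).mono inter_subset_left) ?_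
      exact (hasDerivWithinAt_id _ _).mul_const _
    · intro σ hσ
      have h2 := hκ σ hσ.1 (z n - x)
      have h3 := hδ' hσ.1 hσ.2
      rw [Real.dist_eq] at h3
      rw [map_sub] at h2
      have : κ σ (z n) - 1 * κ s x = (κ σ (z n) - κ σ x) + (κ σ x - κ s x) := by ring
      rw [Real.norm_eq_abs, this]
      exact (abs_add_le _ _).trans (add_le_add h2 h3.le)
  have hlim : ∀ σ, Tendsto (fun n => g σ (z n)) atTop (𝓝 (g σ x)) := fun σ =>
    ((g σ).continuous.tendsto x).comp hzx
  have h4 : Tendsto (fun n => ‖g s' (z n) - s' * κ s x - (g s (z n) - s * κ s x)‖) atTop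
      (𝓝 ‖g s' x - s' * κ s x - (g s x - s * κ s x)‖) :=
    (((hlim s').sub_const _).sub ((hlim s).sub_const _)).norm
  have h5 : Tendsto (fun n => (C * ‖z n - x‖ + ε) * ‖s' - s‖) atTop
      (𝓝 ((C * ‖x - x‖ + ε) * ‖s' - s‖)) :=
    ((((hzx.sub_const x).norm).const_mul C).add_const ε).mul_const _
  have h6 := le_of_tendsto_of_tendsto' h4 h5 h1
  rw [sub_self, norm_zero, mul_zero, zero_add] at h6
  refine le_of_eq_of_le ?_ h6
  congr 1
  simp only [smul_eq_mul]
  ring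

/-! ### Isometric extension -/

/-- A map that preserves inner products on a set `S` extends to a bounded operator that preserves
inner products on the closed span of `S`. -/
lemma exists_clm_of_inner_eq [CompleteSpace E] {S : Set E} {T : E → E}
    (hT : ∀ x ∈ S, ∀ y ∈ S, ⟪T x, T y⟫_ℝ = ⟪x, y⟫_ℝ) :
    ∃ T' : E →L[ℝ] E, (∀ x ∈ S, T' x = T x) ∧ (∀ x, ‖T' x‖ ≤ ‖x‖) ∧
      ∀ x ∈ (Submodule.span ℝ S).topologicalClosure,
        ∀ y ∈ (Submodule.span ℝ S).topologicalClosure, ⟪T' x, T' y⟫_ℝ = ⟪x, y⟫_ℝ := by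
  set f : (S →₀ ℝ) →ₗ[ℝ] E := Finsupp.linearCombination ℝ (fun x : S => T x)
  set g : (S →₀ ℝ) →ₗ[ℝ] E := Finsupp.linearCombination ℝ (fun x : S => (x : E))
  have hfg : ∀ u v, ⟪f u, f v⟫_ℝ = ⟪g u, g v⟫_ℝ := by
    intro u v
    simp only [f, g, Finsupp.linearCombination_apply, Finsupp.sum, sum_inner, inner_sum,
      real_inner_smul_left, real_inner_smul_right]
    refine Finset.sum_congr rfl fun i _ => Finset.sum_congr rfl fun j _ => ?_
    rw [hT j j.2 i i.2]
  have hnorm : ∀ u, ‖f u‖ = ‖g u‖ := by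
    intro u
    rw [@norm_eq_sqrt_real_inner _ _ _ (f u), @norm_eq_sqrt_real_inner _ _ _ (g u), hfg]
  have hker : LinearMap.ker g ≤ LinearMap.ker f := by
    intro u hu
    rw [LinearMap.mem_ker] at hu ⊢
    rw [← norm_eq_zero, hnorm, hu, norm_zero]
  have hrange : LinearMap.range g = Submodule.span ℝ S := by
    rw [Finsupp.range_linearCombination, Subtype.range_coe]
  set L : LinearMap.range g →ₗ[ℝ] E :=
    ((LinearMap.ker g).liftQ f hker) ∘ₗ (g.quotKerEquivRange.symm : _ →ₗ[ℝ] _)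
  have hL : ∀ u, L ⟨g u, u, rfl⟩ = f u := by
    intro u
    have : g.quotKerEquivRange.symm ⟨g u, u, rfl⟩ = (LinearMap.ker g).mkQ u :=
      g.quotKerEquivRange_symm_apply_image u _
    simp [L, this]
  have hLnorm : ∀ w : LinearMap.range g, ‖L w‖ = ‖w‖ := by
    rintro ⟨_, u, rfl⟩
    rw [hL, hnorm]; rfl
  set K := (LinearMap.range g).topologicalClosure
  set e : LinearMap.range g →ₗᵢ[ℝ] K :=
    ⟨Submodule.inclusion (Submodule.le_topologicalClosure _), fun x => rfl⟩
  have hdense : DenseRange e := by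
    intro x
    rw [Metric.mem_closure_range_iff]
    intro ε hε
    obtain ⟨y, hy, hxy⟩ := Metric.mem_closure_iff.1 x.2 ε hε
    exact ⟨⟨y, hy⟩, hxy⟩
  have hui : IsUniformInducing e := e.isometry.isUniformInducing
  set Lc : LinearMap.range g →L[ℝ] E := (⟨L, hLnorm⟩ : LinearMap.range g →ₗᵢ[ℝ] E).toContinuousLinearMap
  set L' : K →L[ℝ] E := Lc.extend e.toContinuousLinearMap
  have hL' : ∀ w, L' (e w) = L w := fun w =>
    ContinuousLinearMap.extend_eq Lc hdense hui w
  have hnorm' : ∀ w : K, ‖L' w‖ = ‖w‖ := by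
    intro w
    refine hdense.induction_on (p := fun w => ‖L' w‖ = ‖w‖) w ?_ ?_
    · exact isClosed_eq L'.continuous.norm continuous_norm
    · intro w; rw [hL', hLnorm]; rfl
  set I : K →ₗᵢ[ℝ] E := ⟨L'.toLinearMap, hnorm'⟩
  have : CompleteSpace K := (Submodule.isClosed_topologicalClosure _).completeSpace_coe
  have hKm : ∀ x ∈ (Submodule.span ℝ S).topologicalClosure, x ∈ K := by
    intro x hx; rw [← hrange] at hx; exact hx
  have hproj : ∀ x (hx : x ∈ K), K.orthogonalProjectionOnto x = ⟨x, hx⟩ := fun x hx =>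
    K.orthogonalProjectionOnto_mem_subspace_eq_self ⟨x, hx⟩
  refine ⟨L' ∘L K.orthogonalProjectionOnto, ?_, ?_, ?_⟩
  · intro x hx
    have hxg : g (Finsupp.single ⟨x, hx⟩ 1) = x := by simp [g]
    have hxK : x ∈ K := Submodule.le_topologicalClosure _ ⟨_, hxg⟩
    have h1 : (⟨x, hxK⟩ : K) = e ⟨g (Finsupp.single ⟨x, hx⟩ 1), _, rfl⟩ := by
      exact Subtype.ext hxg.symm
    rw [ContinuousLinearMap.comp_apply, hproj x hxK, h1, hL', hL]
    simp [f]
  · intro x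
    rw [ContinuousLinearMap.comp_apply, hnorm']
    exact Submodule.norm_orthogonalProjectionOnto_apply_le K x
  · intro x hx y hy
    rw [ContinuousLinearMap.comp_apply, ContinuousLinearMap.comp_apply, hproj x (hKm x hx),
      hproj y (hKm y hy)]
    exact I.inner_map_map _ _

end Hilbert

/-! ### Compactness and separability in metric spaces -/

/-- An isometric self-embedding of a compact set is surjective. -/
lemma surjOn_of_isCompact_of_dist_eq {E : Type*} [MetricSpace E] {Q : Set E} (hQ : IsCompact Q)
    {T : E → E} (hm : MapsTo T Q Q) (hT : ∀ x ∈ Q, ∀ y ∈ Q, dist (T x) (T y) = dist x y) :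
    SurjOn T Q Q := by
  intro z hz
  by_contra hcon
  have hcont : ContinuousOn T Q := by
    rw [Metric.continuousOn_iff]
    intro x hx ε hε
    exact ⟨ε, hε, fun y hy h => by rwa [hT y hy x hx]⟩
  have hcl : IsClosed (T '' Q) := (hQ.image_of_continuousOn hcont).isClosed
  obtain ⟨δ, hδ, hball⟩ := Metric.isOpen_iff.1 hcl.isOpen_compl z hcon
  -- the iterates of `z` stay at mutual distance `≥ δ`
  have hiter : ∀ n, T^[n] z ∈ Q := fun n => hm.iterate n hz
  have hdist : ∀ n k, dist (T^[n] z) (T^[n + (k + 1)] z) = dist z (T^[k + 1] z) := by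
    intro n k
    induction n with
    | zero => simp
    | succ n ih =>
      rw [Function.iterate_succ_apply', add_right_comm n 1 (k + 1), Function.iterate_succ_apply',
        hT _ (hiter _) _ (hiter _), ih]
  have hfar : ∀ n k, δ ≤ dist (T^[n] z) (T^[n + (k + 1)] z) := by
    intro n k
    rw [hdist]
    by_contra h
    have : T^[k + 1] z ∈ Metric.ball z δ := by rw [Metric.mem_ball, dist_comm]; exact not_le.1 h
    refine hball this ⟨T^[k] z, hiter k, ?_⟩
    rw [Function.iterate_succ_apply']
  obtain ⟨y, -, φ, hφ, hlim⟩ := hQ.tendsto_subseq hiter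
  have hc := hlim.cauchySeq
  obtain ⟨N, hN⟩ := Metric.cauchySeq_iff.1 hc δ hδ
  have h1 := hN N le_rfl (N + 1) (by omega)
  have h2 : φ N < φ (N + 1) := hφ (Nat.lt_succ_self N)
  obtain ⟨k, hk⟩ : ∃ k, φ (N + 1) = φ N + (k + 1) := ⟨φ (N + 1) - φ N - 1, by omega⟩
  have h3 := hfar (φ N) k
  rw [← hk] at h3
  exact absurd h1 (not_lt.2 h3)

/-- A connected, locally separable subset of a metric space is separable. -/
lemma isSeparable_of_isPreconnected {E : Type*} [PseudoMetricSpace E] {N : Set E}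
    (hN : IsPreconnected N)
    (hloc : ∀ x ∈ N, ∃ r > 0, TopologicalSpace.IsSeparable (Metric.ball x r ∩ N)) :
    TopologicalSpace.IsSeparable N := by
  rcases N.eq_empty_or_nonempty with rfl | ⟨x₀, hx₀⟩
  · exact ⟨∅, countable_empty, empty_subset _⟩
  -- `S (n + 1)` is the union of the separable balls of rational radius centred at a countable
  -- dense subset of `S n`
  choose c hcc hc using fun S : {S : Set E // TopologicalSpace.IsSeparable S} => S.2
  let rad : Set ℝ := range (fun k : ℚ => (k : ℝ))
  have hradc : rad.Countable := countable_range _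
  have hstep : ∀ S : {S : Set E // TopologicalSpace.IsSeparable S},
      ∃ S' : {S : Set E // TopologicalSpace.IsSeparable S},
      ∀ x ∈ N, ∀ r > 0, TopologicalSpace.IsSeparable (Metric.ball x r ∩ N) →
        (∃ w ∈ S.1, dist x w < r / 8) → Metric.ball x (r / 8) ∩ N ⊆ S'.1 := by
    intro S
    refine ⟨⟨⋃ p ∈ {p : E × ℝ | p ∈ c S ×ˢ rad ∧
      TopologicalSpace.IsSeparable (Metric.ball p.1 p.2 ∩ N)}, Metric.ball p.1 p.2 ∩ N, ?_⟩, ?_⟩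
    · have hct : {p : E × ℝ | p ∈ c S ×ˢ rad ∧
          TopologicalSpace.IsSeparable (Metric.ball p.1 p.2 ∩ N)}.Countable :=
        ((hcc S).prod hradc).mono fun p hp => hp.1
      rw [biUnion_eq_iUnion]
      have := hct.to_subtype
      exact TopologicalSpace.IsSeparable.iUnion fun p => p.2.2
    · rintro x hx r hr hsep ⟨w, hw, hxw⟩ y hy
      obtain ⟨k, hk1, hk2⟩ := exists_rat_btwn (show 3 * r / 8 < r / 2 by linarith)
      obtain ⟨d, hd, hwd⟩ := Metric.mem_closure_iff.1 (hc S hw) (r / 8) (by linarith)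
      have hxd : dist x d < r / 4 := by linarith [dist_triangle x w d]
      simp only [mem_iUnion]
      refine ⟨(d, (k : ℝ)), ⟨⟨hd, k, rfl⟩, ?_⟩, ?_, hy.2⟩
      · refine hsep.mono (inter_subset_inter_left _ fun w hw => ?_)
        have := dist_triangle w d x
        rw [Metric.mem_ball] at hw ⊢
        rw [dist_comm d x] at this
        linarith
      · have h1 := dist_triangle y x d
        have h2 := Metric.mem_ball.1 hy.1
        rw [Metric.mem_ball]
        linarith
  choose next hnext using hstep
  obtain ⟨r₀, hr₀, hsep₀⟩ := hloc x₀ hx₀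
  let S : ℕ → {S : Set E // TopologicalSpace.IsSeparable S} := fun n => next^[n] ⟨_, hsep₀⟩
  have hS : ∀ n, S (n + 1) = next (S n) := fun n => Function.iterate_succ_apply' _ _ _
  refine (TopologicalSpace.IsSeparable.iUnion fun n => (S n).2).mono ?_
  have hball : ∀ x ∈ N, x ∈ closure (⋃ n, (S n).1) →
      ∃ r > 0, Metric.ball x r ∩ N ⊆ ⋃ n, (S n).1 := by
    intro x hx hxc
    obtain ⟨r, hr, hsep⟩ := hloc x hx
    obtain ⟨w, hw, hxw⟩ := Metric.mem_closure_iff.1 hxc (r / 8) (by linarith)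
    obtain ⟨n, hn⟩ := mem_iUnion.1 hw
    refine ⟨r / 8, by linarith, (hnext (S n) x hx r hr hsep ⟨w, hn, hxw⟩).trans ?_⟩
    rw [← hS]
    exact subset_iUnion (fun n => (S n).1) (n + 1)
  have : PreconnectedSpace N := isPreconnected_iff_preconnectedSpace.1 hN
  have hclopen : IsClopen {x : N | (x : E) ∈ ⋃ n, (S n).1} := by
    constructor
    · rw [← closure_subset_iff_isClosed]
      intro x hx
      obtain ⟨r, hr, hsub⟩ := hball x x.2 (by
        have := image_closure_subset_closure_image continuous_subtype_val (mem_image_of_mem _ hx)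
        refine closure_mono ?_ this
        rintro _ ⟨y, hy, rfl⟩
        exact hy)
      exact hsub ⟨Metric.mem_ball_self hr, x.2⟩
    · rw [Metric.isOpen_iff]
      intro x hx
      obtain ⟨r, hr, hsub⟩ := hball x x.2 (subset_closure hx)
      exact ⟨r, hr, fun y hy => hsub ⟨hy, y.2⟩⟩
  have huniv := hclopen.eq_univ
    ⟨⟨x₀, hx₀⟩, mem_iUnion.2 ⟨0, ⟨Metric.mem_ball_self hr₀, hx₀⟩⟩⟩
  intro x hx
  have : (⟨x, hx⟩ : N) ∈ {x : N | (x : E) ∈ ⋃ n, (S n).1} := by rw [huniv]; trivial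
  exact this

section Charts

variable {E : Type*} [NormedAddCommGroup E] [InnerProductSpace ℝ E] {m : ℕ}

/-! ### Charts -/

/-- Near `p`, the set `S` is an embedded `m`-dimensional submanifold. -/
def LocalChart (m : ℕ) (S : Set E) (p : E) : Prop :=
  ∃ (V : Set (EuclideanSpace ℝ (Fin m))) (W : Set E)
    (f : EuclideanSpace ℝ (Fin m) → E) (g : E → EuclideanSpace ℝ (Fin m)),
    IsOpen V ∧ IsOpen W ∧ p ∈ W ∧ ContDiffOn ℝ ∞ f V ∧
    (∀ x ∈ V, Function.Injective (fderiv ℝ f x)) ∧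
    f '' V = S ∩ W ∧ LeftInvOn g f V ∧ ContinuousOn g (S ∩ W)

/-- The points near which `S` is an embedded submanifold. -/
def chartSet (m : ℕ) (S : Set E) : Set E := {p ∈ S | LocalChart m S p}

lemma LocalChart.exists_nhd_subset {S : Set E} {p : E} (h : LocalChart m S p) :
    ∃ W, IsOpen W ∧ p ∈ W ∧ S ∩ W ⊆ chartSet m S := by
  obtain ⟨V, W, f, g, hV, hW, hp, h1⟩ := h
  exact ⟨W, hW, hp, fun q hq => ⟨hq.1, V, W, f, g, hV, hW, hq.2, h1⟩⟩

/-- An embedded submanifold is locally closed, so it coincides with its closure near each of its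
points. -/
lemma LocalChart.closure {S : Set E} {p : E} (hp : p ∈ S) (h : LocalChart m S p) :
    LocalChart m (closure S) p := by
  obtain ⟨V, W, f, g, hV, hW, hpW, hf, hinj, him, hgf, hg⟩ := h
  obtain ⟨x₀, hx₀, rfl⟩ : p ∈ f '' V := by rw [him]; exact ⟨hp, hpW⟩
  obtain ⟨r, hr, hball⟩ := Metric.isOpen_iff.1 hV x₀ hx₀
  have hcb : Metric.closedBall x₀ (r / 2) ⊆ V :=
    (Metric.closedBall_subset_ball (by linarith)).trans hball
  have hbb : Metric.ball x₀ (r / 2) ⊆ V := Metric.ball_subset_closedBall.trans hcb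
  have hK : IsCompact (f '' Metric.closedBall x₀ (r / 2)) :=
    (isCompact_closedBall _ _).image_of_continuousOn (hf.continuousOn.mono hcb)
  obtain ⟨O, hO, hOeq⟩ := continuousOn_iff'.1 hg (Metric.ball x₀ (r / 2)) Metric.isOpen_ball
  have hSW : S ∩ (W ∩ O) = f '' Metric.ball x₀ (r / 2) := by
    ext y
    constructor
    · rintro ⟨hyS, hyW, hyO⟩
      have hy : y ∈ g ⁻¹' Metric.ball x₀ (r / 2) ∩ (S ∩ W) := by rw [hOeq]; exact ⟨hyO, hyS, hyW⟩
      obtain ⟨x, hx, rfl⟩ : y ∈ f '' V := by rw [him]; exact ⟨hyS, hyW⟩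
      have := hy.1
      rw [mem_preimage, hgf hx] at this
      exact ⟨x, this, rfl⟩
    · rintro ⟨x, hx, rfl⟩
      have h1 : f x ∈ S ∩ W := by rw [← him]; exact ⟨x, hbb hx, rfl⟩
      have : f x ∈ g ⁻¹' Metric.ball x₀ (r / 2) ∩ (S ∩ W) := by
        refine ⟨?_, h1⟩
        rw [mem_preimage, hgf (hbb hx)]; exact hx
      rw [hOeq] at this
      exact ⟨h1.1, h1.2, this.1⟩
  have hcl : _root_.closure S ∩ (W ∩ O) = S ∩ (W ∩ O) := by
    refine Subset.antisymm ?_ (inter_subset_inter_left _ subset_closure)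
    have h1 : _root_.closure S ∩ (W ∩ O) ⊆ _root_.closure (S ∩ (W ∩ O)) := by
      rw [inter_comm, inter_comm S]
      exact (hW.inter hO).inter_closure
    have h2 : _root_.closure (S ∩ (W ∩ O)) ⊆ f '' Metric.closedBall x₀ (r / 2) := by
      refine closure_minimal ?_ hK.isClosed
      rw [hSW]
      exact image_mono Metric.ball_subset_closedBall
    intro y hy
    obtain ⟨x, hx, rfl⟩ := h2 (h1 hy)
    have h3 : f x ∈ S ∩ W := by rw [← him]; exact ⟨x, hcb hx, rfl⟩
    exact ⟨h3.1, hy.2⟩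
  refine ⟨Metric.ball x₀ (r / 2), W ∩ O, f, g, Metric.isOpen_ball, hW.inter hO, ?_, hf.mono hbb,
    fun x hx => hinj x (hbb hx), ?_, hgf.mono hbb, ?_⟩
  · have : f x₀ ∈ S ∩ (W ∩ O) := by
      rw [hSW]; exact ⟨x₀, Metric.mem_ball_self (by linarith), rfl⟩
    exact this.2
  · rw [hcl, hSW]
  · rw [hcl]; exact hg.mono fun y hy => ⟨hy.1, hy.2.1⟩

/-- The coordinates `x ↦ (⟪v j, x⟫)_j`. -/
noncomputable def coordMap (v : Fin m → E) : E →L[ℝ] EuclideanSpace ℝ (Fin m) :=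
  ∑ j, (ContinuousLinearMap.toSpanSingleton ℝ (EuclideanSpace.single j (1 : ℝ))).comp
    (innerSL ℝ (v j))

@[simp] lemma coordMap_apply (v : Fin m → E) (x : E) (j : Fin m) :
    coordMap v x j = ⟪v j, x⟫_ℝ := by
  simp [coordMap, Pi.single_apply]

lemma continuous_coordMap : Continuous (coordMap : (Fin m → E) → _) := by
  unfold coordMap
  refine continuous_finsetSum _ fun j _ => ?_
  exact continuous_const.clm_comp ((innerSL ℝ).continuous.comp (continuous_apply j))

/-- Near `U`, the set `S` is the graph-like image of `G`, the inverse of the coordinates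
`coordMap v`. -/
structure IsGraphChart (S : Set E) (v : Fin m → E) (Ω : Set (EuclideanSpace ℝ (Fin m)))
    (G : EuclideanSpace ℝ (Fin m) → E) (U : Set E) : Prop where
  isOpen_dom : IsOpen Ω
  isOpen_nhd : IsOpen U
  contDiffOn : ContDiffOn ℝ 2 G Ω
  coord_mem : ∀ x ∈ S ∩ U, coordMap v x ∈ Ω
  apply_coord : ∀ x ∈ S ∩ U, G (coordMap v x) = x
  mem : ∀ ξ ∈ Ω, G ξ ∈ S ∩ U
  coord_apply : ∀ ξ ∈ Ω, coordMap v (G ξ) = ξ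
  subset : S ∩ U ⊆ chartSet m S

/-- An embedded submanifold has, near each of its points, coordinates of the form `⟪v j, ·⟫` with
`v j` in a given dense subspace `D`. -/
theorem LocalChart.exists_isGraphChart {S : Set E} {p : E} (hp : p ∈ S) (h : LocalChart m S p)
    {D : Submodule ℝ E} (hD : Dense (D : Set E)) :
    ∃ v Ω G U, (∀ j, v j ∈ D) ∧ IsGraphChart (m := m) S v Ω G U ∧ p ∈ U := by
  obtain ⟨V, W, f, g, hV, hW, hpW, hf, hinj, him, hgf, hg⟩ := h
  obtain ⟨x₀, hx₀, rfl⟩ : p ∈ f '' V := by rw [him]; exact ⟨hp, hpW⟩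
  have hfat : ∀ x ∈ V, ContDiffAt ℝ ∞ f x := fun x hx => hf.contDiffAt (hV.mem_nhds hx)
  set T := fderiv ℝ f x₀ with hT
  -- the coordinates `⟪T e_j, ·⟫` are non-degenerate on the tangent space, hence so are nearby ones
  have hopen : IsOpen {v : Fin m → E | IsUnit (coordMap v ∘L T)} := by
    have hcont : Continuous fun v : Fin m → E => coordMap v ∘L T :=
      (ContinuousLinearMap.compL ℝ _ _ _).flip T |>.continuous.comp continuous_coordMap
    exact Units.isOpen.preimage hcont
  have hne : {v : Fin m → E | IsUnit (coordMap v ∘L T)}.Nonempty := by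
    refine ⟨fun j => T (EuclideanSpace.single j 1), ?_⟩
    set Q := coordMap (fun j => T (EuclideanSpace.single j (1 : ℝ))) ∘L T
    have hQ : Function.Injective Q := by
      rw [injective_iff_map_eq_zero]
      intro x hx
      have h1 : ∀ j, ⟪T (EuclideanSpace.single j 1), T x⟫_ℝ = 0 := by
        intro j
        have := congrArg (fun y : EuclideanSpace ℝ (Fin m) => y j) hx
        simpa [Q] using this
      have h2 : x = ∑ j, x j • EuclideanSpace.single j (1 : ℝ) := by
        ext i; simp [Pi.single_apply]
      have h3 : ⟪T x, T x⟫_ℝ = 0 := by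
        nth_rewrite 1 [h2]
        simp [sum_inner, real_inner_smul_left, h1]
      have h4 : T x = T 0 := by rw [map_zero]; exact inner_self_eq_zero.1 h3
      exact hinj x₀ hx₀ h4
    have hb : Function.Bijective Q := ⟨hQ, LinearMap.surjective_of_injective (f := Q.toLinearMap) hQ⟩
    exact ContinuousLinearMap.isUnit_iff_bijective.2 hb
  have hdense : Dense {v : Fin m → E | ∀ j, v j ∈ D} := by
    have := dense_pi (univ : Set (Fin m)) (s := fun _ => (D : Set E)) (fun _ _ => hD)
    convert this using 1
    ext v; simp
  obtain ⟨v, hv, hvD⟩ := hdense.inter_open_nonempty _ hopen hne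
  obtain ⟨Q, hQ⟩ := hv
  set A := ContinuousLinearEquiv.unitsEquiv ℝ (EuclideanSpace ℝ (Fin m)) Q with hA
  set h : EuclideanSpace ℝ (Fin m) → EuclideanSpace ℝ (Fin m) := fun x => coordMap v (f x) with hh
  have hhc : ContDiffAt ℝ 2 h x₀ :=
    (coordMap v).contDiff.contDiffAt.comp x₀ ((hfat x₀ hx₀).of_le (WithTop.coe_le_coe.2 le_top))
  have hhd : HasFDerivAt h (A : EuclideanSpace ℝ (Fin m) →L[ℝ] EuclideanSpace ℝ (Fin m)) x₀ := by
    have h1 : (A : EuclideanSpace ℝ (Fin m) →L[ℝ] EuclideanSpace ℝ (Fin m)) = coordMap v ∘L T := by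
      rw [← hQ]; rfl
    rw [h1]
    exact (coordMap v).hasFDerivAt.comp x₀ ((hfat x₀ hx₀).differentiableAt (by simp)).hasFDerivAt
  set e := hhc.toOpenPartialHomeomorph h hhd (by simp) with he
  have hecoe : ∀ x, e x = h x := fun x => rfl
  have hx₀e : x₀ ∈ e.source := hhc.mem_toOpenPartialHomeomorph_source hhd (by simp)
  have hesymm : ContDiffAt ℝ 2 e.symm (h x₀) := hhc.to_localInverse hhd (by simp)
  have hev : ∀ᶠ ξ in 𝓝 (h x₀), ξ ∈ e.target ∧ ContDiffAt ℝ 2 e.symm ξ ∧ e.symm ξ ∈ V := by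
    have h0 : ∀ᶠ ξ in 𝓝 (h x₀), ξ ∈ e.target := e.open_target.mem_nhds (e.map_source hx₀e)
    refine h0.and ((hesymm.eventually (by simp)).and ?_)
    refine hesymm.continuousAt.eventually_mem (hV.mem_nhds ?_)
    have : e.symm (e x₀) = x₀ := e.left_inv hx₀e
    rw [hecoe] at this
    rw [this]; exact hx₀
  obtain ⟨Ω, hΩ, hΩo, hxΩ⟩ := eventually_nhds_iff.1 hev
  have hV'o : IsOpen (e.source ∩ e ⁻¹' Ω ∩ V) := (e.isOpen_inter_preimage hΩo).inter hV
  obtain ⟨O, hO, hOeq⟩ := continuousOn_iff'.1 hg _ hV'o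
  refine ⟨v, Ω, fun ξ => f (e.symm ξ), W ∩ O, hvD, ⟨hΩo, hW.inter hO, ?_, ?_, ?_, ?_, ?_,
    ?_⟩, hpW, ?_⟩
  · intro ξ hξ
    exact (((hfat _ (hΩ ξ hξ).2.2).of_le (WithTop.coe_le_coe.2 le_top)).comp ξ
      (hΩ ξ hξ).2.1).contDiffWithinAt
  · rintro x ⟨hxS, hxW, hxO⟩
    obtain ⟨y, hy, rfl⟩ : x ∈ f '' V := by rw [him]; exact ⟨hxS, hxW⟩
    have : f y ∈ g ⁻¹' (e.source ∩ e ⁻¹' Ω ∩ V) ∩ (S ∩ W) := by rw [hOeq]; exact ⟨hxO, hxS, hxW⟩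
    have h1 := this.1
    rw [mem_preimage, hgf hy] at h1
    exact h1.1.2
  · rintro x ⟨hxS, hxW, hxO⟩
    obtain ⟨y, hy, rfl⟩ : x ∈ f '' V := by rw [him]; exact ⟨hxS, hxW⟩
    have : f y ∈ g ⁻¹' (e.source ∩ e ⁻¹' Ω ∩ V) ∩ (S ∩ W) := by rw [hOeq]; exact ⟨hxO, hxS, hxW⟩
    have h1 := this.1
    rw [mem_preimage, hgf hy] at h1
    have h2 : e.symm (e y) = y := e.left_inv h1.1.1
    change f (e.symm (e y)) = f y
    rw [h2]
  · intro ξ hξ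
    obtain ⟨h1, -, h2⟩ := hΩ ξ hξ
    have h3 : f (e.symm ξ) ∈ S ∩ W := by rw [← him]; exact ⟨_, h2, rfl⟩
    have : f (e.symm ξ) ∈ g ⁻¹' (e.source ∩ e ⁻¹' Ω ∩ V) ∩ (S ∩ W) := by
      refine ⟨?_, h3⟩
      rw [mem_preimage, hgf h2]
      refine ⟨⟨e.map_target h1, ?_⟩, h2⟩
      rw [mem_preimage, e.right_inv h1]; exact hξ
    rw [hOeq] at this
    exact ⟨h3.1, h3.2, this.1⟩
  · intro ξ hξ
    exact e.right_inv (hΩ ξ hξ).1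
  · exact fun x hx => ⟨hx.1, V, W, f, g, hV, hW, hx.2.1, hf, hinj, him, hgf, hg⟩
  · have : f x₀ ∈ g ⁻¹' (e.source ∩ e ⁻¹' Ω ∩ V) ∩ (S ∩ W) := by
      refine ⟨?_, hp, hpW⟩
      rw [mem_preimage, hgf hx₀]
      exact ⟨⟨hx₀e, hxΩ⟩, hx₀⟩
    rw [hOeq] at this
    exact this.1

/-- Points of `chartSet m S` have compact neighbourhoods in `S`. -/
lemma exists_isCompact_closedBall {S : Set E} {p : E} (hp : p ∈ chartSet m S) :
    ∃ r > 0, IsCompact (S ∩ Metric.closedBall p r) ∧ S ∩ Metric.closedBall p r ⊆ chartSet m S := by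
  obtain ⟨W, hW, hpW, hsub⟩ := hp.2.exists_nhd_subset
  obtain ⟨v, Ω, G, U, -, hG, hpU⟩ := hp.2.exists_isGraphChart hp.1 (D := ⊤) (by simp)
  obtain ⟨ρ, hρ, hball⟩ := Metric.isOpen_iff.1 hG.isOpen_dom _ (hG.coord_mem p ⟨hp.1, hpU⟩)
  have hnhd : W ∩ U ∩ coordMap v ⁻¹' Metric.ball (coordMap v p) (ρ / 2) ∈ 𝓝 p :=
    ((hW.inter hG.isOpen_nhd).inter (Metric.isOpen_ball.preimage (coordMap v).continuous)).mem_nhds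
      ⟨⟨hpW, hpU⟩, Metric.mem_ball_self (by linarith)⟩
  obtain ⟨r, hr, hrs⟩ := Metric.nhds_basis_closedBall.mem_iff.1 hnhd
  have hcb : Metric.closedBall (coordMap v p) (ρ / 2) ⊆ Ω :=
    (Metric.closedBall_subset_ball (by linarith)).trans hball
  refine ⟨r, hr, ?_, fun x hx => hsub ⟨hx.1, (hrs hx.2).1.1⟩⟩
  have : S ∩ Metric.closedBall p r
      = G '' Metric.closedBall (coordMap v p) (ρ / 2) ∩ Metric.closedBall p r := by
    ext x
    constructor
    · rintro ⟨hxS, hx⟩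
      exact ⟨⟨coordMap v x, Metric.ball_subset_closedBall (hrs hx).2,
        hG.apply_coord x ⟨hxS, (hrs hx).1.2⟩⟩, hx⟩
    · rintro ⟨⟨ξ, hξ, rfl⟩, hx⟩
      exact ⟨(hG.mem ξ (hcb hξ)).1, hx⟩
  rw [this]
  exact ((isCompact_closedBall _ _).image_of_continuousOn
    (hG.contDiffOn.continuousOn.mono hcb)).inter_right Metric.isClosed_closedBall

lemma isSeparable_chartSet {S : Set E} (hN : IsPreconnected (chartSet m S)) :
    TopologicalSpace.IsSeparable (chartSet m S) := by
  refine isSeparable_of_isPreconnected hN fun x hx => ?_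
  obtain ⟨r, hr, hc, -⟩ := exists_isCompact_closedBall hx
  exact ⟨r, hr, hc.isSeparable.mono fun y hy => ⟨hy.2.1, Metric.ball_subset_closedBall hy.1⟩⟩

end Charts

section Limits

variable {E : Type*} [NormedAddCommGroup E] [InnerProductSpace ℝ E] {m : ℕ}

/-! ### Limits of isometries of a closed set -/

lemma dist_eq_of_inner_eq {S : Set E} {T : E → E}
    (hT : ∀ a ∈ S, ∀ b ∈ S, ⟪T a, T b⟫_ℝ = ⟪a, b⟫_ℝ) {a b : E} (ha : a ∈ S) (hb : b ∈ S) :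
    dist (T a) (T b) = dist a b := by
  rw [dist_eq_norm, dist_eq_norm, ← sq_eq_sq₀ (norm_nonneg _) (norm_nonneg _),
    ← real_inner_self_eq_norm_sq, ← real_inner_self_eq_norm_sq]
  simp only [inner_sub_left, inner_sub_right, hT a ha a ha, hT a ha b hb, hT b hb a ha, hT b hb b hb]

/-- A chart is transported by an inner-product preserving bijection between relatively open
pieces of `S`. -/
lemma LocalChart.of_image [CompleteSpace E] {S : Set E} {x y : E} {r : ℝ} {T T' : E → E}
    (hxy : ∀ a ∈ S ∩ Metric.closedBall x r, T a ∈ S ∩ Metric.closedBall y r)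
    (hyx : ∀ b ∈ S ∩ Metric.closedBall y r, T' b ∈ S ∩ Metric.closedBall x r)
    (hTi : ∀ a ∈ S ∩ Metric.closedBall x r, ∀ b ∈ S ∩ Metric.closedBall x r,
      ⟪T a, T b⟫_ℝ = ⟪a, b⟫_ℝ)
    (hl : ∀ a ∈ S ∩ Metric.closedBall x r, T' (T a) = a)
    (hr : ∀ b ∈ S ∩ Metric.closedBall y r, T (T' b) = b)
    (hTx : T x = y) (hrpos : 0 < r) (hxS : x ∈ S) (hx : LocalChart m S x) : LocalChart m S y := by
  have hyi : ∀ a ∈ S ∩ Metric.closedBall y r, ∀ b ∈ S ∩ Metric.closedBall y r,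
      ⟪T' a, T' b⟫_ℝ = ⟪a, b⟫_ℝ := fun a ha b hb => by
    rw [← hTi _ (hyx a ha) _ (hyx b hb), hr a ha, hr b hb]
  have hxK : x ∈ S ∩ Metric.closedBall x r := ⟨hxS, Metric.mem_closedBall_self hrpos.le⟩
  have hyK : y ∈ S ∩ Metric.closedBall y r := by rw [← hTx]; exact hTx ▸ hxy x hxK
  have hTy : T' y = x := by rw [← hTx, hl x hxK]
  obtain ⟨A, hA, -, -⟩ := exists_clm_of_inner_eq hTi
  obtain ⟨B, hB, -, -⟩ := exists_clm_of_inner_eq hyi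
  obtain ⟨V, W, f, g, hV, hW, hxW, hf, hinj, him, hgf, hg⟩ := hx
  have hfS : ∀ v ∈ V, f v ∈ S ∩ W := fun v hv => him ▸ mem_image_of_mem f hv
  have hVo : IsOpen (V ∩ f ⁻¹' Metric.ball x r) :=
    hf.continuousOn.isOpen_inter_preimage hV Metric.isOpen_ball
  have hWo : IsOpen (B ⁻¹' W ∩ Metric.ball y r) :=
    (hW.preimage B.continuous).inter Metric.isOpen_ball
  have hmem : ∀ v ∈ V ∩ f ⁻¹' Metric.ball x r, f v ∈ S ∩ Metric.closedBall x r :=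
    fun v hv => ⟨(hfS v hv.1).1, Metric.ball_subset_closedBall hv.2⟩
  have hBA : ∀ a ∈ S ∩ Metric.closedBall x r, B (A a) = a := fun a ha => by
    rw [hA a ha, hB _ (hxy a ha), hl a ha]
  have hmemy : ∀ b ∈ S ∩ (B ⁻¹' W ∩ Metric.ball y r),
      b ∈ S ∩ Metric.closedBall y r ∧ B b = T' b ∧ B b ∈ S ∩ W ∧ B b ∈ Metric.ball x r := by
    rintro b ⟨hbS, hbW, hb⟩
    have hbK : b ∈ S ∩ Metric.closedBall y r := ⟨hbS, Metric.ball_subset_closedBall hb⟩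
    refine ⟨hbK, hB b hbK, ⟨?_, hbW⟩, ?_⟩
    · rw [hB b hbK]; exact (hyx b hbK).1
    · rw [hB b hbK, Metric.mem_ball]
      nth_rewrite 1 [← hTy]
      rw [dist_eq_of_inner_eq hyi hbK hyK]; exact hb
  refine ⟨V ∩ f ⁻¹' Metric.ball x r, B ⁻¹' W ∩ Metric.ball y r, fun v => A (f v), fun b => g (B b),
    hVo, hWo, ⟨?_, Metric.mem_ball_self hrpos⟩, ?_, ?_, ?_, ?_, ?_⟩
  · rw [mem_preimage, hB y hyK, hTy]; exact hxW
  · exact A.contDiff.comp_contDiffOn (hf.mono inter_subset_left)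
  · intro v hv
    have hfd : HasFDerivAt f (fderiv ℝ f v) v :=
      ((hf.contDiffAt (hV.mem_nhds hv.1)).differentiableAt (by simp)).hasFDerivAt
    have h1 : HasFDerivAt (fun v => A (f v)) (A ∘L fderiv ℝ f v) v := A.hasFDerivAt.comp v hfd
    have h2 : HasFDerivAt (fun v => B (A (f v))) (B ∘L (A ∘L fderiv ℝ f v)) v :=
      B.hasFDerivAt.comp v h1
    have h3 : (fun v => B (A (f v))) =ᶠ[𝓝 v] f := by
      filter_upwards [hVo.mem_nhds hv] with w hw using hBA _ (hmem w hw)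
    have h4 := h2.unique (hfd.congr_of_eventuallyEq h3)
    rw [h1.fderiv]
    intro a b hab
    apply hinj v hv.1
    rw [← h4]
    simp only [ContinuousLinearMap.comp_apply] at hab ⊢
    rw [hab]
  · ext b
    constructor
    · rintro ⟨v, hv, rfl⟩
      have h1 := hmem v hv
      change A (f v) ∈ _
      have h2 := hBA _ h1
      refine ⟨?_, ?_, ?_⟩
      · rw [hA _ h1]; exact (hxy _ h1).1
      · rw [mem_preimage, h2]; exact (hfS v hv.1).2
      · rw [hA _ h1, Metric.mem_ball, ← hTx, dist_eq_of_inner_eq hTi h1 hxK]; exact hv.2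
    · intro hb
      obtain ⟨hbK, hBb, hbSW, hbx⟩ := hmemy b hb
      rw [← him] at hbSW
      obtain ⟨v, hv, hvb⟩ := hbSW
      refine ⟨v, ⟨hv, ?_⟩, ?_⟩
      · rw [mem_preimage, hvb]; exact hbx
      · change A (f v) = b
        rw [hvb, hBb, hA _ (hyx b hbK), hr b hbK]
  · intro v hv
    change g (B (A (f v))) = v
    rw [hBA _ (hmem v hv), hgf hv.1]
  · exact hg.comp B.continuous.continuousOn fun b hb => (hmemy b hb).2.2.1

/-- If isometries `T n` of `S` carry a point `x` of `chartSet m S` towards `y` and isometries `T' n`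
carry `y` back towards `x`, then `y` belongs to `chartSet m S` too: limits of the `T n` and the
`T' n` along an ultrafilter transport a chart from `x` to `y`. -/
theorem mem_chartSet_of_tendsto [CompleteSpace E] {S : Set E} (hS : IsClosed S) {x y : E}
    (hx : x ∈ chartSet m S) (hy : y ∈ S) {T T' : ℕ → E → E} (hTS : ∀ n, MapsTo (T n) S S)
    (hTi : ∀ n, ∀ a ∈ S, ∀ b ∈ S, ⟪T n a, T n b⟫_ℝ = ⟪a, b⟫_ℝ)
    (hTS' : ∀ n, MapsTo (T' n) S S)
    (hTi' : ∀ n, ∀ a ∈ S, ∀ b ∈ S, ⟪T' n a, T' n b⟫_ℝ = ⟪a, b⟫_ℝ)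
    (hT : Tendsto (fun n => T n x) atTop (𝓝 y)) (hT' : Tendsto (fun n => T' n y) atTop (𝓝 x)) :
    y ∈ chartSet m S := by
  obtain ⟨r, hr, hK, -⟩ := exists_isCompact_closedBall hx
  have hxS := hx.1
  set U : Ultrafilter ℕ := hyperfilter ℕ
  have hU : (U : Filter ℕ) ≤ atTop := Nat.hyperfilter_le_atTop
  have hTU := hT.mono_left hU
  have hTU' := hT'.mono_left hU
  -- a pointwise limit of `T' n` exists on `S ∩ closedBall y (r / 2)` by compactness near `x`
  have hlim' : ∀ b ∈ S ∩ Metric.closedBall y (r / 2), ∃ c ∈ S,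
      Tendsto (fun n => T' n b) U (𝓝 c) := by
    intro b hb
    have hev : ∀ᶠ n in (U : Filter ℕ), T' n b ∈ S ∩ Metric.closedBall x r := by
      filter_upwards [hTU'.eventually (Metric.ball_mem_nhds x (half_pos hr))] with n hn
      refine ⟨hTS' n hb.1, ?_⟩
      have h1 : dist (T' n b) (T' n y) ≤ r / 2 := by
        rw [dist_eq_of_inner_eq (hTi' n) hb.1 hy]; exact hb.2
      have := dist_triangle (T' n b) (T' n y) x
      rw [Metric.mem_closedBall]; linarith
    obtain ⟨c, hc, hlim⟩ := hK.ultrafilter_le_nhds (U.map fun n => T' n b)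
      (by rw [le_principal_iff]; exact hev)
    exact ⟨c, hc.1, hlim⟩
  -- a pointwise limit of `T n` exists, as `T' k ∘ T n` takes values in a compact set near `x`
  have hlim : ∀ a ∈ S ∩ Metric.closedBall x (r / 2), ∃ c ∈ S,
      Tendsto (fun n => T n a) U (𝓝 c) := by
    intro a ha
    obtain ⟨k, hk⟩ := (hTU'.eventually (Metric.ball_mem_nhds x (show 0 < r / 8 by linarith))).exists
    have hev : ∀ᶠ n in (U : Filter ℕ), T' k (T n a) ∈ S ∩ Metric.closedBall x r := by
      filter_upwards [hTU.eventually (Metric.ball_mem_nhds y (show 0 < r / 8 by linarith))]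
        with n hn
      refine ⟨hTS' k (hTS n ha.1), ?_⟩
      have h1 : dist (T' k (T n a)) (T' k (T n x)) ≤ r / 2 := by
        rw [dist_eq_of_inner_eq (hTi' k) (hTS n ha.1) (hTS n hxS),
          dist_eq_of_inner_eq (hTi n) ha.1 hxS]
        exact ha.2
      have h2 : dist (T' k (T n x)) (T' k y) < r / 8 := by
        rw [dist_eq_of_inner_eq (hTi' k) (hTS n hxS) hy]; exact hn
      have h3 := dist_triangle4 (T' k (T n a)) (T' k (T n x)) (T' k y) x
      rw [Metric.mem_closedBall]; linarith
    obtain ⟨c, hc, hlim⟩ := hK.ultrafilter_le_nhds (U.map fun n => T' k (T n a))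
      (by rw [le_principal_iff]; exact hev)
    have hlim2 : Tendsto (fun n => T' k (T n a)) U (𝓝 c) := hlim
    have hcau : Cauchy (map (fun n => T n a) (U : Filter ℕ)) := by
      rw [Metric.cauchy_iff]
      refine ⟨inferInstance, fun ε hε => ?_⟩
      refine ⟨_, image_mem_map (hlim2.eventually (Metric.ball_mem_nhds c (half_pos hε))), ?_⟩
      rintro _ ⟨n, hn, rfl⟩ _ ⟨n', hn', rfl⟩
      change dist (T' k (T n a)) c < ε / 2 at hn
      change dist (T' k (T n' a)) c < ε / 2 at hn'
      rw [← dist_eq_of_inner_eq (hTi' k) (hTS n ha.1) (hTS n' ha.1)]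
      have := dist_triangle_right (T' k (T n a)) (T' k (T n' a)) c
      linarith
    obtain ⟨d, hd⟩ := cauchy_map_iff_exists_tendsto.1 hcau
    exact ⟨d, hS.mem_of_tendsto hd (Eventually.of_forall fun n => hTS n ha.1), hd⟩
  choose! R hRS hR using hlim
  choose! R' hRS' hR' using hlim'
  have hxK : x ∈ S ∩ Metric.closedBall x (r / 2) := ⟨hxS, Metric.mem_closedBall_self (by linarith)⟩
  have hyK : y ∈ S ∩ Metric.closedBall y (r / 2) := ⟨hy, Metric.mem_closedBall_self (by linarith)⟩
  have hRx : R x = y := tendsto_nhds_unique (hR x hxK) hTU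
  have hRy : R' y = x := tendsto_nhds_unique (hR' y hyK) hTU'
  have hRi : ∀ a ∈ S ∩ Metric.closedBall x (r / 2), ∀ b ∈ S ∩ Metric.closedBall x (r / 2),
      ⟪R a, R b⟫_ℝ = ⟪a, b⟫_ℝ := fun a ha b hb => by
    refine tendsto_nhds_unique ((hR a ha).inner (hR b hb)) ?_
    simp only [fun n => hTi n a ha.1 b hb.1]
    exact tendsto_const_nhds
  have hRi' : ∀ a ∈ S ∩ Metric.closedBall y (r / 2), ∀ b ∈ S ∩ Metric.closedBall y (r / 2),
      ⟪R' a, R' b⟫_ℝ = ⟪a, b⟫_ℝ := fun a ha b hb => by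
    refine tendsto_nhds_unique ((hR' a ha).inner (hR' b hb)) ?_
    simp only [fun n => hTi' n a ha.1 b hb.1]
    exact tendsto_const_nhds
  have hRm : ∀ a ∈ S ∩ Metric.closedBall x (r / 2), R a ∈ S ∩ Metric.closedBall y (r / 2) :=
    fun a ha => ⟨hRS a ha, by
      rw [Metric.mem_closedBall, ← hRx, dist_eq_of_inner_eq hRi ha hxK]; exact ha.2⟩
  have hRm' : ∀ a ∈ S ∩ Metric.closedBall y (r / 2), R' a ∈ S ∩ Metric.closedBall x (r / 2) :=
    fun a ha => ⟨hRS' a ha, by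
      rw [Metric.mem_closedBall, ← hRy, dist_eq_of_inner_eq hRi' ha hyK]; exact ha.2⟩
  have hK2 : IsCompact (S ∩ Metric.closedBall x (r / 2)) := by
    have : S ∩ Metric.closedBall x (r / 2)
        = (S ∩ Metric.closedBall x r) ∩ Metric.closedBall x (r / 2) := by
      rw [inter_assoc, inter_eq_right.2 (Metric.closedBall_subset_closedBall (by linarith))]
    rw [this]
    exact hK.inter_right Metric.isClosed_closedBall
  -- the isometric self-map `R' ∘ R` of a compact set is onto, and `R'` is injective
  have hsurj := surjOn_of_isCompact_of_dist_eq hK2 (T := fun a => R' (R a))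
    (fun a ha => hRm' _ (hRm a ha)) (fun a ha b hb => by
      rw [dist_eq_of_inner_eq hRi' (hRm a ha) (hRm b hb), dist_eq_of_inner_eq hRi ha hb])
  have hRsurj : ∀ b ∈ S ∩ Metric.closedBall y (r / 2), ∃ a ∈ S ∩ Metric.closedBall x (r / 2),
      R a = b := by
    intro b hb
    obtain ⟨a, ha, hab⟩ := hsurj (hRm' b hb)
    refine ⟨a, ha, ?_⟩
    rw [← dist_eq_zero, ← dist_eq_of_inner_eq hRi' (hRm a ha) hb, dist_eq_zero]; exact hab
  choose! R'' hR''m hR'' using hRsurj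
  refine ⟨hy, hx.2.of_image hRm hR''m hRi (fun a ha => ?_) hR'' hRx (half_pos hr) hxS⟩
  rw [← dist_eq_zero, ← dist_eq_of_inner_eq hRi (hR''m _ (hRm a ha)) ha, dist_eq_zero]
  exact hR'' _ (hRm a ha)

end Limits

section Operators

variable {E : Type*} [NormedAddCommGroup E] [InnerProductSpace ℝ E] {m : ℕ}
  {D : Submodule ℝ E} {Q : Set E}

/-! ### Skew operators tangent to the state manifold -/

/-- `Q` is a set of unit vectors in the dense subspace `D`, and near each point of `Q` its closure
is an `m`-dimensional submanifold. -/
structure IsStateSet (m : ℕ) (D : Submodule ℝ E) (Q : Set E) : Prop where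
  dense : Dense (D : Set E)
  subset : Q ⊆ D
  subset_chartSet : Q ⊆ chartSet m (closure Q)
  norm_eq : ∀ x ∈ Q, ‖x‖ = 1

/-- The weak extension of a skew operator `A` on `D`, that is, the adjoint of `-A`; its value is
`0` outside of the domain of the adjoint. -/
noncomputable def weakExt (A : Module.End ℝ D) (x : E) : E :=
  open Classical in
  if h : ∃ e : E, ∀ v : D, ⟪(v : E), e⟫_ℝ = -⟪(A v : E), x⟫_ℝ then h.choose else 0

/-- Equality in the real sense of `A` with minus its formal adjoint. -/
def IsSkew (A : Module.End ℝ D) : Prop := ∀ φ ψ : D, ⟪(A φ : E), (ψ : E)⟫_ℝ = -⟪(φ : E), (A ψ : E)⟫_ℝ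

lemma weakExt_eq (hD : Dense (D : Set E)) {A : Module.End ℝ D} {x e : E}
    (h : ∀ v : D, ⟪(v : E), e⟫_ℝ = -⟪(A v : E), x⟫_ℝ) : weakExt A x = e := by
  have h' : ∃ e : E, ∀ v : D, ⟪(v : E), e⟫_ℝ = -⟪(A v : E), x⟫_ℝ := ⟨e, h⟩
  have h1 : weakExt A x = h'.choose := by rw [weakExt, dif_pos h']
  rw [h1]
  refine hD.eq_of_inner_right ℝ fun v hv => ?_
  exact (h'.choose_spec ⟨v, hv⟩).trans (h ⟨v, hv⟩).symm

lemma weakExt_coe (hD : Dense (D : Set E)) {A : Module.End ℝ D} (hA : IsSkew A) (q : D) :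
    weakExt A q = A q :=
  weakExt_eq hD fun v => by rw [hA v q, neg_neg]

/-- The skew operator `A` is tangent to the manifold `closure Q` at the points of `Q`, as
expressed in charts. -/
structure IsTangent (m : ℕ) (Q : Set E) (A : Module.End ℝ D) : Prop where
  skew : IsSkew A
  tangent : ∀ q : D, (q : E) ∈ Q → ∀ (v : Fin m → E) (Ω : Set (EuclideanSpace ℝ (Fin m)))
    (G : EuclideanSpace ℝ (Fin m) → E) (U : Set E), IsGraphChart (closure Q) v Ω G U →
    (q : E) ∈ U → fderiv ℝ G (coordMap v q) (coordMap v (A q)) = A q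

namespace IsTangent

variable {A B : Module.End ℝ D}

lemma zero : IsTangent m Q (0 : Module.End ℝ D) :=
  ⟨fun φ ψ => by simp, fun q _ v Ω G U _ _ => by simp⟩

lemma add (hA : IsTangent m Q A) (hB : IsTangent m Q B) : IsTangent m Q (A + B) := by
  refine ⟨fun φ ψ => ?_, fun q hq v Ω G U hG hqU => ?_⟩
  · simp only [LinearMap.add_apply, Submodule.coe_add, inner_add_left, inner_add_right,
      hA.skew φ ψ, hB.skew φ ψ]
    ring
  · simp only [LinearMap.add_apply, Submodule.coe_add, map_add, hA.tangent q hq v Ω G U hG hqU,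
      hB.tangent q hq v Ω G U hG hqU]

lemma smul (hA : IsTangent m Q A) (c : ℝ) : IsTangent m Q (c • A) := by
  refine ⟨fun φ ψ => ?_, fun q hq v Ω G U hG hqU => ?_⟩
  · simp only [LinearMap.smul_apply, Submodule.coe_smul, real_inner_smul_left,
      real_inner_smul_right, hA.skew φ ψ]
    ring
  · simp only [LinearMap.smul_apply, Submodule.coe_smul, map_smul, hA.tangent q hq v Ω G U hG hqU]

lemma neg (hA : IsTangent m Q A) : IsTangent m Q (-A) := by
  have h : (-1 : ℝ) • A = -A := by ext x; simp
  exact h ▸ hA.smul (-1)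

lemma sub (hA : IsTangent m Q A) (hB : IsTangent m Q B) : IsTangent m Q (A - B) := by
  rw [sub_eq_add_neg]; exact hA.add hB.neg

/-- Pointwise limits of tangent operators are tangent. -/
lemma of_tendsto {ι : Type*} {l : Filter ι} [l.NeBot] {F : ι → Module.End ℝ D}
    (hF : ∀ᶠ i in l, IsTangent m Q (F i))
    (hlim : ∀ ψ : D, Tendsto (fun i => (F i ψ : E)) l (𝓝 (A ψ))) : IsTangent m Q A := by
  refine ⟨fun φ ψ => ?_, fun q hq v Ω G U hG hqU => ?_⟩
  · refine tendsto_nhds_unique_of_eventuallyEq ((hlim φ).inner tendsto_const_nhds)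
      (tendsto_const_nhds.inner (hlim ψ)).neg ?_
    filter_upwards [hF] with i hi using hi.skew φ ψ
  · refine tendsto_nhds_unique_of_eventuallyEq ?_ (hlim q)
      (hF.mono fun i hi => hi.tangent q hq v Ω G U hG hqU)
    exact (((fderiv ℝ G (coordMap v q)).comp (coordMap v)).continuous.tendsto _).comp (hlim q)

end IsTangent

lemma IsStateSet.exists_chart (hQ : IsStateSet m D Q) {p : E} (hp : p ∈ chartSet m (closure Q)) :
    ∃ (v : Fin m → D) (Ω : Set (EuclideanSpace ℝ (Fin m))) (G : EuclideanSpace ℝ (Fin m) → E)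
      (U : Set E), IsGraphChart (closure Q) (fun j => (v j : E)) Ω G U ∧ p ∈ U := by
  obtain ⟨v, Ω, G, U, hv, hG, hpU⟩ := hp.2.exists_isGraphChart hp.1 hQ.dense
  exact ⟨fun j => ⟨v j, hv j⟩, Ω, G, U, hG, hpU⟩

namespace IsGraphChart

variable {A : Module.End ℝ D} {v : Fin m → D} {Ω : Set (EuclideanSpace ℝ (Fin m))}
  {G : EuclideanSpace ℝ (Fin m) → E} {U : Set E}

lemma continuousOn_fderiv {S : Set E} {v : Fin m → E} (hG : IsGraphChart S v Ω G U) :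
    ContinuousOn (fderiv ℝ G) Ω :=
  hG.contDiffOn.continuousOn_fderiv_of_isOpen hG.isOpen_dom (by norm_num)

lemma hasFDerivAt {S : Set E} {v : Fin m → E} (hG : IsGraphChart S v Ω G U)
    {ξ : EuclideanSpace ℝ (Fin m)} (hξ : ξ ∈ Ω) : HasFDerivAt G (fderiv ℝ G ξ) ξ :=
  ((hG.contDiffOn.contDiffAt (hG.isOpen_dom.mem_nhds hξ)).differentiableAt (by simp)).hasFDerivAt

lemma coordMap_fderiv {S : Set E} {v : Fin m → E} (hG : IsGraphChart S v Ω G U)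
    {ξ : EuclideanSpace ℝ (Fin m)} (hξ : ξ ∈ Ω) (w : EuclideanSpace ℝ (Fin m)) :
    coordMap v (fderiv ℝ G ξ w) = w := by
  have h1 : HasFDerivAt (fun η => coordMap v (G η)) (coordMap v ∘L fderiv ℝ G ξ) ξ :=
    (coordMap v).hasFDerivAt.comp ξ (hG.hasFDerivAt hξ)
  have h2 : (fun η => coordMap v (G η)) =ᶠ[𝓝 ξ] fun η => η := by
    filter_upwards [hG.isOpen_dom.mem_nhds hξ] with η hη using hG.coord_apply η hη
  have h3 := h1.unique ((hasFDerivAt_id ξ).congr_of_eventuallyEq h2)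
  exact congrArg (fun L => L w) h3

lemma contDiffAt {S : Set E} {v : Fin m → E} (hG : IsGraphChart S v Ω G U)
    {ξ : EuclideanSpace ℝ (Fin m)} (hξ : ξ ∈ Ω) : ContDiffAt ℝ 2 G ξ :=
  hG.contDiffOn.contDiffAt (hG.isOpen_dom.mem_nhds hξ)

/-- The velocity of a curve in the manifold is tangent to the manifold. -/
lemma fderiv_coordMap_of_hasDerivWithinAt {S : Set E} {v : Fin m → E}
    (hG : IsGraphChart S v Ω G U) {γ : ℝ → E} {Z : E} {s : Set ℝ} {t : ℝ} (hts : t ∈ s)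
    (hs : UniqueDiffWithinAt ℝ s t) (hγ : HasDerivWithinAt γ Z s t)
    (hS : ∀ᶠ τ in 𝓝[s] t, γ τ ∈ S) (htU : γ t ∈ U) :
    fderiv ℝ G (coordMap v (γ t)) (coordMap v Z) = Z := by
  have htS : γ t ∈ S := hS.self_of_nhdsWithin hts
  have hU : ∀ᶠ τ in 𝓝[s] t, γ τ ∈ U :=
    hγ.continuousWithinAt.eventually_mem (hG.isOpen_nhd.mem_nhds htU)
  have h1 : HasDerivWithinAt (fun τ => G (coordMap v (γ τ)))
      (fderiv ℝ G (coordMap v (γ t)) (coordMap v Z)) s t :=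
    (hG.hasFDerivAt (hG.coord_mem _ ⟨htS, htU⟩)).comp_hasDerivWithinAt t
      ((coordMap v).hasFDerivAt.comp_hasDerivWithinAt t hγ)
  refine (hs.eq_deriv _ h1 (hγ.congr_of_eventuallyEq ?_ ?_))
  · filter_upwards [hS, hU] with τ h1 h2 using hG.apply_coord _ ⟨h1, h2⟩
  · exact hG.apply_coord _ ⟨htS, htU⟩

lemma continuousOn_coordField (hG : IsGraphChart (closure Q) (fun j => (v j : E)) Ω G U) :
    ContinuousOn (fun x : E => fderiv ℝ G (coordMap (fun j => (v j : E)) x)) (closure Q ∩ U) :=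
  hG.continuousOn_fderiv.comp (coordMap _).continuous.continuousOn hG.coord_mem

/-- In a chart, the weak extension of a tangent operator is a vector field whose coordinates
are bounded linear functionals. -/
lemma weakExt_eq (hQ : IsStateSet m D Q)
    (hG : IsGraphChart (closure Q) (fun j => (v j : E)) Ω G U) (hA : IsTangent m Q A) {x : E}
    (hx : x ∈ closure Q ∩ U) : (∀ w : D, ⟪(w : E), weakExt A x⟫_ℝ = -⟪(A w : E), x⟫_ℝ) ∧
    weakExt A x = fderiv ℝ G (coordMap (fun j => (v j : E)) x)
      (-coordMap (fun j => (A (v j) : E)) x) := by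
  have key : ∀ w : D, ⟪(w : E), fderiv ℝ G (coordMap (fun j => (v j : E)) x)
      (-coordMap (fun j => (A (v j) : E)) x)⟫_ℝ = -⟪(A w : E), x⟫_ℝ := by
    intro w
    have h1 : EqOn (fun x => ⟪(w : E), fderiv ℝ G (coordMap (fun j => (v j : E)) x)
        (-coordMap (fun j => (A (v j) : E)) x)⟫_ℝ) (fun x => -⟪(A w : E), x⟫_ℝ) (Q ∩ U) := by
      rintro q ⟨hq, hqU⟩
      lift q to D using hQ.subset hq
      have h2 : -coordMap (fun j => (A (v j) : E)) (q : E) = coordMap (fun j => (v j : E)) (A q) := by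
        ext j
        simp [hA.skew (v j) q]
      simp only [h2]
      rw [hA.tangent q hq _ Ω G U hG hqU, hA.skew w q, neg_neg]
    refine h1.of_subset_closure (t := closure Q ∩ U) ?_ ?_ ?_ ?_ hx
    · exact continuousOn_const.inner (hG.continuousOn_coordField.clm_apply
        (coordMap _).continuous.neg.continuousOn)
    · exact (continuous_const.inner continuous_id).neg.continuousOn
    · exact inter_subset_inter_left _ subset_closure
    · rw [inter_comm, inter_comm Q]; exact hG.isOpen_nhd.inter_closure
  have h2 := QuantumControl.weakExt_eq hQ.dense key
  exact ⟨fun w => by rw [h2]; exact key w, h2⟩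

end IsGraphChart

namespace IsTangent

variable {A B : Module.End ℝ D}

lemma inner_weakExt (hQ : IsStateSet m D Q) (hA : IsTangent m Q A) {x : E}
    (hx : x ∈ chartSet m (closure Q)) (w : D) :
    ⟪(w : E), weakExt A x⟫_ℝ = -⟪(A w : E), x⟫_ℝ := by
  obtain ⟨v, Ω, G, U, hG, hxU⟩ := hQ.exists_chart hx
  exact (hG.weakExt_eq hQ hA ⟨hx.1, hxU⟩).1 w

/-- For a strongly continuous family of tangent operators, the extension is jointly continuous. -/
lemma continuousOn_weakExt_family (hQ : IsStateSet m D Q) {X : ℝ → Module.End ℝ D}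
    (hX : ∀ t, IsTangent m Q (X t)) (hc : ∀ ψ : D, Continuous fun t => (X t ψ : E)) :
    ContinuousOn (fun z : ℝ × E => weakExt (X z.1) z.2) (univ ×ˢ chartSet m (closure Q)) := by
  rintro ⟨t, x⟩ ⟨-, hx⟩
  obtain ⟨v, Ω, G, U, hG, hxU⟩ := hQ.exists_chart hx
  have h1 : ContinuousOn (fun z : ℝ × E => fderiv ℝ G (coordMap (fun j => (v j : E)) z.2)
      (-coordMap (fun j => (X z.1 (v j) : E)) z.2)) (univ ×ˢ (closure Q ∩ U)) := by
    refine ContinuousOn.clm_apply ?_ ?_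
    · exact hG.continuousOn_coordField.comp continuousOn_snd fun z hz => hz.2
    · refine (Continuous.clm_apply ?_ continuous_snd).neg.continuousOn
      exact continuous_coordMap.comp (continuous_pi fun j => (hc (v j)).comp continuous_fst)
  have h2 := h1 (t, x) ⟨mem_univ _, hx.1, hxU⟩
  have h3 : univ ×ˢ (closure Q ∩ U) ∈ 𝓝[univ ×ˢ chartSet m (closure Q)] (t, x) := by
    have : (univ ×ˢ U : Set (ℝ × E)) ∈ 𝓝 (t, x) :=
      (isOpen_univ.prod hG.isOpen_nhd).mem_nhds ⟨mem_univ _, hxU⟩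
    filter_upwards [self_mem_nhdsWithin, mem_nhdsWithin_of_mem_nhds this] with z hz hz'
    exact ⟨mem_univ _, hz.2.1, hz'.2⟩
  refine ((h2.mono_of_mem_nhdsWithin h3).congr_of_eventuallyEq ?_ ?_)
  · filter_upwards [h3] with z hz
    exact (hG.weakExt_eq hQ (hX z.1) hz.2).2
  · exact (hG.weakExt_eq hQ (hX t) ⟨hx.1, hxU⟩).2

lemma continuousOn_weakExt (hQ : IsStateSet m D Q) (hA : IsTangent m Q A) :
    ContinuousOn (weakExt A) (chartSet m (closure Q)) := by
  have := continuousOn_weakExt_family hQ (X := fun _ => A) (fun _ => hA) fun _ => continuous_const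
  exact this.comp (continuousOn_const (c := (0 : ℝ)).prodMk continuousOn_id)
    fun x hx => ⟨mem_univ _, hx⟩

/-- Two continuous functions on the manifold which agree at points of `Q` are equal. -/
lemma _root_.QuantumControl.IsStateSet.eqOn {F : Type*} [TopologicalSpace F] [T2Space F]
    (hQ : IsStateSet m D Q) {f g : E → F} (hf : ContinuousOn f (chartSet m (closure Q)))
    (hg : ContinuousOn g (chartSet m (closure Q))) (h : ∀ q : D, (q : E) ∈ Q → f q = g q) :
    EqOn f g (chartSet m (closure Q)) :=
  EqOn.of_subset_closure (fun q hq => h ⟨q, hQ.subset hq⟩ hq) hf hg hQ.subset_chartSet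
    fun _ hx => hx.1

lemma weakExt_add (hQ : IsStateSet m D Q) (hA : IsTangent m Q A) (hB : IsTangent m Q B) {x : E}
    (hx : x ∈ chartSet m (closure Q)) : weakExt (A + B) x = weakExt A x + weakExt B x :=
  QuantumControl.weakExt_eq hQ.dense fun v => by
    simp [inner_add_left, inner_add_right, hA.inner_weakExt hQ hx, hB.inner_weakExt hQ hx]; ring

lemma weakExt_smul (hQ : IsStateSet m D Q) (hA : IsTangent m Q A) (c : ℝ) {x : E}
    (hx : x ∈ chartSet m (closure Q)) : weakExt (c • A) x = c • weakExt A x :=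
  QuantumControl.weakExt_eq hQ.dense fun v => by
    simp [real_inner_smul_left, real_inner_smul_right, hA.inner_weakExt hQ hx]

lemma weakExt_neg (hQ : IsStateSet m D Q) (hA : IsTangent m Q A) {x : E}
    (hx : x ∈ chartSet m (closure Q)) : weakExt (-A) x = -weakExt A x := by
  have h : (-1 : ℝ) • A = -A := by ext x; simp
  have := hA.weakExt_smul hQ (-1) hx
  rwa [h, neg_one_smul ℝ (weakExt A x)] at this

/-- The extension of a tangent operator is skew on the manifold. -/
lemma inner_weakExt_add (hQ : IsStateSet m D Q) (hA : IsTangent m Q A) {x y : E}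
    (hx : x ∈ chartSet m (closure Q)) (hy : y ∈ chartSet m (closure Q)) :
    ⟪weakExt A x, y⟫_ℝ + ⟪x, weakExt A y⟫_ℝ = 0 := by
  have h1 := hQ.eqOn (f := fun x => ⟪weakExt A x, y⟫_ℝ + ⟪x, weakExt A y⟫_ℝ) (g := fun _ => 0)
    (((hA.continuousOn_weakExt hQ).inner continuousOn_const).add
      (continuousOn_id.inner continuousOn_const)) continuousOn_const
    (fun q _ => by
      rw [weakExt_coe hQ.dense hA.skew, hA.inner_weakExt hQ hy]; ring)
  exact h1 hx

/-- The commutator of two tangent operators is tangent: in coordinates it is the Lie bracket of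
vector fields, by symmetry of the second derivative of the chart. -/
theorem commutator (hQ : IsStateSet m D Q) (hA : IsTangent m Q A) (hB : IsTangent m Q B) :
    IsTangent m Q (A * B - B * A) := by
  refine ⟨fun φ ψ => ?_, fun q hq v' Ω' G' U' hG' hqU' => ?_⟩
  · simp only [LinearMap.sub_apply, Module.End.mul_apply, Submodule.coe_sub, inner_sub_left,
      inner_sub_right, hA.skew (B φ) ψ, hB.skew φ (A ψ), hB.skew (A φ) ψ, hA.skew φ (B ψ)]
    ring
  obtain ⟨v, Ω, G, U, hG, hqU⟩ := hQ.exists_chart (hQ.subset_chartSet hq)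
  set L := coordMap (fun j => (v j : E)) with hL
  have hqS : (q : E) ∈ closure Q ∩ U := ⟨subset_closure hq, hqU⟩
  set ξ := L (q : E) with hξdef
  have hξ : ξ ∈ Ω := hG.coord_mem _ hqS
  have hGξ : G ξ = q := hG.apply_coord _ hqS
  have hG1 := hG.hasFDerivAt hξ
  have hG2 : HasFDerivAt (fderiv ℝ G) (fderiv ℝ (fderiv ℝ G) ξ) ξ :=
    (((hG.contDiffAt hξ).fderiv_right (m := 1) (by norm_num)).differentiableAt
      (by simp)).hasFDerivAt
  have hsymm : IsSymmSndFDerivAt ℝ G ξ := (hG.contDiffAt hξ).isSymmSndFDerivAt (by simp)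
  -- `A C q` is the derivative in the direction `C q` of the vector field extending `A`
  have key : ∀ {A C : Module.End ℝ D}, IsTangent m Q A → IsTangent m Q C → ∃ w,
      (A (C q) : E) = fderiv ℝ (fderiv ℝ G) ξ (L (C q)) (L (A q)) + fderiv ℝ G ξ w := by
    intro A C hA hC
    set a := -coordMap (fun j => (A (v j) : E)) with ha
    have haq : a q = L (A q) := by
      ext j
      simp [ha, hL, hA.skew (v j) q]
    have hCq : fderiv ℝ G ξ (L (C q)) = C q := hC.tangent q hq _ Ω G U hG hqU
    refine ⟨a (C q), ?_⟩
    have h1 : HasFDerivAt (fun η => fderiv ℝ G η (a (G η)))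
        ((fderiv ℝ G ξ).comp (a.comp (fderiv ℝ G ξ)) +
          (fderiv ℝ (fderiv ℝ G) ξ).flip (a (G ξ))) ξ :=
      hG2.clm_apply (a.hasFDerivAt.comp ξ hG1)
    refine hQ.dense.eq_of_inner_right ℝ fun w hw => ?_
    have h2 : HasFDerivAt (fun η => ⟪w, fderiv ℝ G η (a (G η))⟫_ℝ) _ ξ :=
      (innerSL ℝ w).hasFDerivAt.comp ξ h1
    have h3 : HasFDerivAt (fun η => -⟪(A ⟨w, hw⟩ : E), G η⟫_ℝ) _ ξ :=
      ((innerSL ℝ (A ⟨w, hw⟩ : E)).hasFDerivAt.comp ξ hG1).neg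
    have h4 : (fun η => ⟪w, fderiv ℝ G η (a (G η))⟫_ℝ) =ᶠ[𝓝 ξ]
        fun η => -⟪(A ⟨w, hw⟩ : E), G η⟫_ℝ := by
      filter_upwards [hG.isOpen_dom.mem_nhds hξ] with η hη
      have h5 := hG.weakExt_eq hQ hA (hG.mem η hη)
      have h6 := h5.1 ⟨w, hw⟩
      rw [h5.2, hG.coord_apply η hη] at h6
      exact h6
    have h5 := congrArg (fun T => T (L (C q))) (h2.unique (h3.congr_of_eventuallyEq h4))
    simp only [ContinuousLinearMap.comp_apply, add_apply,
      neg_apply, ContinuousLinearMap.flip_apply, innerSL_apply_apply, hCq, hGξ,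
      haq] at h5
    rw [add_comm, h5, hA.skew ⟨w, hw⟩ (C q), neg_neg]
  obtain ⟨w₁, h₁⟩ := key hA hB
  obtain ⟨w₂, h₂⟩ := key hB hA
  have hZ : ((A * B - B * A) q : E) = fderiv ℝ G ξ (w₁ - w₂) := by
    simp only [LinearMap.sub_apply, Module.End.mul_apply, Submodule.coe_sub, h₁, h₂, map_sub,
      hsymm (L (B q)) (L (A q))]
    abel
  have hcurve : HasDerivAt (fun s : ℝ => ξ + s • (w₁ - w₂)) (w₁ - w₂) 0 := by
    simpa using ((hasDerivAt_id (0 : ℝ)).smul_const (w₁ - w₂)).const_add ξ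
  have h0 : ξ + (0 : ℝ) • (w₁ - w₂) = ξ := by simp
  have hγ : HasDerivAt (fun s : ℝ => G (ξ + s • (w₁ - w₂))) (fderiv ℝ G ξ (w₁ - w₂)) 0 := by
    refine HasFDerivAt.comp_hasDerivAt (0 : ℝ) ?_ hcurve
    rw [h0]; exact hG1
  have hS : ∀ᶠ s in 𝓝 (0 : ℝ), G (ξ + s • (w₁ - w₂)) ∈ closure Q := by
    have : ∀ᶠ s in 𝓝 (0 : ℝ), ξ + s • (w₁ - w₂) ∈ Ω :=
      hcurve.continuousAt.eventually_mem (by rw [h0]; exact hG.isOpen_dom.mem_nhds hξ)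
    filter_upwards [this] with s hs using (hG.mem _ hs).1
  have hfin := hG'.fderiv_coordMap_of_hasDerivWithinAt (mem_univ (0 : ℝ)) uniqueDiffWithinAt_univ
    hγ.hasDerivWithinAt (by rw [nhdsWithin_univ]; exact hS) (by simp only [h0, hGξ]; exact hqU')
  simp only [h0, hGξ] at hfin
  rw [hZ]; exact hfin

/-- The extension of a commutator. -/
lemma inner_weakExt_commutator (hQ : IsStateSet m D Q) (hA : IsTangent m Q A)
    (hB : IsTangent m Q B) {x y : E} (hx : x ∈ chartSet m (closure Q))
    (hy : y ∈ chartSet m (closure Q)) :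
    ⟪weakExt A x, weakExt B y⟫_ℝ - ⟪weakExt B x, weakExt A y⟫_ℝ
      = ⟪x, weakExt (B * A - A * B) y⟫_ℝ := by
  have hBA := hB.commutator hQ hA
  have hconst : ∀ {C : Module.End ℝ D} (z : E), IsTangent m Q C →
      ContinuousOn (fun x => ⟪weakExt C x, z⟫_ℝ) (chartSet m (closure Q)) :=
    fun z hC => (hC.continuousOn_weakExt hQ).inner continuousOn_const
  have hconst' : ∀ {C : Module.End ℝ D} (z : E), IsTangent m Q C →
      ContinuousOn (fun x => ⟪z, weakExt C x⟫_ℝ) (chartSet m (closure Q)) :=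
    fun z hC => continuousOn_const.inner (hC.continuousOn_weakExt hQ)
  have h1 := hQ.eqOn (f := fun x => ⟪weakExt A x, weakExt B y⟫_ℝ - ⟪weakExt B x, weakExt A y⟫_ℝ)
    (g := fun x => ⟪x, weakExt (B * A - A * B) y⟫_ℝ) ((hconst _ hA).sub (hconst _ hB))
    (continuousOn_id.inner continuousOn_const) (fun q hq => ?_)
  · exact h1 hx
  have hqN := hQ.subset_chartSet hq
  have h2 := hQ.eqOn (f := fun y => ⟪weakExt A q, weakExt B y⟫_ℝ - ⟪weakExt B q, weakExt A y⟫_ℝ)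
    (g := fun y => ⟪(q : E), weakExt (B * A - A * B) y⟫_ℝ) ((hconst' _ hB).sub (hconst' _ hA))
    (hconst' _ hBA) (fun p hp => ?_)
  · exact h2 hy
  rw [weakExt_coe hQ.dense hA.skew, weakExt_coe hQ.dense hB.skew, weakExt_coe hQ.dense hA.skew,
    weakExt_coe hQ.dense hB.skew, weakExt_coe hQ.dense hBA.skew, hA.skew q (B p), hB.skew q (A p)]
  simp only [LinearMap.sub_apply, Module.End.mul_apply, Submodule.coe_sub, inner_sub_right]
  ring

/-- The time derivative of a family of tangent operators is tangent. -/
lemma timeDeriv {X Y : ℝ → Module.End ℝ D} (hX : ∀ t, IsTangent m Q (X t))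
    (hd : ∀ (t : ℝ) (ψ : D), HasDerivAt (fun s => (X s ψ : E)) (Y t ψ) t) (t : ℝ) :
    IsTangent m Q (Y t) := by
  refine of_tendsto (l := 𝓝[≠] (0 : ℝ)) (F := fun h => h⁻¹ • (X (t + h) - X t))
    (Eventually.of_forall fun h => ((hX _).sub (hX _)).smul _) fun ψ => ?_
  simpa using (hasDerivAt_iff_tendsto_slope_zero.1 (hd t ψ))

/-- The difference quotients of the extension of a family converge, jointly in time and state. -/
lemma tendsto_weakExt_slope (hQ : IsStateSet m D Q) {X Y : ℝ → Module.End ℝ D}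
    (hX : ∀ t, IsTangent m Q (X t))
    (hd : ∀ (t : ℝ) (ψ : D), HasDerivAt (fun s => (X s ψ : E)) (Y t ψ) t) (t : ℝ) {x : E}
    (hx : x ∈ chartSet m (closure Q)) :
    Tendsto (fun z : ℝ × E => z.1⁻¹ • (weakExt (X (t + z.1)) z.2 - weakExt (X t) z.2))
      (𝓝[≠] 0 ×ˢ 𝓝[chartSet m (closure Q)] x) (𝓝 (weakExt (Y t) x)) := by
  obtain ⟨v, Ω, G, U, hG, hxU⟩ := hQ.exists_chart hx
  have hxS : x ∈ closure Q ∩ U := ⟨hx.1, hxU⟩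
  have hU : ∀ᶠ y in 𝓝[chartSet m (closure Q)] x, y ∈ closure Q ∩ U := by
    filter_upwards [self_mem_nhdsWithin,
      mem_nhdsWithin_of_mem_nhds (hG.isOpen_nhd.mem_nhds hxU)] with y hy hyU using ⟨hy.1, hyU⟩
  have hle : 𝓝[chartSet m (closure Q)] x ≤ 𝓝[closure Q ∩ U] x :=
    le_inf (nhdsWithin_le_nhds) (le_principal_iff.2 hU)
  have h1 : Tendsto (fun z : ℝ × E => fderiv ℝ G (coordMap (fun j => (v j : E)) z.2)
      (-coordMap (fun j => z.1⁻¹ • ((X (t + z.1) (v j) : E) - X t (v j))) z.2))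
      (𝓝[≠] 0 ×ˢ 𝓝[chartSet m (closure Q)] x) (𝓝 (weakExt (Y t) x)) := by
    rw [(hG.weakExt_eq hQ (timeDeriv hX hd t) hxS).2]
    have ha : Tendsto (fun z : ℝ × E => fderiv ℝ G (coordMap (fun j => (v j : E)) z.2))
        (𝓝[≠] 0 ×ˢ 𝓝[chartSet m (closure Q)] x)
        (𝓝 (fderiv ℝ G (coordMap (fun j => (v j : E)) x))) :=
      ((hG.continuousOn_coordField x hxS).mono_left hle).comp tendsto_snd
    have hb : Tendsto (fun z : ℝ × E =>
        coordMap (fun j => z.1⁻¹ • ((X (t + z.1) (v j) : E) - X t (v j))))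
        (𝓝[≠] 0 ×ˢ 𝓝[chartSet m (closure Q)] x) (𝓝 (coordMap fun j => (Y t (v j) : E))) := by
      refine ((continuous_coordMap (E := E)).tendsto _).comp (tendsto_pi_nhds.2 fun j => ?_)
      exact (hasDerivAt_iff_tendsto_slope_zero.1 (hd t (v j))).comp tendsto_fst
    have hc : Tendsto (fun z : ℝ × E => z.2) (𝓝[≠] (0 : ℝ) ×ˢ 𝓝[chartSet m (closure Q)] x) (𝓝 x) :=
      (tendsto_nhdsWithin_iff.1 tendsto_snd).1
    have hbc := (isBoundedBilinearMap_apply.continuous.tendsto _).comp (hb.prodMk_nhds hc)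
    exact (isBoundedBilinearMap_apply.continuous.tendsto _).comp (ha.prodMk_nhds hbc.neg)
  refine h1.congr' ?_
  filter_upwards [prod_mem_prod (univ_mem (f := 𝓝[≠] (0 : ℝ))) hU] with z hz
  have hzU : z.2 ∈ closure Q ∩ U := hz.2
  rw [(hG.weakExt_eq hQ (hX _) hzU).2, (hG.weakExt_eq hQ (hX _) hzU).2, ← map_sub, ← map_smul]
  congr 1
  ext j
  simp [real_inner_smul_left, inner_sub_left]
  ring

end IsTangent

/-! ### Integral curves -/

/-- `γ` is an integral curve, inside the manifold, of the extension of `A` on `[a, b]`. -/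
def IsCurve (m : ℕ) (Q : Set E) (A : Module.End ℝ D) (γ : ℝ → E) (a b : ℝ) : Prop :=
  ∀ s ∈ Icc a b, γ s ∈ chartSet m (closure Q) ∧
    HasDerivWithinAt γ (weakExt A (γ s)) (Icc a b) s

lemma exists_isCurve (hQ : IsStateSet m D Q) {A : Module.End ℝ D} (hA : IsTangent m Q A) {x : E}
    (hx : x ∈ chartSet m (closure Q)) : ∃ ε > 0, ∃ γ : ℝ → E, γ 0 = x ∧ IsCurve m Q A γ (-ε) ε := by
  obtain ⟨v, Ω, G, U, hG, hxU⟩ := hQ.exists_chart hx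
  have hxS : x ∈ closure Q ∩ U := ⟨hx.1, hxU⟩
  set L := coordMap (fun j => (v j : E))
  set a := -coordMap (fun j => (A (v j) : E)) with ha
  have hξ : L x ∈ Ω := hG.coord_mem _ hxS
  have hf : ContDiffAt ℝ 1 (fun ξ => a (G ξ)) (L x) :=
    a.contDiff.contDiffAt.comp _ ((hG.contDiffAt hξ).of_le (by norm_num))
  obtain ⟨α, hα0, ε, hε, hα⟩ :=
    hf.exists_forall_mem_closedBall_exists_eq_forall_mem_Ioo_hasDerivAt₀ 0
  have hev : ∀ᶠ s in 𝓝 (0 : ℝ), α s ∈ Ω ∧ s ∈ Ioo (0 - ε) (0 + ε) := by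
    refine ((hα 0 (by simp [hε])).continuousAt.eventually_mem ?_).and
      (Ioo_mem_nhds (by simp [hε]) (by simp [hε]))
    rw [hα0]; exact hG.isOpen_dom.mem_nhds hξ
  obtain ⟨δ, hδ, hδ'⟩ := Metric.nhds_basis_closedBall.mem_iff.1 hev
  rw [Real.closedBall_eq_Icc, zero_sub, zero_add] at hδ'
  refine ⟨δ, hδ, fun s => G (α s), by
    simp only [hα0]; exact hG.apply_coord _ hxS, fun s hs => ?_⟩
  obtain ⟨h1, h2⟩ := hδ' hs
  have h3 := hG.mem _ h1
  refine ⟨hG.subset h3, ?_⟩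
  rw [(hG.weakExt_eq hQ hA h3).2, hG.coord_apply _ h1]
  exact ((hG.hasFDerivAt h1).comp_hasDerivAt s (hα s h2)).hasDerivWithinAt

end Operators

section Evolution

variable {E : Type*} [NormedAddCommGroup E] [InnerProductSpace ℝ E] {m r : ℕ}
  {D : Submodule ℝ E} {Q : Set E}

/-! ### Evolution under constant controls -/

/-- The closed real span of the set of states. -/
def stateSpan (Q : Set E) : Submodule ℝ E := (Submodule.span ℝ Q).topologicalClosure

lemma subset_stateSpan (Q : Set E) : Q ⊆ stateSpan Q :=
  fun _ hx => Submodule.le_topologicalClosure _ (Submodule.subset_span hx)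

lemma isClosed_stateSpan (Q : Set E) : IsClosed (stateSpan Q : Set E) :=
  Submodule.isClosed_topologicalClosure _

lemma closure_subset_stateSpan (Q : Set E) : closure Q ⊆ stateSpan Q :=
  closure_minimal (subset_stateSpan Q) (isClosed_stateSpan Q)

/-- The operator `H₀(t) + ∑ aₗ Hₗ(t)`. -/
def generator (H : Fin (r + 1) → ℝ → Module.End ℝ D) (a : Fin r → ℝ) (t : ℝ) : Module.End ℝ D :=
  H 0 t + ∑ l, a l • H l.succ t

/-- `y` solves `y' = A y` on `[t₀, ∞)`, with values in `Q`. -/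
structure IsSolution (Q : Set E) (A : ℝ → Module.End ℝ D) (t₀ : ℝ) (y : ℝ → D) : Prop where
  mem : ∀ t, t₀ ≤ t → (y t : E) ∈ Q
  deriv : ∀ t, t₀ ≤ t → HasDerivWithinAt (fun s => (y s : E)) (A t (y t)) (Ici t₀) t

lemma IsSolution.mono {A : ℝ → Module.End ℝ D} {t₀ t₁ : ℝ} {y : ℝ → D} (h : IsSolution Q A t₀ y)
    (h01 : t₀ ≤ t₁) : IsSolution Q A t₁ y :=
  ⟨fun t ht => h.mem t (h01.trans ht),
    fun t ht => (h.deriv t (h01.trans ht)).mono (Ici_subset_Ici.2 h01)⟩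

lemma IsSolution.continuousOn {A : ℝ → Module.End ℝ D} {t₀ : ℝ} {y : ℝ → D}
    (h : IsSolution Q A t₀ y) : ContinuousOn (fun s => (y s : E)) (Ici t₀) :=
  fun t ht => (h.deriv t ht).continuousWithinAt

lemma IsSolution.hasDerivAt {A : ℝ → Module.End ℝ D} {t₀ : ℝ} {y : ℝ → D}
    (h : IsSolution Q A t₀ y) {t : ℝ} (ht : t₀ < t) :
    HasDerivAt (fun s => (y s : E)) (A t (y t)) t :=
  (h.deriv t ht.le).hasDerivAt (Ici_mem_nhds ht)

/-- A system, with constant controls, on the set of states `Q`. -/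
structure IsControlSystem (m : ℕ) (Q : Set E) (H : Fin (r + 1) → ℝ → Module.End ℝ D) : Prop where
  isStateSet : IsStateSet m D Q
  skew : ∀ i t, IsSkew (H i t)
  continuous : ∀ i (ψ : D), Continuous fun t => (H i t ψ : E)
  exists_solution : ∀ (a : Fin r → ℝ) (t₀ : ℝ) (q : D), (q : E) ∈ Q →
    ∃ y, y t₀ = q ∧ IsSolution Q (generator H a) t₀ y

lemma IsSkew.inner_self {A : Module.End ℝ D} (hA : IsSkew A) (q : D) :
    ⟪(q : E), (A q : E)⟫_ℝ = 0 := by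
  have h1 := hA q q
  rw [real_inner_comm] at h1
  linarith

lemma isSkew_generator {H : Fin (r + 1) → ℝ → Module.End ℝ D} (hH : ∀ i t, IsSkew (H i t))
    (a : Fin r → ℝ) (t : ℝ) : IsSkew (generator H a t) := by
  intro φ ψ
  simp only [generator, LinearMap.add_apply, LinearMap.sum_apply, LinearMap.smul_apply,
    Submodule.coe_add, Submodule.coe_sum, Submodule.coe_smul, inner_add_left, inner_add_right,
    sum_inner, inner_sum, real_inner_smul_left, real_inner_smul_right, hH 0 t φ ψ,
    fun l : Fin r => hH l.succ t φ ψ, Finset.sum_neg_distrib, mul_neg]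
  ring

lemma IsSolution.inner_eq [CompleteSpace E] {A : ℝ → Module.End ℝ D} (hA : ∀ t, IsSkew (A t))
    {t₀ t : ℝ} {y z : ℝ → D} (hy : IsSolution Q A t₀ y) (hz : IsSolution Q A t₀ z) (ht : t₀ ≤ t) :
    ⟪(y t : E), (z t : E)⟫_ℝ = ⟪(y t₀ : E), (z t₀ : E)⟫_ℝ :=
  inner_eq_of_deriv_skew ht countable_empty (hy.continuousOn.mono Icc_subset_Ici_self)
    (hz.continuousOn.mono Icc_subset_Ici_self) (fun _ hs => hy.hasDerivAt hs.1.1)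
    (fun _ hs => hz.hasDerivAt hs.1.1) fun s _ => by rw [hA s]; ring

/-- The flow from time `t` to time `t'` under the constant control `a`, extended to the whole
space as a contraction that is isometric on the span of the states. -/
structure IsPropagator (Q : Set E) (H : Fin (r + 1) → ℝ → Module.End ℝ D) (a : Fin r → ℝ)
    (t t' : ℝ) (Φ : E →L[ℝ] E) : Prop where
  le : t ≤ t'
  apply : ∀ y, IsSolution Q (generator H a) t y → Φ (y t) = y t'
  norm_le : ∀ x, ‖Φ x‖ ≤ ‖x‖
  inner : ∀ x ∈ stateSpan Q, ∀ y ∈ stateSpan Q, ⟪Φ x, Φ y⟫_ℝ = ⟪x, y⟫_ℝ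

namespace IsControlSystem

variable {H : Fin (r + 1) → ℝ → Module.End ℝ D}

lemma exists_isPropagator [CompleteSpace E] (hs : IsControlSystem m Q H) (a : Fin r → ℝ)
    {t t' : ℝ} (h : t ≤ t') : ∃ Φ, IsPropagator Q H a t t' Φ := by
  have hex : ∀ x : E, ∃ y : E, ∀ z, IsSolution Q (generator H a) t z → z t = x → y = z t' := by
    intro x
    by_cases hx : ∃ z, IsSolution Q (generator H a) t z ∧ (z t : E) = x
    · obtain ⟨z, hz, hzx⟩ := hx
      refine ⟨z t', fun w hw hwx => ?_⟩
      have hwz : ∀ {u v : ℝ → D}, IsSolution Q (generator H a) t u →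
          IsSolution Q (generator H a) t v →
          ⟪(u t' : E), (v t' : E)⟫_ℝ = ⟪(u t : E), (v t : E)⟫_ℝ :=
        fun hu hv => hu.inner_eq (isSkew_generator hs.skew a) hv h
      rw [← sub_eq_zero, ← inner_self_eq_zero (𝕜 := ℝ)]
      simp only [inner_sub_left, inner_sub_right, hwz hz hz, hwz hw hw, hwz hz hw, hwz hw hz, hzx,
        hwx]
      ring
    · exact ⟨0, fun z hz hzx => (hx ⟨z, hz, hzx⟩).elim⟩
  choose T hT using hex
  have hTi : ∀ x ∈ Q, ∀ y ∈ Q, ⟪T x, T y⟫_ℝ = ⟪x, y⟫_ℝ := by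
    intro x hx y hy
    obtain ⟨u, hu, hu'⟩ := hs.exists_solution a t ⟨x, hs.isStateSet.subset hx⟩ hx
    obtain ⟨v, hv, hv'⟩ := hs.exists_solution a t ⟨y, hs.isStateSet.subset hy⟩ hy
    rw [hT x u hu' (by rw [hu]), hT y v hv' (by rw [hv]),
      hu'.inner_eq (isSkew_generator hs.skew a) hv' h, hu, hv]
  obtain ⟨Φ, h1, h2, h3⟩ := exists_clm_of_inner_eq hTi
  exact ⟨Φ, h, fun y hy => by rw [h1 _ (hy.mem t le_rfl), hT _ y hy rfl], h2, h3⟩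

lemma isTangent_generator (hs : IsControlSystem m Q H) (a : Fin r → ℝ) (t : ℝ) :
    IsTangent m Q (generator H a t) := by
  refine ⟨isSkew_generator hs.skew a t, fun q hq v Ω G U hG hqU => ?_⟩
  obtain ⟨y, hy, hsol⟩ := hs.exists_solution a t q hq
  have := hG.fderiv_coordMap_of_hasDerivWithinAt self_mem_Ici
    (uniqueDiffWithinAt_Ici t) (hsol.deriv t le_rfl) ?_ (by simp only [hy]; exact hqU)
  · simpa only [hy] using this
  · filter_upwards [self_mem_nhdsWithin] with s hs' using subset_closure (hsol.mem s hs')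

lemma isTangent (hs : IsControlSystem m Q H) (i : Fin (r + 1)) (t : ℝ) :
    IsTangent m Q (H i t) := by
  have h0 : IsTangent m Q (H 0 t) := by
    have := hs.isTangent_generator 0 t
    simpa [generator] using this
  refine Fin.cases h0 (fun l => ?_) i
  have := (hs.isTangent_generator (Pi.single l 1) t).sub h0
  have h1 : generator H (Pi.single l 1) t - H 0 t = H l.succ t := by
    rw [generator, add_sub_cancel_left, Finset.sum_eq_single l]
    · simp
    · intro b _ hb; simp [hb]
    · simp
  rwa [h1] at this

lemma continuous_generator (hs : IsControlSystem m Q H) (a : Fin r → ℝ) (ψ : D) :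
    Continuous fun t => (generator H a t ψ : E) := by
  simp only [generator, LinearMap.add_apply, LinearMap.sum_apply, LinearMap.smul_apply,
    Submodule.coe_add, Submodule.coe_sum, Submodule.coe_smul]
  exact (hs.continuous 0 ψ).add (continuous_finsetSum _ fun l _ =>
    (hs.continuous l.succ ψ).const_smul (a l))

/-- A solution stays close to a curve `z` in the manifold that solves the equation
approximately. -/
lemma norm_sub_le (hs : IsControlSystem m Q H) {a : Fin r → ℝ} {t₀ t₁ C : ℝ} (h01 : t₀ ≤ t₁)
    {y : ℝ → D} (hy : IsSolution Q (generator H a) t₀ y) {z e : ℝ → E} (hC : 0 ≤ C)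
    (hzN : ∀ t ∈ Icc t₀ t₁, z t ∈ chartSet m (closure Q)) (hzc : ContinuousOn z (Icc t₀ t₁))
    (hz : ∀ t ∈ Ioo t₀ t₁, HasDerivAt z (e t) t)
    (hze : ∀ t ∈ Ioo t₀ t₁, ‖weakExt (generator H a t) (z t) - e t‖ ≤ C) :
    ‖(y t₁ : E) - z t₁‖ ≤ ‖(y t₀ : E) - z t₀‖ + C * (t₁ - t₀) := by
  have hQ := hs.isStateSet
  refine norm_le_add_of_inner_deriv_le (u := fun t => (y t : E) - z t)
    (u' := fun t => (generator H a t (y t) : E) - e t) h01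
    ((hy.continuousOn.mono Icc_subset_Ici_self).sub hzc)
    (fun t ht => (hy.hasDerivAt ht.1).sub (hz t ht)) hC fun t ht => ?_
  have hA := hs.isTangent_generator a t
  set A := generator H a t
  have hzt := hzN t (Ioo_subset_Icc_self ht)
  have h1 : ⟪(y t : E) - z t, (A (y t) : E) - weakExt A (z t)⟫_ℝ = 0 := by
    have h2 := hA.inner_weakExt_add hQ hzt hzt
    have h3 := hA.inner_weakExt hQ hzt (y t)
    have h4 := hA.skew.inner_self (y t)
    have h5 := real_inner_comm (z t) (weakExt A (z t))
    have h6 := real_inner_comm (z t) (A (y t) : E)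
    simp only [inner_sub_left, inner_sub_right]
    linarith
  have h2 : ⟪(y t : E) - z t, (A (y t) : E) - e t⟫_ℝ
      = ⟪(y t : E) - z t, weakExt A (z t) - e t⟫_ℝ := by
    have : (A (y t) : E) - e t = ((A (y t) : E) - weakExt A (z t)) + (weakExt A (z t) - e t) := by
      abel
    rw [this, inner_add_right, h1, zero_add]
  rw [h2]
  calc _ ≤ ‖(y t : E) - z t‖ * ‖weakExt A (z t) - e t‖ := real_inner_le_norm _ _
    _ ≤ ‖(y t : E) - z t‖ * C := by gcongr; exact hze t ht
    _ = _ := mul_comm _ _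

/-- The displacement of a state is bounded by the norm of its velocity at fixed position. -/
lemma norm_propagator_sub_le (hs : IsControlSystem m Q H) {a : Fin r → ℝ} {t t' C : ℝ}
    {Φ : E →L[ℝ] E} (hΦ : IsPropagator Q H a t t' Φ) {q : D} (hq : (q : E) ∈ Q) (hC : 0 ≤ C)
    (hb : ∀ s ∈ Ioo t t', ‖(generator H a s q : E)‖ ≤ C) : ‖Φ q - q‖ ≤ C * (t' - t) := by
  obtain ⟨y, hy, hsol⟩ := hs.exists_solution a t q hq
  have h1 := hs.norm_sub_le hΦ.le hsol (z := fun _ => (q : E)) (e := fun _ => 0) hC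
    (fun _ _ => hs.isStateSet.subset_chartSet hq) continuousOn_const
    (fun t _ => hasDerivAt_const _ _)
    (fun s hs' => by
      rw [sub_zero, weakExt_coe hs.isStateSet.dense (isSkew_generator hs.skew a s)]
      exact hb s hs')
  have h2 := hΦ.apply y hsol
  rw [hy] at h2 h1
  rw [h2]
  simpa using h1

end IsControlSystem

/-- The evolution operators from time `t` to time `t'` under piecewise constant controls. -/
inductive Evo (Q : Set E) (H : Fin (r + 1) → ℝ → Module.End ℝ D) (t : ℝ) :
    ℝ → (E →L[ℝ] E) → Prop
  | refl : Evo Q H t t (ContinuousLinearMap.id ℝ E)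
  | step {t' t'' : ℝ} {T Φ : E →L[ℝ] E} {a : Fin r → ℝ} (hT : Evo Q H t t' T)
      (hΦ : IsPropagator Q H a t' t'' Φ) : Evo Q H t t'' (Φ.comp T)

namespace Evo

variable {H : Fin (r + 1) → ℝ → Module.End ℝ D} {t t' t'' : ℝ} {T T' : E →L[ℝ] E}

lemma le (hT : Evo Q H t t' T) : t ≤ t' := by
  induction hT with
  | refl => exact le_rfl
  | step _ hΦ ih => exact ih.trans hΦ.le

lemma trans (hT : Evo Q H t t' T) (hT' : Evo Q H t' t'' T') : Evo Q H t t'' (T'.comp T) := by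
  induction hT' with
  | refl => exact hT
  | step _ hΦ ih => exact ih.step hΦ

lemma of_isPropagator {a : Fin r → ℝ} {Φ : E →L[ℝ] E} (hΦ : IsPropagator Q H a t t' Φ) :
    Evo Q H t t' Φ := (Evo.refl).step hΦ

lemma norm_le (hT : Evo Q H t t' T) (x : E) : ‖T x‖ ≤ ‖x‖ := by
  induction hT with
  | refl => exact le_rfl
  | step _ hΦ ih => exact (hΦ.norm_le _).trans ih

lemma mapsTo (hs : IsControlSystem m Q H) (hT : Evo Q H t t' T) : MapsTo T Q Q := by
  induction hT with
  | refl => exact mapsTo_id _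
  | @step t₁ t₂ T Φ a _ hΦ ih =>
    intro x hx
    obtain ⟨y, hy, hsol⟩ := hs.exists_solution a t₁ ⟨T x, hs.isStateSet.subset (ih hx)⟩ (ih hx)
    have := hΦ.apply y hsol
    rw [hy] at this
    exact this ▸ hsol.mem t₂ hΦ.le

lemma mapsTo_closure (hs : IsControlSystem m Q H) (hT : Evo Q H t t' T) :
    MapsTo T (closure Q) (closure Q) :=
  (hT.mapsTo hs).closure T.continuous

lemma mapsTo_stateSpan (hs : IsControlSystem m Q H) (hT : Evo Q H t t' T) {x : E}
    (hx : x ∈ stateSpan Q) : T x ∈ stateSpan Q := by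
  have h1 : Submodule.span ℝ Q ≤ (Submodule.span ℝ Q).comap T.toLinearMap :=
    Submodule.span_le.2 fun x hx => Submodule.subset_span (hT.mapsTo hs hx)
  have h2 : MapsTo T (Submodule.span ℝ Q : Set E) (Submodule.span ℝ Q : Set E) := fun x hx => h1 hx
  exact h2.closure T.continuous hx

lemma inner_eq (hs : IsControlSystem m Q H) (hT : Evo Q H t t' T) {x y : E}
    (hx : x ∈ stateSpan Q) (hy : y ∈ stateSpan Q) : ⟪T x, T y⟫_ℝ = ⟪x, y⟫_ℝ := by
  induction hT with
  | refl => rfl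
  | step hT hΦ ih =>
    exact (hΦ.inner _ (hT.mapsTo_stateSpan hs hx) _ (hT.mapsTo_stateSpan hs hy)).trans ih

end Evo

lemma IsControlSystem.exists_evo [CompleteSpace E] {H : Fin (r + 1) → ℝ → Module.End ℝ D}
    (hs : IsControlSystem m Q H) {t t' : ℝ} (h : t ≤ t') : ∃ T, Evo Q H t t' T := by
  obtain ⟨Φ, hΦ⟩ := hs.exists_isPropagator 0 h
  exact ⟨Φ, .of_isPropagator hΦ⟩

end Evolution

section Support

variable {E : Type*} [NormedAddCommGroup E] [InnerProductSpace ℝ E] {m r : ℕ}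
  {D : Submodule ℝ E} {Q : Set E}

/-! ### Sublinear functionals and their supporting vectors -/

/-- Sublinear functionals of norm at most one which vanish orthogonally to the states. -/
structure IsSublinear (Q : Set E) (w : E → ℝ) : Prop where
  add_le : ∀ z z', w (z + z') ≤ w z + w z'
  smul : ∀ c : ℝ, 0 < c → ∀ z, w (c • z) = c * w z
  le_norm : ∀ z, w z ≤ ‖z‖
  orthogonal : ∀ z ∈ (stateSpan Q)ᗮ, w z ≤ 0

/-- `p` supports the sublinear functional `w` at `q`. -/
structure IsOpt (Q : Set E) (w : E → ℝ) (q p : E) : Prop where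
  mem : p ∈ stateSpan Q
  eq : ⟪q, p⟫_ℝ = w q
  le : ∀ z, ⟪z, p⟫_ℝ ≤ w z

namespace IsSublinear

variable {w : E → ℝ}

lemma sub_le (hw : IsSublinear Q w) (z z' : E) : w z - w z' ≤ ‖z - z'‖ := by
  have h1 := hw.add_le z' (z - z')
  have h2 := hw.le_norm (z - z')
  rw [add_sub_cancel] at h1
  linarith

lemma continuous (hw : IsSublinear Q w) : Continuous w := by
  refine (LipschitzWith.of_dist_le_mul (K := 1) fun z z' => ?_).continuous
  rw [NNReal.coe_one, one_mul, Real.dist_eq, abs_le, dist_eq_norm]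
  have h1 := hw.sub_le z z'
  have h2 := hw.sub_le z' z
  rw [norm_sub_rev] at h2
  exact ⟨by linarith, h1⟩

lemma exists_isOpt [CompleteSpace E] (hw : IsSublinear Q w) {q : E} (hq : q ≠ 0) :
    ∃ p, IsOpt Q w q p := by
  have h0 : w 0 = 0 := by
    have := hw.smul 2 (by norm_num) 0
    rw [smul_zero] at this
    linarith
  set f : E →ₗ.[ℝ] ℝ := LinearPMap.mkSpanSingleton (K := ℝ) q (w q) hq
  obtain ⟨g, hg1, hg2⟩ := exists_extension_of_le_sublinear f w hw.smul hw.add_le (by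
    rintro ⟨x, hx⟩
    obtain ⟨c, rfl⟩ := Submodule.mem_span_singleton.1 hx
    have h1 : f ⟨c • q, hx⟩ = c * w q := by
      exact LinearPMap.mkSpanSingleton'_apply (σ := RingHom.id ℝ) q (w q) _ c hx
    rw [h1]
    change c * w q ≤ w (c • q)
    rcases lt_trichotomy c 0 with hc | rfl | hc
    · have h2 := hw.smul (-c) (by linarith) q
      have h3 := hw.add_le (c • q) ((-c) • q)
      rw [← add_smul, add_neg_cancel, zero_smul, h0, h2] at h3
      linarith
    · simp [h0]
    · rw [hw.smul c hc])
  have hbd : ∀ z, ‖g z‖ ≤ 1 * ‖z‖ := by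
    intro z
    rw [one_mul, Real.norm_eq_abs, abs_le]
    have h1 := (hg2 z).trans (hw.le_norm z)
    have h2 := (hg2 (-z)).trans (hw.le_norm (-z))
    rw [map_neg, norm_neg] at h2
    exact ⟨by linarith, h1⟩
  set p : E := (InnerProductSpace.toDual ℝ E).symm (g.mkContinuous 1 hbd)
  have hp : ∀ z, ⟪z, p⟫_ℝ = g z := by
    intro z
    rw [real_inner_comm, InnerProductSpace.toDual_symm_apply]; rfl
  have hqg : g q = w q := by
    have hqm : q ∈ f.domain := Submodule.mem_span_singleton_self q
    have h1 := hg1 ⟨q, hqm⟩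
    have h2 : f ⟨q, hqm⟩ = w q := by
      exact LinearPMap.mkSpanSingleton'_apply_self (σ := RingHom.id ℝ) q (w q) _ hqm
    rw [h2] at h1; exact h1
  refine ⟨p, ?_, by rw [hp, hqg], fun z => by rw [hp]; exact hg2 z⟩
  have hperp : p ∈ (stateSpan Q)ᗮᗮ := by
    rw [Submodule.mem_orthogonal]
    intro z hz
    rw [hp]
    have h1 := (hg2 z).trans (hw.orthogonal z hz)
    have h2 := (hg2 (-z)).trans (hw.orthogonal (-z) (Submodule.neg_mem _ hz))
    rw [map_neg] at h2
    linarith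
  rw [Submodule.orthogonal_orthogonal_eq_closure] at hperp
  exact (isClosed_stateSpan Q).closure_subset hperp

end IsSublinear

lemma IsOpt.norm_le_one {w : E → ℝ} (hw : IsSublinear Q w) {q p : E} (hp : IsOpt Q w q p) :
    ‖p‖ ≤ 1 := by
  have h1 := (hp.le p).trans (hw.le_norm p)
  rw [real_inner_self_eq_norm_sq] at h1
  nlinarith [norm_nonneg p]

/-- A lower bound for a sublinear functional near `x` that is first-order sharp along those
directions `e` to which the supporting vectors at points near `x` are orthogonal. -/
lemma IsSublinear.sub_norm_le {w : E → ℝ} (hw : IsSublinear Q w) {x e : E}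
    (h : ∀ ε > 0, ∃ q e', ‖q - x‖ < ε ∧ ‖e' - e‖ < ε ∧ ∃ p, IsOpt Q w q p ∧ ⟪e', p⟫_ℝ = 0)
    (y : E) (c : ℝ) : w x - ‖y - x - c • e‖ ≤ w y := by
  have key : ∀ ε > 0, w x - ‖y - x - c • e‖ ≤ w y + ε * (2 + |c|) := by
    intro ε hε
    obtain ⟨q, e', hq, he, p, hp, hpe⟩ := h ε hε
    have h1 : w q - ‖y - q - c • e'‖ ≤ w y := by
      have h2 : ⟪y, p⟫_ℝ = w q + ⟪y - q - c • e', p⟫_ℝ := by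
        rw [inner_sub_left, inner_sub_left, real_inner_smul_left, hpe, hp.eq]; ring
      have h3 : -⟪y - q - c • e', p⟫_ℝ ≤ ‖y - q - c • e'‖ := by
        rw [← inner_neg_left]
        refine (real_inner_le_norm _ _).trans ?_
        rw [norm_neg]
        exact mul_le_of_le_one_right (norm_nonneg _) (hp.norm_le_one hw)
      have := hp.le y
      linarith
    have h2 := hw.sub_le x q
    have h3 : ‖y - q - c • e'‖ ≤ ‖y - x - c • e‖ + ‖x - q‖ + |c| * ‖e - e'‖ := by
      have : y - q - c • e' = (y - x - c • e) + (x - q) + c • (e - e') := by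
        rw [smul_sub]; abel
      rw [this, ← Real.norm_eq_abs, ← norm_smul]
      exact norm_add₃_le
    rw [norm_sub_rev x q] at h2 h3
    rw [norm_sub_rev e e'] at h3
    have h4 : |c| * ‖e' - e‖ ≤ |c| * ε := by gcongr
    nlinarith
  refine le_of_forall_pos_le_add fun ε hε => ?_
  have h1 := key (ε / (2 + |c|)) (by positivity)
  rwa [div_mul_cancel₀ _ (by positivity)] at h1

/-- A sublinear functional is constant along a curve whose velocities are limits of directions
orthogonal to supporting vectors. -/
lemma IsSublinear.eq_of_curve {w : E → ℝ} (hw : IsSublinear Q w) {γ γ' : ℝ → E} {a b : ℝ}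
    (hab : a ≤ b) (hγ : ∀ s ∈ Icc a b, HasDerivWithinAt γ (γ' s) (Icc a b) s)
    (h : ∀ s ∈ Icc a b, ∀ ε > 0, ∃ q e', ‖q - γ s‖ < ε ∧ ‖e' - γ' s‖ < ε ∧
      ∃ p, IsOpt Q w q p ∧ ⟪e', p⟫_ℝ = 0) : w (γ a) = w (γ b) := by
  have key : ∀ {γ γ' : ℝ → E}, (∀ s ∈ Icc a b, HasDerivWithinAt γ (γ' s) (Icc a b) s) →
      (∀ s ∈ Icc a b, ∀ ε > 0, ∃ q e', ‖q - γ s‖ < ε ∧ ‖e' - γ' s‖ < ε ∧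
      ∃ p, IsOpt Q w q p ∧ ⟪e', p⟫_ℝ = 0) → w (γ a) ≤ w (γ b) := by
    intro γ γ' hγ h
    have hc : ContinuousOn γ (Icc a b) := fun s hs => (hγ s hs).continuousWithinAt
    have := image_le_of_liminf_slope_right_le_deriv_boundary (f := fun s => -w (γ s)) (a := a)
      (b := b) (B := fun _ => -w (γ a)) (B' := fun _ => 0)
      (hw.continuous.comp_continuousOn hc).neg le_rfl continuousOn_const
      (fun x _ => hasDerivWithinAt_const _ _ _) (fun s hs R hR => ?_) (right_mem_Icc.2 hab)
    · linarith
    refine Eventually.frequently ?_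
    have hd : HasDerivWithinAt γ (γ' s) (Ioi s) s := by
      have h1 := (hγ s (Ico_subset_Icc_self hs)).mono (Icc_subset_Icc_left hs.1)
      have h2 : HasDerivWithinAt γ (γ' s) (Ici s) s :=
        h1.mono_of_mem_nhdsWithin (Icc_mem_nhdsGE hs.2)
      exact h2.mono Ioi_subset_Ici_self
    have hlo := (hasDerivWithinAt_iff_isLittleO.1 hd).def (half_pos hR)
    filter_upwards [hlo, self_mem_nhdsWithin] with z hz hz'
    have hz'' : 0 < z - s := sub_pos.2 hz'
    have h1 := hw.sub_norm_le (h s (Ico_subset_Icc_self hs)) (γ z) (z - s)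
    rw [Real.norm_eq_abs, abs_of_pos hz''] at hz
    rw [slope_def_field, div_lt_iff₀ hz'']
    nlinarith
  refine le_antisymm (key hγ h) ?_
  -- the opposite inequality comes from the reversed curve
  have hrev : ∀ s ∈ Icc a b, a + b - s ∈ Icc a b := fun s hs => ⟨by linarith [hs.2], by linarith [hs.1]⟩
  have := key (γ := fun s => γ (a + b - s)) (γ' := fun s => -γ' (a + b - s)) (fun s hs => ?_)
    (fun s hs ε hε => ?_)
  · simpa using this
  · have h1 : HasDerivWithinAt (fun s : ℝ => a + b - s) (-1) (Icc a b) s := by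
      simpa using ((hasDerivAt_id s).const_sub (a + b)).hasDerivWithinAt
    have h2 := (hγ _ (hrev s hs)).scomp s h1 hrev
    rw [neg_one_smul] at h2
    exact h2
  · obtain ⟨q, e', hq, he, p, hp, hpe⟩ := h _ (hrev s hs) ε hε
    refine ⟨q, -e', hq, ?_, p, hp, by rw [inner_neg_left, hpe, neg_zero]⟩
    rw [← norm_neg] at he
    have h1 : -(e' - γ' (a + b - s)) = -e' - -γ' (a + b - s) := by abel
    rwa [h1] at he

/-! ### The support functional of the reachable set -/

/-- The support functional of the set of states reachable from `x` in the time interval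
`[t', t]`. -/
noncomputable def supp (Q : Set E) (H : Fin (r + 1) → ℝ → Module.End ℝ D) (t' : ℝ) (x : E) (t : ℝ)
    (z : E) : ℝ :=
  sSup {c | ∃ T, Evo Q H t' t T ∧ ⟪z, T x⟫_ℝ = c}

namespace IsControlSystem

variable {H : Fin (r + 1) → ℝ → Module.End ℝ D} {t' t : ℝ} {x : E}

lemma le_supp {T : E →L[ℝ] E} (hT : Evo Q H t' t T) (x z : E) :
    ⟪z, T x⟫_ℝ ≤ supp Q H t' x t z := by
  refine le_csSup ⟨‖z‖ * ‖x‖, ?_⟩ ⟨T, hT, rfl⟩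
  rintro _ ⟨T', hT', rfl⟩
  refine (real_inner_le_norm _ _).trans ?_
  gcongr
  exact hT'.norm_le x

lemma exists_bound (hs : IsControlSystem m Q H) (i : Fin (r + 1)) (q : D) (a b : ℝ) :
    ∃ C, 0 ≤ C ∧ ∀ s ∈ Icc a b, ‖(H i s q : E)‖ ≤ C := by
  obtain ⟨C, hC⟩ := (isCompact_Icc (a := a) (b := b)).exists_bound_of_continuousOn
    (hs.continuous i q).continuousOn
  exact ⟨max C 0, le_max_right _ _, fun s h => (hC s h).trans (le_max_left _ _)⟩

variable [CompleteSpace E]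

lemma supp_le (hs : IsControlSystem m Q H) (h : t' ≤ t) {z : E} {c : ℝ}
    (hc : ∀ T, Evo Q H t' t T → ⟪z, T x⟫_ℝ ≤ c) : supp Q H t' x t z ≤ c := by
  refine csSup_le ?_ ?_
  · obtain ⟨T, hT⟩ := hs.exists_evo h
    exact ⟨_, T, hT, rfl⟩
  · rintro _ ⟨T, hT, rfl⟩
    exact hc T hT

lemma exists_lt_inner (hs : IsControlSystem m Q H) (h : t' ≤ t) {z : E} {c : ℝ}
    (hc : c < supp Q H t' x t z) : ∃ T, Evo Q H t' t T ∧ c < ⟪z, T x⟫_ℝ := by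
  by_contra! hcon
  exact absurd (hs.supp_le h hcon) (not_le.2 hc)

lemma supp_le_norm (hs : IsControlSystem m Q H) (h : t' ≤ t) (x z : E) :
    supp Q H t' x t z ≤ ‖z‖ * ‖x‖ := by
  refine hs.supp_le h fun T hT => (real_inner_le_norm _ _).trans ?_
  gcongr
  exact hT.norm_le x

lemma isSublinear_supp (hs : IsControlSystem m Q H) (h : t' ≤ t) (hx : x ∈ closure Q)
    (hx1 : ‖x‖ ≤ 1) : IsSublinear Q (supp Q H t' x t) where
  add_le z z' := hs.supp_le h fun T hT => by
    rw [inner_add_left]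
    exact add_le_add (le_supp hT x z) (le_supp hT x z')
  smul c hc z := by
    refine le_antisymm (hs.supp_le h fun T hT => ?_) ?_
    · rw [real_inner_smul_left]
      exact mul_le_mul_of_nonneg_left (le_supp hT x z) hc.le
    · rw [← le_div_iff₀' hc]
      refine hs.supp_le h fun T hT => ?_
      rw [le_div_iff₀' hc, ← real_inner_smul_left]
      exact le_supp hT x _
  le_norm z := (hs.supp_le_norm h x z).trans (mul_le_of_le_one_right (norm_nonneg _) hx1)
  orthogonal z hz := hs.supp_le h fun T hT => by
    rw [real_inner_comm, Submodule.mem_orthogonal _ _ |>.1 hz (T x)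
      (closure_subset_stateSpan Q (hT.mapsTo_closure hs hx))]

lemma supp_sub_le (hs : IsControlSystem m Q H) (h : t' ≤ t) (x x' z : E) :
    supp Q H t' x t z - supp Q H t' x' t z ≤ ‖z‖ * ‖x - x'‖ := by
  rw [sub_le_iff_le_add]
  refine hs.supp_le h fun T hT => ?_
  have h1 : ⟪z, T x⟫_ℝ = ⟪z, T (x - x')⟫_ℝ + ⟪z, T x'⟫_ℝ := by
    rw [← inner_add_right, ← map_add, sub_add_cancel]
  rw [h1]
  refine add_le_add ((real_inner_le_norm _ _).trans ?_) (le_supp hT x' z)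
  gcongr
  exact hT.norm_le _

/-- Evolving the states does not decrease the support functional. -/
lemma supp_le_supp_evo (hs : IsControlSystem m Q H) {t₁ : ℝ} (h : t' ≤ t) {T : E →L[ℝ] E}
    (hT : Evo Q H t t₁ T) {z : E} (hz : z ∈ stateSpan Q) (hx : x ∈ stateSpan Q) :
    supp Q H t' x t z ≤ supp Q H t' x t₁ (T z) :=
  hs.supp_le h fun T₁ hT₁ => by
    have := le_supp (hT₁.trans hT) x (T z)
    rwa [ContinuousLinearMap.comp_apply, hT.inner_eq hs hz (hT₁.mapsTo_stateSpan hs hx)] at this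

/-- The support functional at a fixed state decreases at most at a bounded rate. -/
lemma supp_sub_mul_le (hs : IsControlSystem m Q H) {t₁ t₂ C : ℝ} (h : t' ≤ t₁) (h12 : t₁ ≤ t₂)
    (hx : x ∈ closure Q) (hx1 : ‖x‖ ≤ 1) {q : D} (hq : (q : E) ∈ Q) (hC0 : 0 ≤ C)
    (hC : ∀ s ∈ Icc t₁ t₂, ‖(H 0 s q : E)‖ ≤ C) :
    supp Q H t' x t₁ q - C * (t₂ - t₁) ≤ supp Q H t' x t₂ q := by
  obtain ⟨Φ, hΦ⟩ := hs.exists_isPropagator 0 h12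
  have h1 := hs.norm_propagator_sub_le hΦ hq hC0 (fun s hs' => by
    simpa [generator] using hC s (Ioo_subset_Icc_self hs'))
  have h2 := hs.supp_le_supp_evo h (Evo.of_isPropagator hΦ) (subset_stateSpan Q hq)
    (closure_subset_stateSpan Q hx)
  have h3 := (hs.isSublinear_supp (h.trans h12) hx hx1).sub_le (Φ q) q
  linarith

/-- The times at which the support functionals, for a set of states, are differentiable. -/
def goodTimes (Q₀ : Set E) (Q : Set E) (H : Fin (r + 1) → ℝ → Module.End ℝ D) : Set ℝ :=
  {t | ∀ x ∈ Q₀, ∀ q ∈ Q₀, ∀ t' : ℚ, (t' : ℝ) < t →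
    DifferentiableAt ℝ (fun τ => supp Q H t' x τ q) t}

lemma dense_goodTimes (hs : IsControlSystem m Q H) {Q₀ : Set E} (hc : Q₀.Countable)
    (hQ₀ : Q₀ ⊆ Q) : Dense (goodTimes Q₀ Q H) := by
  refine MeasureTheory.Measure.dense_of_ae (μ := MeasureTheory.volume) ?_
  refine (MeasureTheory.ae_ball_iff hc).2 fun x hx => (MeasureTheory.ae_ball_iff hc).2 fun q hq =>
    MeasureTheory.ae_all_iff.2 fun t' => ?_
  have hn : ∀ n : ℕ, ∀ᵐ t : ℝ, t ∈ Icc (t' : ℝ) n →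
      DifferentiableWithinAt ℝ (fun τ => supp Q H t' x τ q) (Icc (t' : ℝ) n) t := by
    intro n
    lift q to D using hs.isStateSet.subset (hQ₀ hq)
    obtain ⟨C, hC0, hC⟩ := hs.exists_bound 0 q t' n
    have hmono : MonotoneOn (fun τ => supp Q H t' x τ q + C * τ) (Icc (t' : ℝ) n) := by
      intro t₁ h₁ t₂ h₂ h12
      have := hs.supp_sub_mul_le h₁.1 h12 (subset_closure (hQ₀ hx))
        (hs.isStateSet.norm_eq x (hQ₀ hx)).le (hQ₀ hq) hC0
        (fun s hs' => hC s ⟨h₁.1.trans hs'.1, hs'.2.trans h₂.2⟩)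
      simp only
      linarith
    filter_upwards [hmono.ae_differentiableWithinAt_of_mem] with t ht ht'
    have h1 := (ht ht').sub ((differentiableWithinAt_id (𝕜 := ℝ)).const_mul C)
    refine h1.congr (fun y _ => ?_) ?_ <;> simp
  filter_upwards [MeasureTheory.ae_all_iff.2 hn] with t ht htt'
  obtain ⟨n, hn⟩ := exists_nat_gt t
  exact (ht n ⟨htt'.le, hn.le⟩).differentiableAt (Icc_mem_nhds htt' hn)

/-- From `x` one can return arbitrarily close to `x` in a short time. -/
lemma tendsto_supp_self (hs : IsControlSystem m Q H) (t : ℝ) (hx : x ∈ closure Q) (hx1 : ‖x‖ = 1) :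
    ∀ ε > 0, ∃ δ > 0, ∀ t', t - δ < t' → t' ≤ t → 1 - ε < supp Q H t' x t x := by
  intro ε hε
  obtain ⟨q, hq, hqx⟩ := Metric.mem_closure_iff.1 hx (ε / 4) (by linarith)
  lift q to D using hs.isStateSet.subset hq
  obtain ⟨C, hC0, hC⟩ := hs.exists_bound 0 q (t - 1) t
  refine ⟨min 1 (ε / (4 * (C + 1))), by positivity, fun t' h1 h2 => ?_⟩
  obtain ⟨Φ, hΦ⟩ := hs.exists_isPropagator 0 h2
  have hd : t - t' < min 1 (ε / (4 * (C + 1))) := by linarith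
  have hd1 := hd.trans_le (min_le_left _ _)
  have hd2 := hd.trans_le (min_le_right _ _)
  rw [lt_div_iff₀ (by positivity)] at hd2
  have h3 := hs.norm_propagator_sub_le hΦ hq hC0 (fun s hs' => by
    simpa [generator] using hC s ⟨by linarith [hs'.1], hs'.2.le⟩)
  have h4 := le_supp (Evo.of_isPropagator hΦ) x x
  have h5 : ⟪x, Φ x⟫_ℝ = 1 + ⟪x, Φ x - x⟫_ℝ := by
    rw [inner_sub_right, real_inner_self_eq_norm_sq, hx1]; ring
  have h6 : ‖Φ x - x‖ ≤ ‖x - q‖ + ‖Φ q - q‖ + ‖x - q‖ := by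
    have : Φ x - x = Φ (x - q) + (Φ q - q) + (q - x) := by rw [map_sub]; abel
    rw [this]
    refine norm_add₃_le.trans ?_
    rw [norm_sub_rev (q : E) x]
    gcongr
    exact hΦ.norm_le _
  have h7 : -⟪x, Φ x - x⟫_ℝ ≤ ‖Φ x - x‖ := by
    rw [← inner_neg_left]
    refine (real_inner_le_norm _ _).trans ?_
    rw [norm_neg, hx1, one_mul]
  rw [dist_eq_norm] at hqx
  nlinarith

end IsControlSystem
end Support

section Null

variable {E : Type*} [NormedAddCommGroup E] [InnerProductSpace ℝ E] {m r : ℕ}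
  {D : Submodule ℝ E} {Q : Set E}

/-! ### Null operators and their flows -/

namespace IsCurve

variable {A : Module.End ℝ D} {γ γ₁ γ₂ : ℝ → E} {a b c : ℝ}

lemma mono (h : IsCurve m Q A γ a b) {a' b' : ℝ} (ha : a ≤ a') (hb : b' ≤ b) :
    IsCurve m Q A γ a' b' := fun s hs =>
  ⟨(h s ⟨ha.trans hs.1, hs.2.trans hb⟩).1,
    (h s ⟨ha.trans hs.1, hs.2.trans hb⟩).2.mono (Icc_subset_Icc ha hb)⟩

lemma continuousOn (h : IsCurve m Q A γ a b) : ContinuousOn γ (Icc a b) :=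
  fun s hs => (h s hs).2.continuousWithinAt

lemma hasDerivAt (h : IsCurve m Q A γ a b) {s : ℝ} (hs : s ∈ Ioo a b) :
    HasDerivAt γ (weakExt A (γ s)) s :=
  (h s (Ioo_subset_Icc_self hs)).2.hasDerivAt (Icc_mem_nhds hs.1 hs.2)

lemma congr (h : IsCurve m Q A γ₁ a b) (he : EqOn γ₂ γ₁ (Icc a b)) : IsCurve m Q A γ₂ a b :=
  fun s hs => by
    rw [he hs]
    exact ⟨(h s hs).1, (h s hs).2.congr he (he hs)⟩

lemma comp_add_right (h : IsCurve m Q A γ a b) (c : ℝ) :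
    IsCurve m Q A (fun s => γ (s + c)) (a - c) (b - c) := by
  intro s hs
  have hm : ∀ s ∈ Icc (a - c) (b - c), s + c ∈ Icc a b :=
    fun s hs => ⟨by linarith [hs.1], by linarith [hs.2]⟩
  refine ⟨(h _ (hm s hs)).1, ?_⟩
  have h1 : HasDerivWithinAt (fun s : ℝ => s + c) 1 (Icc (a - c) (b - c)) s :=
    ((hasDerivAt_id s).add_const c).hasDerivWithinAt
  have h2 := (h _ (hm s hs)).2.scomp s h1 hm
  rw [one_smul] at h2
  exact h2

lemma inner_eq [CompleteSpace E] (hQ : IsStateSet m D Q) (hA : IsTangent m Q A) (hab : a ≤ b)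
    (h₁ : IsCurve m Q A γ₁ a b) (h₂ : IsCurve m Q A γ₂ a b) :
    ⟪γ₁ b, γ₂ b⟫_ℝ = ⟪γ₁ a, γ₂ a⟫_ℝ :=
  inner_eq_of_deriv_skew hab countable_empty h₁.continuousOn h₂.continuousOn
    (fun _ hs => h₁.hasDerivAt hs.1) (fun _ hs => h₂.hasDerivAt hs.1) fun s hs =>
    hA.inner_weakExt_add hQ (h₁ s (Ioo_subset_Icc_self hs.1)).1 (h₂ s (Ioo_subset_Icc_self hs.1)).1

lemma norm_sub_eq [CompleteSpace E] (hQ : IsStateSet m D Q) (hA : IsTangent m Q A) (hab : a ≤ b)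
    (h₁ : IsCurve m Q A γ₁ a b) (h₂ : IsCurve m Q A γ₂ a b) :
    ‖γ₁ b - γ₂ b‖ = ‖γ₁ a - γ₂ a‖ := by
  rw [← sq_eq_sq₀ (norm_nonneg _) (norm_nonneg _), ← real_inner_self_eq_norm_sq,
    ← real_inner_self_eq_norm_sq]
  simp only [inner_sub_left, inner_sub_right, inner_eq hQ hA hab h₁ h₁, inner_eq hQ hA hab h₁ h₂,
    inner_eq hQ hA hab h₂ h₁, inner_eq hQ hA hab h₂ h₂]

lemma eqOn [CompleteSpace E] (hQ : IsStateSet m D Q) (hA : IsTangent m Q A)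
    (h₁ : IsCurve m Q A γ₁ a b) (h₂ : IsCurve m Q A γ₂ a b) (h : γ₁ a = γ₂ a) :
    EqOn γ₁ γ₂ (Icc a b) := fun s hs => by
  have := norm_sub_eq hQ hA hs.1 (h₁.mono le_rfl hs.2) (h₂.mono le_rfl hs.2)
  rw [h, sub_self, norm_zero, norm_eq_zero, sub_eq_zero] at this
  exact this

lemma glue (hab : a ≤ b) (hbc : b ≤ c) (h₁ : IsCurve m Q A γ₁ a b) (h₂ : IsCurve m Q A γ₂ b c)
    (h : γ₁ b = γ₂ b) : IsCurve m Q A (fun s => if s ≤ b then γ₁ s else γ₂ s) a c := by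
  set γ := fun s => if s ≤ b then γ₁ s else γ₂ s with hγ
  have e1 : EqOn γ γ₁ (Icc a b) := fun s hs => if_pos hs.2
  have e2 : EqOn γ γ₂ (Icc b c) := by
    intro s hs
    rcases hs.1.eq_or_lt with rfl | h'
    · simp [hγ, h]
    · exact if_neg (not_le.2 h')
  have g1 := h₁.congr e1
  have g2 := h₂.congr e2
  have hun : Icc a c = Icc a b ∪ Icc b c := (Icc_union_Icc_eq_Icc hab hbc).symm
  have d1 : ∀ s, s ∈ Icc a c → HasDerivWithinAt γ (weakExt A (γ s)) (Icc a b) s := by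
    intro s hs
    by_cases h' : s ∈ Icc a b
    · exact (g1 s h').2
    · exact HasFDerivWithinAt.of_notMem_closure (by rwa [isClosed_Icc.closure_eq])
  have d2 : ∀ s, s ∈ Icc a c → HasDerivWithinAt γ (weakExt A (γ s)) (Icc b c) s := by
    intro s hs
    by_cases h' : s ∈ Icc b c
    · exact (g2 s h').2
    · exact HasFDerivWithinAt.of_notMem_closure (by rwa [isClosed_Icc.closure_eq])
  intro s hs
  refine ⟨?_, by rw [hun]; exact (d1 s hs).union (d2 s hs)⟩
  rw [hun] at hs
  exact hs.elim (fun h' => (g1 s h').1) fun h' => (g2 s h').1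

/-- The speed of an integral curve of a skew vector field is constant. -/
lemma norm_weakExt_eq [CompleteSpace E] (hQ : IsStateSet m D Q) (hA : IsTangent m Q A)
    (h : IsCurve m Q A γ a b) {s : ℝ} (hs : s ∈ Ico a b) :
    ‖weakExt A (γ s)‖ = ‖weakExt A (γ a)‖ := by
  have hd : ∀ s ∈ Ico a b,
      Tendsto (fun z => ‖slope γ s (s + z)‖) (𝓝[>] 0) (𝓝 ‖weakExt A (γ s)‖) := by
    intro s hs
    have h1 := ((h s (Ico_subset_Icc_self hs)).2.mono
      (Icc_subset_Icc_left hs.1)).mono_of_mem_nhdsWithin (Icc_mem_nhdsGE hs.2)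
    have h2 := (hasDerivWithinAt_iff_tendsto_slope' (s := Ioi s) (by simp)).1
      (h1.mono Ioi_subset_Ici_self)
    have h3 : Tendsto (fun z : ℝ => s + z) (𝓝[>] 0) (𝓝[>] s) := by
      refine tendsto_nhdsWithin_iff.2 ⟨?_, ?_⟩
      · have : Tendsto (fun z : ℝ => s + z) (𝓝 0) (𝓝 (s + 0)) :=
          (continuous_const.add continuous_id).tendsto 0
        rw [add_zero] at this
        exact this.mono_left nhdsWithin_le_nhds
      · filter_upwards [self_mem_nhdsWithin] with z hz
        exact lt_add_of_pos_right s hz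
    exact (h2.comp h3).norm
  refine tendsto_nhds_unique_of_eventuallyEq (hd s hs) (hd a ⟨le_rfl, hs.1.trans_lt hs.2⟩) ?_
  filter_upwards [Ioo_mem_nhdsGT (sub_pos.2 hs.2)] with z hz
  rw [slope_def_module, slope_def_module, norm_smul, norm_smul, add_sub_cancel_left,
    add_sub_cancel_left]
  congr 1
  have h1 : IsCurve m Q A (fun τ => γ (τ + z)) a s :=
    (h.comp_add_right z).mono (by linarith [hz.1]) (by linarith [hz.2])
  exact norm_sub_eq hQ hA hs.1 h1 (h.mono le_rfl hs.2.le)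

end IsCurve

variable {H : Fin (r + 1) → ℝ → Module.End ℝ D} {Q₀ : Set E} {t : ℝ}

/-- At time `t`, the operator `A` has zero expectation between states and the vectors supporting
the reachable sets at these states. -/
def IsNull (Q₀ Q : Set E) (H : Fin (r + 1) → ℝ → Module.End ℝ D) (t : ℝ) (A : Module.End ℝ D) :
    Prop :=
  ∀ t' : ℚ, (t' : ℝ) < t → ∀ x ∈ Q₀, ∀ q : D, (q : E) ∈ Q₀ → ∀ p,
    IsOpt Q (supp Q H t' x t) q p → ⟪(A q : E), p⟫_ℝ = 0

lemma IsNull.zero : IsNull Q₀ Q H t (0 : Module.End ℝ D) := fun _ _ _ _ _ _ _ _ => by simp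

lemma IsNull.add {A B : Module.End ℝ D} (hA : IsNull Q₀ Q H t A) (hB : IsNull Q₀ Q H t B) :
    IsNull Q₀ Q H t (A + B) := fun t' ht x hx q hq p hp => by
  simp [inner_add_left, hA t' ht x hx q hq p hp, hB t' ht x hx q hq p hp]

lemma IsNull.smul {A : Module.End ℝ D} (hA : IsNull Q₀ Q H t A) (c : ℝ) :
    IsNull Q₀ Q H t (c • A) := fun t' ht x hx q hq p hp => by
  simp [real_inner_smul_left, hA t' ht x hx q hq p hp]

lemma IsNull.neg {A : Module.End ℝ D} (hA : IsNull Q₀ Q H t A) : IsNull Q₀ Q H t (-A) :=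
  fun t' ht x hx q hq p hp => by simp [hA t' ht x hx q hq p hp]

/-- `Q₀` is a dense set of states. -/
structure IsDenseStates (Q₀ Q : Set E) : Prop where
  subset : Q₀ ⊆ Q
  dense : Q ⊆ closure Q₀

lemma IsDenseStates.closure_subset (h0 : IsDenseStates Q₀ Q) : closure Q ⊆ closure Q₀ :=
  closure_minimal h0.dense isClosed_closure

lemma IsStateSet.norm_eq_one (hQ : IsStateSet m D Q) {x : E} (hx : x ∈ closure Q) : ‖x‖ = 1 := by
  have : closure Q ⊆ Metric.sphere (0 : E) 1 :=
    closure_minimal (fun x hx => by simpa using hQ.norm_eq x hx) Metric.isClosed_sphere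
  simpa using this hx

lemma IsStateSet.ne_zero (hQ : IsStateSet m D Q) {x : E} (hx : x ∈ closure Q) : x ≠ 0 := by
  have := hQ.norm_eq_one hx
  rintro rfl
  simp at this

namespace IsControlSystem

variable [CompleteSpace E]

/-- Equality of support functionals at two states passes from a dense set of base points to all
base points. -/
lemma supp_eq_of_dense (hs : IsControlSystem m Q H) (h0 : IsDenseStates Q₀ Q) {t' : ℝ} (h : t' ≤ t)
    {y z : E} (heq : ∀ x ∈ Q₀, supp Q H t' x t y = supp Q H t' x t z) {x : E}
    (hx : x ∈ closure Q) : supp Q H t' x t y = supp Q H t' x t z := by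
  have hc : ∀ z, Continuous fun x => supp Q H t' x t z := by
    intro z
    refine (LipschitzWith.of_dist_le_mul (K := ‖z‖₊) fun x x' => ?_).continuous
    rw [Real.dist_eq, abs_le, dist_eq_norm, coe_nnnorm]
    have h1 := hs.supp_sub_le h x x' z
    have h2 := hs.supp_sub_le h x' x z
    rw [norm_sub_rev] at h2
    exact ⟨by linarith, h1⟩
  exact (EqOn.closure heq (hc y) (hc z)) (h0.closure_subset hx)

lemma exists_isOpt (hs : IsControlSystem m Q H) {t' : ℝ} (h : t' ≤ t) {x q : E}
    (hx : x ∈ closure Q) (hq : q ∈ closure Q) : ∃ p, IsOpt Q (supp Q H t' x t) q p :=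
  (hs.isSublinear_supp h hx (hs.isStateSet.norm_eq_one hx).le).exists_isOpt
    (hs.isStateSet.ne_zero hq)

/-- The support functionals are constant along the integral curves of a null operator. -/
lemma supp_eq_of_isCurve (hs : IsControlSystem m Q H) (h0 : IsDenseStates Q₀ Q)
    {A : Module.End ℝ D} (hA : IsTangent m Q A) (hnull : IsNull Q₀ Q H t A) {γ : ℝ → E} {a b : ℝ}
    (hab : a ≤ b) (hγ : IsCurve m Q A γ a b) {t' : ℚ} (ht' : (t' : ℝ) < t) {x : E}
    (hx : x ∈ closure Q) : supp Q H t' x t (γ a) = supp Q H t' x t (γ b) := by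
  refine hs.supp_eq_of_dense h0 ht'.le (fun x hx => ?_) hx
  have hxQ : x ∈ closure Q := subset_closure (h0.subset hx)
  refine (hs.isSublinear_supp ht'.le hxQ (hs.isStateSet.norm_eq_one hxQ).le).eq_of_curve hab
    (fun s hs => (hγ s hs).2) fun s hs' ε hε => ?_
  obtain ⟨hsN, -⟩ := hγ s hs'
  have hcont := hA.continuousOn_weakExt hs.isStateSet _ hsN
  have hev : ∀ᶠ q in 𝓝[chartSet m (closure Q)] (γ s),
      ‖q - γ s‖ < ε ∧ ‖weakExt A q - weakExt A (γ s)‖ < ε := by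
    simp only [← dist_eq_norm]
    exact ((tendsto_nhdsWithin_of_tendsto_nhds tendsto_id).eventually
      (Metric.ball_mem_nhds _ hε)).and (hcont.eventually (Metric.ball_mem_nhds _ hε))
  have hcl : γ s ∈ closure Q₀ := h0.closure_subset hsN.1
  have hne : (𝓝[Q₀] (γ s)).NeBot := mem_closure_iff_nhdsWithin_neBot.1 hcl
  have hev' : ∀ᶠ q in 𝓝[Q₀] (γ s),
      ‖q - γ s‖ < ε ∧ ‖weakExt A q - weakExt A (γ s)‖ < ε :=
    hev.filter_mono (nhdsWithin_mono (γ s) (h0.subset.trans hs.isStateSet.subset_chartSet))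
  obtain ⟨q, ⟨h1, h2⟩, hq⟩ := (hev'.and self_mem_nhdsWithin).exists
  obtain ⟨p, hp⟩ := hs.exists_isOpt ht'.le hxQ (subset_closure (h0.subset hq))
  refine ⟨q, weakExt A q, h1, h2, p, hp, ?_⟩
  lift q to D using hs.isStateSet.subset (h0.subset hq)
  rw [weakExt_coe hs.isStateSet.dense hA.skew]
  exact hnull t' ht' x hx q hq p hp

lemma inner_weakExt_eq_zero (hs : IsControlSystem m Q H) (h0 : IsDenseStates Q₀ Q)
    {A : Module.End ℝ D} (hA : IsTangent m Q A) (hnull : IsNull Q₀ Q H t A) {t' : ℚ}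
    (ht' : (t' : ℝ) < t) {x q p : E} (hx : x ∈ closure Q) (hq : q ∈ chartSet m (closure Q))
    (hp : IsOpt Q (supp Q H t' x t) q p) : ⟪weakExt A q, p⟫_ℝ = 0 := by
  obtain ⟨ε, hε, γ, hγ0, hγ⟩ := exists_isCurve hs.isStateSet hA hq
  have hd : HasDerivAt (fun s => ⟪γ s, p⟫_ℝ) ⟪weakExt A q, p⟫_ℝ 0 := by
    have := (hγ.hasDerivAt (s := 0) ⟨by linarith, hε⟩).inner ℝ (hasDerivAt_const 0 p)
    rw [hγ0] at this
    simpa using this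
  refine IsLocalMax.hasDerivAt_eq_zero ?_ hd
  filter_upwards [Icc_mem_nhds (show -ε < 0 by linarith) hε] with s hs'
  have h1 : supp Q H t' x t (γ s) = supp Q H t' x t (γ 0) := by
    rcases le_total s 0 with h | h
    · exact hs.supp_eq_of_isCurve h0 hA hnull h (hγ.mono hs'.1 hε.le) ht' hx
    · exact (hs.supp_eq_of_isCurve h0 hA hnull h (hγ.mono (by linarith) hs'.2) ht' hx).symm
  have h2 := hp.le (γ s)
  rw [h1, hγ0] at h2
  rw [hγ0, hp.eq]
  exact h2

lemma norm_sub_sq_lt_of_lt_inner {y z : E} (hy : ‖y‖ = 1) (hz : ‖z‖ = 1) {ε : ℝ}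
    (h : 1 - ε < ⟪y, z⟫_ℝ) : ‖z - y‖ ^ 2 < 2 * ε := by
  rw [norm_sub_sq_real, hy, hz, real_inner_comm]; linarith

/-- If the support functionals do not distinguish `x` from `y` just before time `t`, then states
can be steered from `x` towards `y` and back, so that `y` is as regular a point as `x` is. -/
lemma mem_chartSet_of_supp_eq (hs : IsControlSystem m Q H) {x y : E}
    (hx : x ∈ chartSet m (closure Q)) (hy : y ∈ closure Q)
    (h : ∀ t' : ℚ, (t' : ℝ) < t → supp Q H t' x t y = supp Q H t' x t x ∧
      supp Q H t' y t x = supp Q H t' y t y) : y ∈ chartSet m (closure Q) := by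
  have key : ∀ {x y : E}, x ∈ closure Q → y ∈ closure Q →
      (∀ t' : ℚ, (t' : ℝ) < t → supp Q H t' x t y = supp Q H t' x t x) →
      ∀ n : ℕ, ∃ t' : ℝ, ∃ T, Evo Q H t' t T ∧ ‖T x - y‖ ^ 2 < 2 * (1 / ((n : ℝ) + 1)) := by
    intro x y hx hy h n
    obtain ⟨δ, hδ, hδ'⟩ := hs.tendsto_supp_self t hx (hs.isStateSet.norm_eq_one hx)
      (1 / ((n : ℝ) + 1)) (by positivity)
    obtain ⟨t', h1, h2⟩ := exists_rat_btwn (show t - δ < t by linarith)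
    have h3 := hδ' t' h1 h2.le
    rw [← h t' h2] at h3
    obtain ⟨T, hT, hlt⟩ := hs.exists_lt_inner h2.le h3
    exact ⟨t', T, hT, norm_sub_sq_lt_of_lt_inner (hs.isStateSet.norm_eq_one hy)
      (hs.isStateSet.norm_eq_one (hT.mapsTo_closure hs hx)) hlt⟩
  have htend : ∀ {f : ℕ → E} {y : E}, (∀ n, ‖f n - y‖ ^ 2 < 2 * (1 / ((n : ℝ) + 1))) →
      Tendsto f atTop (𝓝 y) := by
    intro f y hf
    rw [tendsto_iff_norm_sub_tendsto_zero]
    have h1 : Tendsto (fun n => ‖f n - y‖ ^ 2) atTop (𝓝 0) := by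
      refine squeeze_zero (fun n => sq_nonneg _) (fun n => (hf n).le) ?_
      have := (tendsto_one_div_add_atTop_nhds_zero_nat (𝕜 := ℝ)).const_mul 2
      rwa [mul_zero] at this
    have h2 := h1.sqrt
    simpa [Real.sqrt_sq (norm_nonneg _)] using h2
  choose t₁ T hT hTlim using key hx.1 hy fun t' ht' => (h t' ht').1
  choose t₂ T' hT' hTlim' using key hy hx.1 fun t' ht' => (h t' ht').2
  refine mem_chartSet_of_tendsto isClosed_closure hx hy (T := fun n => T n) (T' := fun n => T' n)
    (fun n => (hT n).mapsTo_closure hs) (fun n a ha b hb => ?_)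
    (fun n => (hT' n).mapsTo_closure hs) (fun n a ha b hb => ?_) (htend hTlim) (htend hTlim')
  · exact (hT n).inner_eq hs (closure_subset_stateSpan Q ha) (closure_subset_stateSpan Q hb)
  · exact (hT' n).inner_eq hs (closure_subset_stateSpan Q ha) (closure_subset_stateSpan Q hb)

/-- The integral curves of a null operator are complete. -/
theorem exists_isCurve_of_isNull (hs : IsControlSystem m Q H) (h0 : IsDenseStates Q₀ Q)
    {A : Module.End ℝ D} (hA : IsTangent m Q A) (hnull : IsNull Q₀ Q H t A) {x : E}
    (hx : x ∈ chartSet m (closure Q)) {b : ℝ} (hb : 0 ≤ b) :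
    ∃ γ : ℝ → E, γ 0 = x ∧ IsCurve m Q A γ 0 b := by
  have hQ := hs.isStateSet
  set P : ℝ → Prop := fun b => ∃ γ : ℝ → E, γ 0 = x ∧ IsCurve m Q A γ 0 b with hP
  have hmono : ∀ b b', b' ≤ b → P b → P b' := fun b b' h ⟨γ, h1, h2⟩ => ⟨γ, h1, h2.mono le_rfl h⟩
  have hP0 : P 0 := by
    obtain ⟨ε, hε, γ, h1, h2⟩ := exists_isCurve hQ hA hx
    exact ⟨γ, h1, h2.mono (by linarith) hε.le⟩
  have hext : ∀ b, 0 ≤ b → P b → ∃ ε > 0, P (b + ε) := by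
    rintro b hb ⟨γ, h1, h2⟩
    obtain ⟨ε, hε, γ', h1', h2'⟩ := exists_isCurve hQ hA (h2 b (right_mem_Icc.2 hb)).1
    have h3 : IsCurve m Q A (fun s => γ' (s + -b)) b (b + ε) :=
      (h2'.comp_add_right (-b)).mono (by linarith) (by linarith)
    refine ⟨ε, hε, _, ?_, h2.glue hb (by linarith) h3 (by simp [h1'])⟩
    simp [hb, h1]
  -- a curve on `[0, b)` has a limit at `b`, which is again a point of the manifold
  have hlim : ∀ b, 0 < b → (∀ s, s < b → P s) → P b := by
    intro b hb hall
    choose! c hc0 hc using hall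
    set γ : ℝ → E := fun s => c s s with hγdef
    have hγc : ∀ s, 0 ≤ s → s < b → IsCurve m Q A γ 0 s := by
      intro s h1 h2
      refine (hc s h2).congr fun τ hτ => ?_
      exact (hc τ (hτ.2.trans_lt h2)).eqOn hQ hA ((hc s h2).mono le_rfl hτ.2)
        ((hc0 τ (hτ.2.trans_lt h2)).trans (hc0 s h2).symm) (right_mem_Icc.2 hτ.1)
    have hγ0 : γ 0 = x := hc0 0 hb
    have hN : ∀ s ∈ Ico 0 b, γ s ∈ chartSet m (closure Q) :=
      fun s h => (hγc s h.1 h.2 s (right_mem_Icc.2 h.1)).1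
    have hder : ∀ s ∈ Ioo 0 b, HasDerivAt γ (weakExt A (γ s)) s := by
      intro s h
      exact (hγc ((s + b) / 2) (by linarith [h.1, h.2]) (by linarith [h.2])).hasDerivAt
        ⟨h.1, by linarith [h.2]⟩
    have hlip : ∀ s ∈ Ico 0 b, ∀ s' ∈ Ico 0 b, ‖γ s' - γ s‖ ≤ ‖weakExt A x‖ * ‖s' - s‖ := by
      intro s h s' h'
      set τ := max s s'
      have hτ : τ < b := max_lt h.2 h'.2
      have hτ' : 0 ≤ (τ + b) / 2 := by have := h.1.trans (le_max_left s s'); linarith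
      have hcur := hγc ((τ + b) / 2) hτ' (by linarith)
      refine (convex_Ico 0 ((τ + b) / 2)).norm_image_sub_le_of_norm_hasDerivWithin_le
        (f := γ) (f' := fun s => weakExt A (γ s))
        (fun u hu => ((hcur u (Ico_subset_Icc_self hu)).2.mono Ico_subset_Icc_self))
        (fun u hu => ?_) ⟨h.1, ?_⟩ ⟨h'.1, ?_⟩
      · rw [hcur.norm_weakExt_eq hQ hA hu, hγ0]
      · have := le_max_left s s'; linarith
      · have := le_max_right s s'; linarith
    have hcau : Cauchy (map γ (𝓝[<] b)) := by
      rw [Metric.cauchy_iff]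
      refine ⟨inferInstance, fun ε hε => ?_⟩
      set C := ‖weakExt A x‖ + 1
      have hC : 0 < C := by positivity
      refine ⟨γ '' Ioo (max 0 (b - ε / C)) b, image_mem_map
        (Ioo_mem_nhdsLT (max_lt hb (by have : 0 < ε / C := by positivity
                                       linarith))), ?_⟩
      rintro _ ⟨s, hs1, rfl⟩ _ ⟨s', hs1', rfl⟩
      have h1 := (max_lt_iff.1 hs1.1)
      have h2 := (max_lt_iff.1 hs1'.1)
      rw [dist_eq_norm]
      refine (hlip s' ⟨h2.1.le, hs1'.2⟩ s ⟨h1.1.le, hs1.2⟩).trans_lt ?_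
      have h3 : ‖s - s'‖ < ε / C := by
        rw [Real.norm_eq_abs, abs_lt]
        exact ⟨by linarith [hs1'.2], by linarith [hs1.2]⟩
      rw [lt_div_iff₀ hC] at h3
      have := norm_nonneg (s - s')
      nlinarith
    obtain ⟨y, hy⟩ := cauchy_map_iff_exists_tendsto.1 hcau
    have hevN : ∀ᶠ s in 𝓝[<] b, s ∈ Ioo 0 b := Ioo_mem_nhdsLT hb
    have hyS : y ∈ closure Q := isClosed_closure.mem_of_tendsto hy
      (hevN.mono fun s h => (hN s (Ioo_subset_Ico_self h)).1)
    have hyN : y ∈ chartSet m (closure Q) := by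
      refine hs.mem_chartSet_of_supp_eq (t := t) hx hyS fun t' ht' => ?_
      have hsup : ∀ s ∈ Ioo 0 b, ∀ z ∈ closure Q,
          supp Q H t' z t x = supp Q H t' z t (γ s) := by
        intro s h z hz
        rw [← hγ0]
        exact hs.supp_eq_of_isCurve h0 hA hnull h.1.le (hγc s h.1.le h.2) ht' hz
      have hcont : ∀ z ∈ closure Q, Continuous (supp Q H t' z t) := fun z hz =>
        (hs.isSublinear_supp ht'.le hz (hQ.norm_eq_one hz).le).continuous
      have heq : ∀ z ∈ closure Q, supp Q H t' z t y = supp Q H t' z t x := by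
        intro z hz
        refine tendsto_nhds_unique_of_eventuallyEq (((hcont z hz).tendsto y).comp hy)
          tendsto_const_nhds ?_
        filter_upwards [hevN] with s h using (hsup s h z hz).symm
      exact ⟨heq x hx.1, (heq y hyS).symm⟩
    set γ' : ℝ → E := fun s => if s < b then γ s else y with hγ'
    have e1 : ∀ s, s < b → γ' s = γ s := fun s h => if_pos h
    have e2 : γ' b = y := if_neg (lt_irrefl b)
    refine ⟨γ', by rw [e1 0 hb, hγ0], fun s h => ?_⟩
    rcases h.2.eq_or_lt with rfl | hsb
    · rw [e2]
      refine ⟨hyN, ?_⟩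
      have hder' : ∀ u ∈ Ioo 0 s, HasDerivAt γ' (weakExt A (γ u)) u := by
        intro u hu
        refine (hder u hu).congr_of_eventuallyEq ?_
        filter_upwards [Iio_mem_nhds hu.2] with v hv using e1 v hv
      have hyt : Tendsto γ' (𝓝[<] s) (𝓝 y) := by
        refine hy.congr' ?_
        filter_upwards [self_mem_nhdsWithin] with v hv using (e1 v hv).symm
      refine (hasDerivWithinAt_Iic_of_tendsto_deriv (s := Ioo 0 s) (fun u hu =>
        (hder' u hu).differentiableAt.differentiableWithinAt) ?_ (Ioo_mem_nhdsLT hb) ?_).mono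
        Icc_subset_Iic_self
      · rw [ContinuousWithinAt, e2]
        exact hyt.mono_left (nhdsWithin_mono _ Ioo_subset_Iio_self)
      · have h1 : Tendsto (fun u => weakExt A (γ u)) (𝓝[<] s) (𝓝 (weakExt A y)) := by
          refine (hA.continuousOn_weakExt hQ y hyN).tendsto.comp (tendsto_nhdsWithin_iff.2 ⟨hy, ?_⟩)
          filter_upwards [hevN] with u hu using hN u (Ioo_subset_Ico_self hu)
        refine h1.congr' ?_
        filter_upwards [hevN] with u hu using (hder' u hu).deriv.symm
    · have hcur := hγc ((s + b) / 2) (by linarith [h.1]) (by linarith)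
      have hs' : s ∈ Icc 0 ((s + b) / 2) := ⟨h.1, by linarith⟩
      rw [e1 s hsb]
      refine ⟨(hcur s hs').1, ?_⟩
      have h1 : HasDerivWithinAt γ (weakExt A (γ s)) (Icc 0 b) s := by
        refine (hcur s hs').2.mono_of_mem_nhdsWithin ?_
        filter_upwards [self_mem_nhdsWithin,
          mem_nhdsWithin_of_mem_nhds (Iio_mem_nhds (show s < (s + b) / 2 by linarith))]
          with u hu hu' using ⟨hu.1, le_of_lt hu'⟩
      refine h1.congr_of_eventuallyEq ?_ (e1 s hsb)
      filter_upwards [mem_nhdsWithin_of_mem_nhds (Iio_mem_nhds hsb)] with u hu using e1 u hu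
  -- connectedness argument
  by_contra hcon
  set Z : Set ℝ := {b | 0 ≤ b ∧ ¬ P b}
  have hZne : Z.Nonempty := ⟨b, hb, hcon⟩
  have hZbdd : BddBelow Z := ⟨0, fun _ h => h.1⟩
  set β := sInf Z
  have hβ0 : 0 ≤ β := le_csInf hZne fun _ h => h.1
  have hlt : ∀ s, s < β → P s := by
    intro s hsβ
    rcases le_total s 0 with h | h
    · exact hmono 0 s h hP0
    · by_contra hc
      exact absurd (csInf_le hZbdd ⟨h, hc⟩) (not_le.2 hsβ)
  have hPβ : P β := by
    rcases hβ0.eq_or_lt with h | h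
    · rw [← h]; exact hP0
    · exact hlim β h hlt
  obtain ⟨ε, hε, hPε⟩ := hext β hβ0 hPβ
  obtain ⟨z, hz, hzβ⟩ := exists_lt_of_csInf_lt hZne (show β < β + ε by linarith)
  exact hz.2 (hmono _ z hzβ.le hPε)

end IsControlSystem

/-- `V` is the forward flow of the extension of `A` on the manifold, extended to contractions of
the whole space that are isometric on the span of the states. -/
structure IsFlow (m : ℕ) (Q : Set E) (A : Module.End ℝ D) (V : ℝ → E →L[ℝ] E) : Prop where
  zero : ∀ x ∈ chartSet m (closure Q), V 0 x = x
  isCurve : ∀ x ∈ chartSet m (closure Q), ∀ b, 0 ≤ b → IsCurve m Q A (fun s => V s x) 0 b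
  norm_le : ∀ s x, ‖V s x‖ ≤ ‖x‖
  inner_eq : ∀ s, 0 ≤ s → ∀ x ∈ stateSpan Q, ∀ y ∈ stateSpan Q, ⟪V s x, V s y⟫_ℝ = ⟪x, y⟫_ℝ

namespace IsFlow

variable {A : Module.End ℝ D} {V V' : ℝ → E →L[ℝ] E}

lemma mem (hV : IsFlow m Q A V) {s : ℝ} (hs : 0 ≤ s) {x : E} (hx : x ∈ chartSet m (closure Q)) :
    V s x ∈ chartSet m (closure Q) := (hV.isCurve x hx s hs s (right_mem_Icc.2 hs)).1

lemma mem_stateSpan (hV : IsFlow m Q A V) (hQ : IsStateSet m D Q) {s : ℝ} (hs : 0 ≤ s) {x : E}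
    (hx : x ∈ stateSpan Q) : V s x ∈ stateSpan Q := by
  have h1 : Submodule.span ℝ Q ≤ (stateSpan Q).comap (V s).toLinearMap :=
    Submodule.span_le.2 fun x hx =>
      closure_subset_stateSpan Q (hV.mem hs (hQ.subset_chartSet hx)).1
  have h2 : MapsTo (V s) (Submodule.span ℝ Q : Set E) (stateSpan Q : Set E) := fun x hx => h1 hx
  exact (isClosed_stateSpan Q).closure_subset (h2.closure (V s).continuous hx)

end IsFlow

namespace IsControlSystem

variable [CompleteSpace E]

lemma exists_isFlow (hs : IsControlSystem m Q H) (h0 : IsDenseStates Q₀ Q)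
    {A : Module.End ℝ D} (hA : IsTangent m Q A) (hnull : IsNull Q₀ Q H t A) :
    ∃ V, IsFlow m Q A V := by
  have hQ := hs.isStateSet
  have hex : ∀ s : ℝ, ∀ x : E, ∃ y : E, 0 ≤ s → x ∈ chartSet m (closure Q) →
      ∀ γ, γ 0 = x → IsCurve m Q A γ 0 s → γ s = y := by
    intro s x
    by_cases h : 0 ≤ s ∧ x ∈ chartSet m (closure Q)
    · obtain ⟨γ, h1, h2⟩ := hs.exists_isCurve_of_isNull h0 hA hnull h.2 h.1
      exact ⟨γ s, fun _ _ γ' h1' h2' => h2'.eqOn hQ hA h2 (h1'.trans h1.symm)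
        (right_mem_Icc.2 h.1)⟩
    · exact ⟨0, fun a b => (h ⟨a, b⟩).elim⟩
  choose T hT using hex
  have hcurve : ∀ x ∈ chartSet m (closure Q), ∀ b, 0 ≤ b →
      IsCurve m Q A (fun s => T s x) 0 b := by
    intro x hx b hb
    obtain ⟨γ, h1, h2⟩ := hs.exists_isCurve_of_isNull h0 hA hnull hx hb
    exact h2.congr fun s hs => (hT s x hs.1 hx γ h1 (h2.mono le_rfl hs.2)).symm
  have hzero : ∀ x ∈ chartSet m (closure Q), T 0 x = x := by
    intro x hx
    obtain ⟨γ, h1, h2⟩ := hs.exists_isCurve_of_isNull h0 hA hnull hx le_rfl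
    rw [← hT 0 x le_rfl hx γ h1 h2, h1]
  have hTi : ∀ s, 0 ≤ s → ∀ x ∈ chartSet m (closure Q), ∀ y ∈ chartSet m (closure Q),
      ⟪T s x, T s y⟫_ℝ = ⟪x, y⟫_ℝ := by
    intro s hs x hx y hy
    have := IsCurve.inner_eq hQ hA hs (hcurve x hx s hs) (hcurve y hy s hs)
    simpa only [hzero x hx, hzero y hy] using this
  have hex' : ∀ s : ℝ, ∃ V : E →L[ℝ] E, (∀ x, ‖V x‖ ≤ ‖x‖) ∧ (0 ≤ s →
      (∀ x ∈ chartSet m (closure Q), V x = T s x) ∧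
      ∀ x ∈ stateSpan Q, ∀ y ∈ stateSpan Q, ⟪V x, V y⟫_ℝ = ⟪x, y⟫_ℝ) := by
    intro s
    by_cases h : 0 ≤ s
    · obtain ⟨V, h1, h2, h3⟩ := exists_clm_of_inner_eq (hTi s h)
      have hle : stateSpan Q ≤ (Submodule.span ℝ (chartSet m (closure Q))).topologicalClosure :=
        Submodule.topologicalClosure_mono (Submodule.span_mono hQ.subset_chartSet)
      exact ⟨V, h2, fun _ => ⟨h1, fun x hx y hy => h3 x (hle hx) y (hle hy)⟩⟩
    · exact ⟨0, fun x => by simp, fun h' => (h h').elim⟩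
  choose V hV1 hV2 using hex'
  refine ⟨V, fun x hx => ?_, fun x hx b hb => ?_, hV1, fun s hs => (hV2 s hs).2⟩
  · rw [(hV2 0 le_rfl).1 x hx, hzero x hx]
  · exact (hcurve x hx b hb).congr fun s hs => (hV2 s hs.1).1 x hx

lemma one_le_supp (hs : IsControlSystem m Q H) {t' : ℝ} {T : E →L[ℝ] E} (hT : Evo Q H t' t T)
    {x : E} (hx : x ∈ closure Q) : 1 ≤ supp Q H t' x t (T x) := by
  have := le_supp hT x (T x)
  rwa [real_inner_self_eq_norm_sq, hs.isStateSet.norm_eq_one (hT.mapsTo_closure hs hx),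
    one_pow] at this

lemma inner_le_supp_of_one_le (hs : IsControlSystem m Q H) {t' : ℝ} (h : t' ≤ t) {x y : E}
    (hx : x ∈ closure Q) (hy : y ∈ closure Q) (h1 : 1 ≤ supp Q H t' x t y) (z : E) :
    ⟪z, y⟫_ℝ ≤ supp Q H t' x t z := by
  have key : ∀ ε > 0, ⟪z, y⟫_ℝ ≤ supp Q H t' x t z + ‖z‖ * ε := by
    intro ε hε
    obtain ⟨T, hT, hlt⟩ := hs.exists_lt_inner h (show 1 - ε ^ 2 / 2 < supp Q H t' x t y by
      nlinarith [sq_pos_of_pos hε])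
    have h2 := norm_sub_sq_lt_of_lt_inner (hs.isStateSet.norm_eq_one hy)
      (hs.isStateSet.norm_eq_one (hT.mapsTo_closure hs hx)) hlt
    have h3 : ‖T x - y‖ < ε := lt_of_pow_lt_pow_left₀ 2 hε.le (by linarith)
    have h4 := le_supp hT x z
    have h5 : ⟪z, y⟫_ℝ = ⟪z, T x⟫_ℝ + ⟪z, y - T x⟫_ℝ := by rw [← inner_add_right]; simp
    have h6 := real_inner_le_norm z (y - T x)
    rw [norm_sub_rev] at h6
    have : ‖z‖ * ‖T x - y‖ ≤ ‖z‖ * ε := by gcongr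
    linarith
  refine le_of_forall_pos_le_add fun ε hε => ?_
  have h1 := key (ε / (‖z‖ + 1)) (by positivity)
  have h2 : ‖z‖ * (ε / (‖z‖ + 1)) ≤ ε := by
    rw [mul_div_assoc', div_le_iff₀ (by positivity)]
    nlinarith [norm_nonneg z]
  linarith

/-- The flow of a null operator preserves the closed convex hull of the reachable set. -/
lemma inner_flow_le_supp (hs : IsControlSystem m Q H) (h0 : IsDenseStates Q₀ Q)
    {A : Module.End ℝ D} (hA : IsTangent m Q A) (hnull : IsNull Q₀ Q H t A)
    {V : ℝ → E →L[ℝ] E} (hV : IsFlow m Q A V) {t' : ℚ} (ht' : (t' : ℝ) < t) {x : E}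
    (hx : x ∈ Q) {p : E} (hp : ∀ z, ⟪z, p⟫_ℝ ≤ supp Q H t' x t z) {s : ℝ} (hs0 : 0 ≤ s) (z : E) :
    ⟪z, V s p⟫_ℝ ≤ supp Q H t' x t z := by
  rw [← ContinuousLinearMap.adjoint_inner_left]
  refine (hp _).trans (hs.supp_le ht'.le fun T hT => ?_)
  rw [ContinuousLinearMap.adjoint_inner_left]
  have hTx := hs.isStateSet.subset_chartSet (hT.mapsTo hs hx)
  refine hs.inner_le_supp_of_one_le ht'.le (subset_closure hx) (hV.mem hs0 hTx).1 ?_ z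
  have h1 := hs.supp_eq_of_isCurve h0 hA hnull hs0 (hV.isCurve _ hTx s hs0) ht' (subset_closure hx)
  simp only [hV.zero _ hTx] at h1
  rw [← h1]
  exact hs.one_le_supp hT (subset_closure hx)

lemma isOpt_flow (hs : IsControlSystem m Q H) (h0 : IsDenseStates Q₀ Q)
    {A : Module.End ℝ D} (hA : IsTangent m Q A) (hnull : IsNull Q₀ Q H t A)
    {V : ℝ → E →L[ℝ] E} (hV : IsFlow m Q A V) {t' : ℚ} (ht' : (t' : ℝ) < t) {x q p : E}
    (hx : x ∈ Q) (hq : q ∈ chartSet m (closure Q)) (hp : IsOpt Q (supp Q H t' x t) q p) {s : ℝ}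
    (hs0 : 0 ≤ s) : IsOpt Q (supp Q H t' x t) (V s q) (V s p) where
  mem := hV.mem_stateSpan hs.isStateSet hs0 hp.mem
  eq := by
    rw [hV.inner_eq s hs0 q (closure_subset_stateSpan Q hq.1) p hp.mem, hp.eq]
    have h1 := hs.supp_eq_of_isCurve h0 hA hnull hs0 (hV.isCurve q hq s hs0) ht' (subset_closure hx)
    simpa only [hV.zero q hq] using h1
  le := hs.inner_flow_le_supp h0 hA hnull hV ht' hx hp.le hs0

end IsControlSystem
end Null

section LieNull

variable {E : Type*} [NormedAddCommGroup E] [InnerProductSpace ℝ E] {m r : ℕ}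
  {D : Submodule ℝ E} {Q : Set E} {H : Fin (r + 1) → ℝ → Module.End ℝ D} {Q₀ : Set E} {t : ℝ}

/-! ### The null operators form a Lie algebra -/

/-- Strong convergence of contractions extends from the states to their closed span. -/
lemma tendsto_of_mem_stateSpan {ι : Type*} {l : Filter ι} {V : ι → E →L[ℝ] E} {V₀ : E →L[ℝ] E}
    (hV : ∀ᶠ i in l, ∀ x, ‖V i x‖ ≤ ‖x‖) (h : ∀ x ∈ Q, Tendsto (fun i => V i x) l (𝓝 (V₀ x)))
    {x : E} (hx : x ∈ stateSpan Q) : Tendsto (fun i => V i x) l (𝓝 (V₀ x)) := by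
  have hspan : ∀ x ∈ Submodule.span ℝ Q, Tendsto (fun i => V i x) l (𝓝 (V₀ x)) := by
    intro x hx
    induction hx using Submodule.span_induction with
    | mem x hx => exact h x hx
    | zero => simpa using tendsto_const_nhds
    | add x y _ _ hx hy => simpa using hx.add hy
    | smul c x _ hx => simpa using hx.const_smul c
  rw [Metric.tendsto_nhds]
  intro ε hε
  set C := 1 + ‖V₀‖
  have hC : 0 < C := by positivity
  obtain ⟨y, hy, hxy⟩ := Metric.mem_closure_iff.1 hx (ε / (2 * C)) (by positivity)
  rw [lt_div_iff₀ (by positivity), dist_eq_norm] at hxy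
  filter_upwards [hV, (hspan y hy).eventually (Metric.ball_mem_nhds _ (half_pos hε))] with i h1 h2
  rw [dist_eq_norm] at h2
  rw [dist_eq_norm]
  have h3 : V i x - V₀ x = V i (x - y) + (V i y - V₀ y) - V₀ (x - y) := by
    rw [map_sub, map_sub]; abel
  have h4 : ‖V i x - V₀ x‖ ≤ ‖x - y‖ + ‖V i y - V₀ y‖ + ‖V₀‖ * ‖x - y‖ := by
    rw [h3]
    refine (norm_sub_le _ _).trans (add_le_add ((norm_add_le _ _).trans ?_) (V₀.le_opNorm _))
    gcongr
    exact h1 _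
  have h5 : ‖x - y‖ * (2 * C) = 2 * (‖x - y‖ + ‖V₀‖ * ‖x - y‖) := by ring
  linarith

namespace IsFlow

variable {A B : Module.End ℝ D} {V : ℝ → E →L[ℝ] E}

lemma continuousOn (hQ : IsStateSet m D Q) (hV : IsFlow m Q A V) {p : E} (hp : p ∈ stateSpan Q)
    (b : ℝ) : ContinuousOn (fun s => V s p) (Icc 0 b) := by
  intro s hs
  exact tendsto_of_mem_stateSpan (Eventually.of_forall fun i => hV.norm_le i)
    (fun x hx => (hV.isCurve x (hQ.subset_chartSet hx) b (hs.1.trans hs.2)).continuousOn s hs) hp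

lemma zero_of_mem_stateSpan (hQ : IsStateSet m D Q) (hV : IsFlow m Q A V) {p : E}
    (hp : p ∈ stateSpan Q) : V 0 p = p := by
  have h1 : EqOn (V 0) (ContinuousLinearMap.id ℝ E) (Submodule.span ℝ Q : Set E) :=
    LinearMap.eqOn_span (f := (V 0).toLinearMap) (g := LinearMap.id)
      fun x hx => hV.zero x (hQ.subset_chartSet hx)
  exact h1.closure (V 0).continuous continuous_id hp

/-- The derivative of the inner product of a curve in the manifold with the flow of `A`. -/
lemma hasDerivWithinAt_inner (hQ : IsStateSet m D Q) (hA : IsTangent m Q A) (hV : IsFlow m Q A V)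
    {y y' : ℝ → E} {b : ℝ} (hb : 0 ≤ b) (hyN : ∀ s ∈ Icc 0 b, y s ∈ chartSet m (closure Q))
    (hy : ∀ s ∈ Icc 0 b, HasDerivWithinAt y (y' s) (Icc 0 b) s) (hy' : ContinuousOn y' (Icc 0 b))
    {p : E} (hp : p ∈ stateSpan Q) : ∀ s ∈ Icc 0 b,
    HasDerivWithinAt (fun s => ⟪y s, V s p⟫_ℝ) ⟪y' s - weakExt A (y s), V s p⟫_ℝ (Icc 0 b) s := by
  have hyc : ContinuousOn y (Icc 0 b) := fun s hs => (hy s hs).continuousWithinAt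
  have hc : ContinuousOn (fun s => y' s - weakExt A (y s)) (Icc 0 b) :=
    hy'.sub ((hA.continuousOn_weakExt hQ).comp hyc hyN)
  obtain ⟨C, hC⟩ := isCompact_Icc.exists_bound_of_continuousOn hc
  refine hasDerivWithinAt_of_mem_closure_span (X := Q) (g := fun s => (innerSL ℝ (y s)).comp (V s))
    (κ := fun s => (innerSL ℝ (y' s - weakExt A (y s))).comp (V s)) (C := C) (fun s hs x => ?_)
    (fun x hx s hs => ?_) hp ?_
  · refine (abs_real_inner_le_norm _ _).trans ?_
    exact mul_le_mul (hC s hs) (hV.norm_le s x) (norm_nonneg _) ((norm_nonneg _).trans (hC s hs))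
  · obtain ⟨h1, h2⟩ := hV.isCurve x (hQ.subset_chartSet hx) b hb s hs
    have h3 := (hy s hs).inner ℝ h2
    have h4 := hA.inner_weakExt_add hQ (hyN s hs) h1
    have h5 : ⟪y s, weakExt A (V s x)⟫_ℝ + ⟪y' s, V s x⟫_ℝ
        = ⟪y' s - weakExt A (y s), V s x⟫_ℝ := by rw [inner_sub_left]; linarith
    rw [h5] at h3
    exact h3
  · exact hc.inner (hV.continuousOn hQ hp b)

/-- Along the flow of `A`, the expectation of `B` changes at the rate given by the commutator. -/
lemma hasDerivWithinAt_inner_weakExt (hQ : IsStateSet m D Q) (hA : IsTangent m Q A)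
    (hB : IsTangent m Q B) (hV : IsFlow m Q A V) {q p : E} {b : ℝ} (hb : 0 ≤ b)
    (hq : q ∈ chartSet m (closure Q)) (hp : p ∈ stateSpan Q) : ∀ s ∈ Icc 0 b,
    HasDerivWithinAt (fun s => ⟪weakExt B (V s q), V s p⟫_ℝ)
      ⟪weakExt (B * A - A * B) (V s q), V s p⟫_ℝ (Icc 0 b) s := by
  have hBA := hB.commutator hQ hA
  have hqc := hV.isCurve q hq b hb
  have hmem : ∀ s ∈ Icc 0 b, V s q ∈ chartSet m (closure Q) := fun s hs => (hqc s hs).1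
  have hc : ContinuousOn (fun s => weakExt (B * A - A * B) (V s q)) (Icc 0 b) :=
    (hBA.continuousOn_weakExt hQ).comp hqc.continuousOn hmem
  have hcB : ContinuousOn (fun s => weakExt B (V s q)) (Icc 0 b) :=
    (hB.continuousOn_weakExt hQ).comp hqc.continuousOn hmem
  obtain ⟨C, hC⟩ := isCompact_Icc.exists_bound_of_continuousOn hc
  refine hasDerivWithinAt_of_mem_closure_span (X := Q)
    (g := fun s => (innerSL ℝ (weakExt B (V s q))).comp (V s))
    (κ := fun s => (innerSL ℝ (weakExt (B * A - A * B) (V s q))).comp (V s)) (C := C)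
    (fun s hs x => ?_) (fun x hx s hs => ?_) hp ?_
  · refine (abs_real_inner_le_norm _ _).trans ?_
    exact mul_le_mul (hC s hs) (hV.norm_le s x) (norm_nonneg _) ((norm_nonneg _).trans (hC s hs))
  · have hxc := hV.isCurve x (hQ.subset_chartSet hx) b hb
    have hxN : ∀ s ∈ Icc 0 b, V s x ∈ chartSet m (closure Q) := fun s hs => (hxc s hs).1
    -- skewness of `B` on the manifold replaces differentiability of its extension
    have hlim : Tendsto (fun u => ⟪weakExt B (V u q), slope (fun s => V s x) s u⟫_ℝ
        - ⟪slope (fun s => V s q) s u, weakExt B (V s x)⟫_ℝ) (𝓝[Icc 0 b \ {s}] s)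
        (𝓝 (⟪weakExt B (V s q), weakExt A (V s x)⟫_ℝ
          - ⟪weakExt A (V s q), weakExt B (V s x)⟫_ℝ)) := by
      refine (Tendsto.inner ?_ ?_).sub (Tendsto.inner ?_ tendsto_const_nhds)
      · exact (hcB s hs).mono_left (nhdsWithin_mono _ sdiff_subset)
      · exact hasDerivWithinAt_iff_tendsto_slope.1 (hxc s hs).2
      · exact hasDerivWithinAt_iff_tendsto_slope.1 (hqc s hs).2
    have hval : ⟪weakExt B (V s q), weakExt A (V s x)⟫_ℝ - ⟪weakExt A (V s q), weakExt B (V s x)⟫_ℝ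
        = ⟪weakExt (B * A - A * B) (V s q), V s x⟫_ℝ := by
      have h1 := hA.inner_weakExt_commutator hQ hB (hxN s hs) (hmem s hs)
      rw [real_inner_comm (V s x), ← h1, real_inner_comm (weakExt B (V s q)),
        real_inner_comm (weakExt A (V s q))]
    rw [hval] at hlim
    rw [hasDerivWithinAt_iff_tendsto_slope]
    refine hlim.congr' ?_
    filter_upwards [self_mem_nhdsWithin] with u hu
    have h1 := hB.inner_weakExt_add hQ (hmem u hu.1) (hxN s hs)
    have h2 := hB.inner_weakExt_add hQ (hmem s hs) (hxN s hs)
    have h3 : ∀ c : ℝ, c * (⟪weakExt B (V u q), V u x - V s x⟫_ℝ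
        - ⟪V u q - V s q, weakExt B (V s x)⟫_ℝ)
        = c * (⟪weakExt B (V u q), V u x⟫_ℝ - ⟪weakExt B (V s q), V s x⟫_ℝ) := by
      intro c
      congr 1
      rw [inner_sub_right, inner_sub_left]
      linarith
    have h4 := h3 (u - s)⁻¹
    rw [mul_sub] at h4
    simpa only [slope_def_module, real_inner_smul_left, real_inner_smul_right, smul_eq_mul,
      ContinuousLinearMap.comp_apply, innerSL_apply_apply] using h4
  · exact hc.inner (hV.continuousOn hQ hp b)

end IsFlow

variable [CompleteSpace E]

/-- The commutator of null operators is null. -/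
theorem IsNull.commutator (hs : IsControlSystem m Q H) (h0 : IsDenseStates Q₀ Q)
    {A B : Module.End ℝ D} (hA : IsTangent m Q A) (hB : IsTangent m Q B)
    (hAn : IsNull Q₀ Q H t A) (hBn : IsNull Q₀ Q H t B) : IsNull Q₀ Q H t (B * A - A * B) := by
  intro t' ht' x hx q hq p hp
  have hQ := hs.isStateSet
  obtain ⟨V, hV⟩ := hs.exists_isFlow h0 hA hAn
  have hqN := hQ.subset_chartSet (h0.subset hq)
  have h1 := hV.hasDerivWithinAt_inner_weakExt hQ hA hB zero_le_one hqN hp.mem 0 (by simp)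
  have h2 : ∀ s ∈ Icc (0 : ℝ) 1, ⟪weakExt B (V s q), V s p⟫_ℝ = 0 := fun s hs' =>
    hs.inner_weakExt_eq_zero h0 hB hBn ht' (subset_closure (h0.subset hx)) (hV.mem hs'.1 hqN)
      (hs.isOpt_flow h0 hA hAn hV ht' (h0.subset hx) hqN hp hs'.1)
  have h3 : HasDerivWithinAt (fun s => ⟪weakExt B (V s q), V s p⟫_ℝ) 0 (Icc 0 1) 0 :=
    (hasDerivWithinAt_const (0 : ℝ) (Icc 0 1) (0 : ℝ)).congr h2 (h2 0 (by simp))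
  have h4 := (uniqueDiffOn_Icc (zero_lt_one' ℝ) 0 (by simp)).eq_deriv _ h1 h3
  rw [hV.zero q hqN, hV.zero_of_mem_stateSpan hQ hp.mem,
    weakExt_coe hQ.dense (hB.commutator hQ hA).skew] at h4
  exact h4

namespace IsControlSystem

lemma isCompact_eventually_norm_sub_lt {F : ℝ → ℝ → E} (hF : Continuous fun z : ℝ × ℝ => F z.1 z.2)
    {K : Set ℝ} (hK : IsCompact K) (t : ℝ) {ε : ℝ} (hε : 0 < ε) :
    ∀ᶠ τ in 𝓝 t, ∀ s ∈ K, ‖F τ s - F t s‖ < ε := by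
  refine hK.eventually_forall_of_forall_eventually fun s _ => ?_
  have h1 : Continuous fun z : ℝ × ℝ => ‖F z.1 z.2 - F t z.2‖ :=
    (hF.sub (hF.comp (continuous_const.prodMk continuous_snd))).norm
  have h2 := h1.tendsto (t, s)
  simp only [sub_self, norm_zero] at h2
  exact h2.eventually (gt_mem_nhds hε)

/-- A short strong pulse of the `l`-th control approximates the flow of `± H_l`, so that the support
functional does not decrease along this flow. -/
lemma supp_le_of_isCurve_control (hs : IsControlSystem m Q H) (h0 : IsDenseStates Q₀ Q)
    (ht : t ∈ goodTimes Q₀ Q H) (l : Fin r) (c : ℝ) {γ : ℝ → E} {a b : ℝ} (hab : a < b)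
    (hγ : IsCurve m Q (c • H l.succ t) γ a b) {t' : ℚ} (ht' : (t' : ℝ) < t) {x : E} (hx : x ∈ Q₀) :
    supp Q H t' x t (γ a) ≤ supp Q H t' x t (γ b) := by
  have hQ := hs.isStateSet
  have hxQ : x ∈ closure Q := subset_closure (h0.subset hx)
  have hw := hs.isSublinear_supp ht'.le hxQ (hQ.norm_eq_one hxQ).le
  set δ : ℝ → E := fun s => γ (projIcc a b hab.le s) with hδ
  have hδN : ∀ s, δ s ∈ chartSet m (closure Q) := fun s => (hγ _ (projIcc a b hab.le s).2).1
  have hδc : Continuous δ := by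
    have h1 : Continuous ((Icc a b).domRestrict γ) :=
      continuousOn_iff_continuous_domRestrict.1 hγ.continuousOn
    exact h1.comp continuous_projIcc
  have hδγ : ∀ s ∈ Icc a b, δ s = γ s := fun s h => by simp [hδ, projIcc_of_mem hab.le h]
  have hcont : ∀ i, Continuous fun z : ℝ × ℝ => weakExt (H i z.1) (δ z.2) := fun i =>
    (IsTangent.continuousOn_weakExt_family hQ (hs.isTangent i) (hs.continuous i)).comp_continuous
      (continuous_fst.prodMk (hδc.comp continuous_snd)) fun z => ⟨mem_univ _, hδN _⟩
  have hcl : γ a ∈ closure Q₀ := h0.closure_subset (hγ a (left_mem_Icc.2 hab.le)).1.1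
  obtain ⟨C₀, hC₀⟩ := ((isCompact_Icc (a := t - 1) (b := t)).prod
    (isCompact_Icc (a := a) (b := b))).exists_bound_of_continuousOn (hcont 0).continuousOn
  have key : ∀ ε > 0, supp Q H t' x t (γ a) ≤ supp Q H t' x t (γ b) + 5 * ε := by
    intro ε hε
    obtain ⟨q, hq, hqa⟩ := Metric.mem_closure_iff.1 hcl ε hε
    rw [dist_eq_norm, norm_sub_rev] at hqa
    lift q to D using hQ.subset (h0.subset hq)
    have hFc : ∀ᶠ τ in 𝓝 t, supp Q H t' x t q - ε < supp Q H t' x τ q :=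
      (ht x hx q hq t' ht').continuousAt.eventually (lt_mem_nhds (by linarith))
    set K := (|c| + 1) * (b - a) with hK
    have hKpos : 0 < K := by have := sub_pos.2 hab; positivity
    have hun := isCompact_eventually_norm_sub_lt
      (F := fun τ s => weakExt (H l.succ τ) (δ s)) (hcont l.succ) (isCompact_Icc (a := a) (b := b)) t
      (show 0 < ε / K by positivity)
    obtain ⟨ν, hν, hν'⟩ := Metric.eventually_nhds_iff.1 (hFc.and hun)
    set η := min (min 1 (t - t')) (min (ν / 2) (ε / (|C₀| + 1))) with hη
    have hηpos : 0 < η := by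
      have := sub_pos.2 ht'
      positivity
    have hη1 : η ≤ 1 := (min_le_left _ _).trans (min_le_left _ _)
    have hη2 : η ≤ t - t' := (min_le_left _ _).trans (min_le_right _ _)
    have hη3 : η ≤ ν / 2 := (min_le_right _ _).trans (min_le_left _ _)
    have hη4 : |C₀| * η ≤ ε := by
      have h1 : η ≤ ε / (|C₀| + 1) := (min_le_right _ _).trans (min_le_right _ _)
      rw [le_div_iff₀ (by positivity)] at h1
      nlinarith
    have hνη : ∀ τ ∈ Icc (t - η) t, dist τ t < ν := by
      intro τ hτ
      rw [Real.dist_eq, abs_lt]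
      exact ⟨by linarith [hτ.1], by linarith [hτ.2]⟩
    set σ := (b - a) / η with hσ
    have hσpos : 0 < σ := by have := sub_pos.2 hab; positivity
    have hση : σ * η = b - a := div_mul_cancel₀ _ hηpos.ne'
    set α : Fin r → ℝ := Pi.single l (σ * c) with hα
    obtain ⟨Φ, hΦ⟩ := hs.exists_isPropagator α (show t - η ≤ t by linarith)
    obtain ⟨y, hy, hsol⟩ := hs.exists_solution α (t - η) q (h0.subset hq)
    set θ : ℝ → ℝ := fun τ => a + σ * (τ - (t - η)) with hθ
    have hθm : ∀ τ ∈ Icc (t - η) t, θ τ ∈ Icc a b := by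
      intro τ hτ
      refine ⟨by have := mul_nonneg hσpos.le (sub_nonneg.2 hτ.1); simp only [hθ]; linarith, ?_⟩
      have : σ * (τ - (t - η)) ≤ σ * η := by
        have := hτ.2
        gcongr; linarith
      simp only [hθ]; linarith
    have hθm' : ∀ τ ∈ Ioo (t - η) t, θ τ ∈ Ioo a b := by
      intro τ hτ
      refine ⟨by have := mul_pos hσpos (sub_pos.2 hτ.1); simp only [hθ]; linarith, ?_⟩
      have : σ * (τ - (t - η)) < σ * η := by
        have := hτ.2
        gcongr; linarith
      simp only [hθ]; linarith
    have hθd : ∀ τ, HasDerivAt θ σ τ := by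
      intro τ
      have := (((hasDerivAt_id τ).sub_const (t - η)).const_mul σ).const_add a
      rw [mul_one] at this
      exact this
    have hgen : ∀ τ, generator H α τ = H 0 τ + (σ * c) • H l.succ τ := by
      intro τ
      rw [generator, Finset.sum_eq_single l]
      · simp [hα]
      · intro j _ hj; simp [hα, hj]
      · simp
    have hmain := hs.norm_sub_le (show t - η ≤ t by linarith) hsol (z := fun τ => γ (θ τ))
      (e := fun τ => σ • weakExt (c • H l.succ t) (γ (θ τ))) (C := |C₀| + σ * (|c| * (ε / K)))
      (by positivity) (fun τ hτ => (hγ _ (hθm τ hτ)).1)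
      (hγ.continuousOn.comp (continuous_iff_continuousAt.2
        fun τ => (hθd τ).continuousAt).continuousOn hθm)
      (fun τ hτ => by exact (hγ.hasDerivAt (hθm' τ hτ)).scomp τ (hθd τ)) (fun τ hτ => ?_)
    · have h1 : ‖(y t : E) - γ b‖ ≤ ε + (ε + ε) := by
        have h2 : θ t = b := by simp only [hθ, sub_sub_cancel, hση]; ring
        have h3 : θ (t - η) = a := by simp [hθ]
        simp only [h2, h3, hy, sub_sub_cancel] at hmain
        have h4 : (|C₀| + σ * (|c| * (ε / K))) * η ≤ ε + ε := by
          have h5 : (|C₀| + σ * (|c| * (ε / K))) * η = |C₀| * η + (|c| * (b - a)) * (ε / K) := by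
            rw [← hση]; ring
          have h6 : (|c| * (b - a)) * (ε / K) ≤ K * (ε / K) := by
            have := sub_pos.2 hab
            gcongr
            rw [hK]; nlinarith
          rw [mul_div_cancel₀ _ hKpos.ne'] at h6
          linarith
        linarith
      have h2 := hΦ.apply y hsol
      rw [hy] at h2
      have h3 := hs.supp_le_supp_evo (show (t' : ℝ) ≤ t - η by linarith) (Evo.of_isPropagator hΦ)
        (subset_stateSpan Q (h0.subset hq)) (closure_subset_stateSpan Q hxQ)
      rw [h2] at h3
      have h4 := hw.sub_le (y t) (γ b)
      have h5 := hw.sub_le (γ a) q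
      rw [norm_sub_rev] at h5
      have h6 := (hν' (hνη (t - η) ⟨le_rfl, by linarith⟩)).1
      linarith
    · have hτ' := Ioo_subset_Icc_self hτ
      have hN := (hγ _ (hθm τ hτ')).1
      rw [hgen, (hs.isTangent 0 τ).weakExt_add hQ ((hs.isTangent l.succ τ).smul _) hN,
        (hs.isTangent l.succ τ).weakExt_smul hQ _ hN, (hs.isTangent l.succ t).weakExt_smul hQ _ hN]
      have h1 : ‖weakExt (H 0 τ) (γ (θ τ))‖ ≤ |C₀| := by
        have := hC₀ (τ, θ τ) ⟨⟨by linarith [hτ.1], hτ.2.le⟩, hθm τ hτ'⟩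
        simp only [hδγ _ (hθm τ hτ')] at this
        exact this.trans (le_abs_self _)
      have h2 : ‖weakExt (H l.succ τ) (γ (θ τ)) - weakExt (H l.succ t) (γ (θ τ))‖ ≤ ε / K := by
        have := (hν' (hνη τ hτ')).2 _ (hθm τ hτ')
        rw [hδγ _ (hθm τ hτ')] at this
        exact this.le
      have h3 : weakExt (H 0 τ) (γ (θ τ)) + (σ * c) • weakExt (H l.succ τ) (γ (θ τ))
          - σ • c • weakExt (H l.succ t) (γ (θ τ)) = weakExt (H 0 τ) (γ (θ τ))
          + (σ * c) • (weakExt (H l.succ τ) (γ (θ τ)) - weakExt (H l.succ t) (γ (θ τ))) := by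
        rw [smul_sub, smul_smul]; abel
      rw [h3]
      refine (norm_add_le _ _).trans (add_le_add h1 ?_)
      rw [norm_smul, Real.norm_eq_abs, abs_mul, abs_of_pos hσpos, mul_assoc]
      gcongr
  refine le_of_forall_pos_le_add fun ε hε => ?_
  have := key (ε / 5) (by positivity)
  linarith

/-- The control operators are null. -/
theorem isNull_control (hs : IsControlSystem m Q H) (h0 : IsDenseStates Q₀ Q)
    (ht : t ∈ goodTimes Q₀ Q H) (l : Fin r) : IsNull Q₀ Q H t (H l.succ t) := by
  intro t' ht' x hx q hq p hp
  have hQ := hs.isStateSet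
  have hA := hs.isTangent l.succ t
  obtain ⟨ε, hε, γ, hγ0, hγ⟩ := exists_isCurve hQ hA (hQ.subset_chartSet (h0.subset hq))
  have hd : HasDerivAt (fun s => ⟪γ s, p⟫_ℝ) ⟪(H l.succ t q : E), p⟫_ℝ 0 := by
    have := (hγ.hasDerivAt (s := 0) ⟨by linarith, hε⟩).inner ℝ (hasDerivAt_const 0 p)
    rw [hγ0, weakExt_coe hQ.dense hA.skew] at this
    simpa using this
  refine IsLocalMax.hasDerivAt_eq_zero ?_ hd
  filter_upwards [Icc_mem_nhds (show -ε < 0 by linarith) hε] with s hs'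
  rw [hγ0, hp.eq]
  refine (hp.le (γ s)).trans ?_
  rcases lt_trichotomy s 0 with h | rfl | h
  · have h1 : IsCurve m Q ((1 : ℝ) • H l.succ t) γ s 0 := by
      rw [one_smul]; exact hγ.mono hs'.1 hε.le
    have := hs.supp_le_of_isCurve_control h0 ht l 1 h h1 ht' hx
    rwa [hγ0] at this
  · rw [hγ0]
  · have h1 : IsCurve m Q ((-1 : ℝ) • H l.succ t) (fun u => γ (s - u)) 0 s := by
      intro u hu
      have hm : ∀ u ∈ Icc 0 s, s - u ∈ Icc (-ε) ε :=
        fun u hu => ⟨by linarith [hu.2], by linarith [hu.1, hs'.2]⟩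
      obtain ⟨h2, h3⟩ := hγ _ (hm u hu)
      refine ⟨h2, ?_⟩
      have h4 : HasDerivWithinAt (fun u : ℝ => s - u) (-1) (Icc 0 s) u := by
        simpa using ((hasDerivAt_id u).const_sub s).hasDerivWithinAt
      have h5 := h3.scomp u h4 hm
      rw [← hA.weakExt_smul hQ (-1) h2] at h5
      exact h5
    have := hs.supp_le_of_isCurve_control h0 ht l (-1) h h1 ht' hx
    simpa [hγ0] using this

end IsControlSystem
end LieNull

section DriftDerivative

variable {E : Type*} [NormedAddCommGroup E] [InnerProductSpace ℝ E] {m r : ℕ}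
  {D : Submodule ℝ E} {Q : Set E} {H : Fin (r + 1) → ℝ → Module.End ℝ D} {Q₀ : Set E} {t : ℝ}
  [CompleteSpace E]

/-! ### The derivative along the drift of a null family is null -/

/-- Along a compact piece of a curve, the difference quotients of a family converge uniformly in
a neighbourhood of the curve. -/
lemma exists_forall_norm_slope_sub_lt (hQ : IsStateSet m D Q) {X Y : ℝ → Module.End ℝ D}
    (hX : ∀ t, IsTangent m Q (X t))
    (hd : ∀ (t : ℝ) (ψ : D), HasDerivAt (fun s => (X s ψ : E)) (Y t ψ) t) (t : ℝ) {z : ℝ → E}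
    {K : Set ℝ} (hK : IsCompact K) (hz : ContinuousOn z K)
    (hzN : ∀ s ∈ K, z s ∈ chartSet m (closure Q)) {ε : ℝ} (hε : 0 < ε) :
    ∃ δ > 0, ∀ s ∈ K, ∀ h, 0 < h → h < δ → ∀ x ∈ chartSet m (closure Q), ‖x - z s‖ < δ →
      ‖h⁻¹ • (weakExt (X (t + h)) x - weakExt (X t) x) - weakExt (Y t) (z s)‖ < ε := by
  refine hK.induction_on (p := fun K => ∃ δ > 0, ∀ s ∈ K, ∀ h, 0 < h → h < δ →
    ∀ x ∈ chartSet m (closure Q), ‖x - z s‖ < δ →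
      ‖h⁻¹ • (weakExt (X (t + h)) x - weakExt (X t) x) - weakExt (Y t) (z s)‖ < ε)
    ⟨1, one_pos, fun s hs => hs.elim⟩ ?_ ?_ ?_
  · rintro s s' hss ⟨δ, hδ, h⟩
    exact ⟨δ, hδ, fun u hu => h u (hss hu)⟩
  · rintro s s' ⟨δ, hδ, h⟩ ⟨δ', hδ', h'⟩
    refine ⟨min δ δ', lt_min hδ hδ', ?_⟩
    rintro u (hu | hu) k hk0 hk x hx hxz
    · exact h u hu k hk0 (hk.trans_le (min_le_left _ _)) x hx (hxz.trans_le (min_le_left _ _))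
    · exact h' u hu k hk0 (hk.trans_le (min_le_right _ _)) x hx (hxz.trans_le (min_le_right _ _))
  · intro s hs
    have hY := IsTangent.timeDeriv hX hd t
    have h1 := IsTangent.tendsto_weakExt_slope hQ hX hd t (hzN s hs)
    have h2 := h1.eventually (Metric.ball_mem_nhds _ (half_pos hε))
    obtain ⟨P₁, hP₁, P₂, hP₂, hP⟩ := eventually_prod_iff.1 h2
    obtain ⟨δ₁, hδ₁, hδ₁'⟩ := Metric.mem_nhdsWithin_iff.1 hP₁
    obtain ⟨δ₂, hδ₂, hδ₂'⟩ := Metric.mem_nhdsWithin_iff.1 hP₂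
    have hev : ∀ᶠ u in 𝓝[K] s, ‖z u - z s‖ < δ₂ / 2 ∧
        ‖weakExt (Y t) (z u) - weakExt (Y t) (z s)‖ < ε / 2 := by
      simp only [← dist_eq_norm]
      exact ((hz s hs).eventually (Metric.ball_mem_nhds _ (half_pos hδ₂))).and
        (((hY.continuousOn_weakExt hQ).comp hz hzN s hs).eventually
          (Metric.ball_mem_nhds _ (half_pos hε)))
    refine ⟨{u | ‖z u - z s‖ < δ₂ / 2 ∧ ‖weakExt (Y t) (z u) - weakExt (Y t) (z s)‖ < ε / 2}, hev,
      min δ₁ (δ₂ / 2), lt_min hδ₁ (half_pos hδ₂), ?_⟩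
    rintro u ⟨hu1, hu2⟩ k hk0 hk x hx hxz
    have h3 : P₁ k := hδ₁' ⟨by
      rw [Metric.mem_ball, Real.dist_eq, sub_zero, abs_of_pos hk0]
      exact hk.trans_le (min_le_left _ _), hk0.ne'⟩
    have h4 : P₂ x := hδ₂' ⟨by
      rw [Metric.mem_ball, dist_eq_norm]
      have h5 : x - z s = (x - z u) + (z u - z s) := by abel
      rw [h5]
      have := hxz.trans_le (min_le_right δ₁ (δ₂ / 2))
      exact (norm_add_le _ _).trans_lt (by linarith), hx⟩
    have h5 := hP h3 h4
    rw [dist_eq_norm] at h5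
    have h6 : k⁻¹ • (weakExt (X (t + k)) x - weakExt (X t) x) - weakExt (Y t) (z u)
        = (k⁻¹ • (weakExt (X (t + k)) x - weakExt (X t) x) - weakExt (Y t) (z s))
          - (weakExt (Y t) (z u) - weakExt (Y t) (z s)) := by abel
    rw [h6]
    exact (norm_sub_le _ _).trans_lt (by linarith)

/-- Integral curves of nearby operators with the same initial value stay close. -/
lemma IsCurve.norm_sub_le (hQ : IsStateSet m D Q) {A B : Module.End ℝ D} (hA : IsTangent m Q A)
    {y z : ℝ → E} {b C : ℝ} (hb : 0 ≤ b) (hy : IsCurve m Q A y 0 b) (hz : IsCurve m Q B z 0 b)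
    (h0 : y 0 = z 0) (hC : 0 ≤ C) (hAB : ∀ s ∈ Icc 0 b, ‖weakExt A (z s) - weakExt B (z s)‖ ≤ C) :
    ‖y b - z b‖ ≤ C * b := by
  have h1 := norm_le_add_of_inner_deriv_le (u := fun s => y s - z s)
    (u' := fun s => weakExt A (y s) - weakExt B (z s)) hb (hy.continuousOn.sub hz.continuousOn)
    (fun s hs => (hy.hasDerivAt hs).sub (hz.hasDerivAt hs)) hC fun s hs => ?_
  · simpa [h0] using h1
  have hs' := Ioo_subset_Icc_self hs
  have hyN := (hy s hs').1
  have hzN := (hz s hs').1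
  have h2 : ⟪y s - z s, weakExt A (y s) - weakExt A (z s)⟫_ℝ = 0 := by
    have h3 := hA.inner_weakExt_add hQ hyN hyN
    have h4 := hA.inner_weakExt_add hQ hzN hzN
    have h5 := hA.inner_weakExt_add hQ hyN hzN
    have h6 := real_inner_comm (y s) (weakExt A (y s))
    have h7 := real_inner_comm (z s) (weakExt A (z s))
    have h8 := real_inner_comm (z s) (weakExt A (y s))
    simp only [inner_sub_left, inner_sub_right]
    linarith
  have h3 : weakExt A (y s) - weakExt B (z s)
      = (weakExt A (y s) - weakExt A (z s)) + (weakExt A (z s) - weakExt B (z s)) := by abel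
  rw [h3, inner_add_right, h2, zero_add, mul_comm]
  exact (real_inner_le_norm _ _).trans (mul_le_mul_of_nonneg_left (hAB s hs') (norm_nonneg _))

namespace IsControlSystem

/-- A first-order expansion of the propagators, uniform near a given time and state. -/
lemma exists_norm_propagator_sub_le (hs : IsControlSystem m Q H) (a : Fin r → ℝ) (t : ℝ) {x : E}
    (hx : x ∈ chartSet m (closure Q)) {ε : ℝ} (hε : 0 < ε) :
    ∃ δ > 0, ∀ τ h, |τ - t| < δ → 0 ≤ h → h < δ → ∀ Φ, IsPropagator Q H a τ (τ + h) Φ →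
      ∀ η ∈ closure Q, ‖η - x‖ < δ → ‖Φ η - η - h • weakExt (generator H a t) x‖ ≤ ε * h := by
  have hQ := hs.isStateSet
  -- continuity of the generator at `(t, x)`
  have hcont := IsTangent.continuousOn_weakExt_family hQ (hs.isTangent_generator a)
    (hs.continuous_generator a) (t, x) ⟨mem_univ _, hx⟩
  obtain ⟨δ₁, hδ₁, hδ₁'⟩ := Metric.mem_nhdsWithin_iff.1
    (hcont.eventually (Metric.ball_mem_nhds _ hε))
  have hclose : ∀ τ y, |τ - t| < δ₁ → ‖y - x‖ < δ₁ → y ∈ chartSet m (closure Q) →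
      ‖weakExt (generator H a τ) y - weakExt (generator H a t) x‖ < ε := by
    intro τ y h1 h2 h3
    have h4 : (τ, y) ∈ Metric.ball (t, x) δ₁ := by
      rw [Metric.mem_ball, Prod.dist_eq, max_lt_iff, Real.dist_eq, dist_eq_norm]
      exact ⟨h1, h2⟩
    have h5 := hδ₁' ⟨h4, mem_univ _, h3⟩
    rw [← dist_eq_norm]
    exact h5
  set w := weakExt (generator H a t) x with hw
  set C := ‖w‖ + ε with hC
  have hCpos : 0 < C := by positivity
  refine ⟨min (δ₁ / 2) (δ₁ / (2 * C)), by positivity, fun t₁ h ht₁ hh0 hh Φ hΦ => ?_⟩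
  have ht₂ := abs_lt.1 (ht₁.trans_le (min_le_left _ _))
  have hh1 : h < δ₁ / 2 := hh.trans_le (min_le_left _ _)
  have hh2 : C * h < δ₁ / 2 := by
    have := hh.trans_le (min_le_right _ _)
    rw [lt_div_iff₀ (by positivity)] at this
    linarith
  have hmain : ∀ q : D, (q : E) ∈ Q → ‖(q : E) - x‖ < δ₁ / 2 → ‖Φ q - q - h • w‖ ≤ ε * h := by
    intro q hq hqx
    obtain ⟨y, hy, hsol⟩ := hs.exists_solution a t₁ q hq
    have hyx : ∀ τ ∈ Icc t₁ (t₁ + h), ‖(y τ : E) - x‖ < δ₁ := by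
      intro τ hτ
      have h1 := hs.norm_sub_le hτ.1 hsol (z := fun _ => (q : E)) (e := fun _ => 0) hCpos.le
        (fun _ _ => hQ.subset_chartSet hq) continuousOn_const (fun t _ => hasDerivAt_const _ _)
        (fun s hs' => by
          rw [sub_zero]
          have h2 := hclose s q
            (by rw [abs_lt]; constructor <;> linarith [hs'.1, hs'.2, hτ.2, ht₂.1, ht₂.2])
            (by linarith) (hQ.subset_chartSet hq)
          have h3 := norm_le_norm_add_norm_sub' (weakExt (generator H a s) (q : E)) w
          linarith)
      simp only [hy, sub_self, norm_zero, zero_add] at h1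
      have h2 : (y τ : E) - x = ((y τ : E) - q) + (q - x) := by abel
      rw [h2]
      have h3 : C * (τ - t₁) ≤ C * h := by
        have := hτ.2
        gcongr; linarith
      exact (norm_add_le _ _).trans_lt (by linarith)
    have h1 := norm_image_sub_le_of_norm_deriv_le_segment' (a := t₁) (b := t₁ + h)
      (f := fun τ => (y τ : E) - (τ - t₁) • w)
      (f' := fun τ => (generator H a τ (y τ) : E) - w) (C := ε) (fun τ hτ => ?_)
      (fun τ hτ => ?_) (t₁ + h) (right_mem_Icc.2 (by linarith))
    · have h2 := hΦ.apply y hsol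
      rw [hy] at h2
      simp only [add_sub_cancel_left, sub_self, zero_smul, sub_zero, hy] at h1
      rw [h2, sub_right_comm]
      exact h1
    · have h2 := (hsol.deriv τ hτ.1).mono (Icc_subset_Ici_self : Icc t₁ (t₁ + h) ⊆ Ici t₁)
      have h3 : HasDerivAt (fun τ : ℝ => (τ - t₁) • w) w τ := by
        simpa using ((hasDerivAt_id τ).sub_const t₁).smul_const w
      exact h2.sub h3.hasDerivWithinAt
    · have hτ' := Ico_subset_Icc_self hτ
      have h2 := hclose τ (y τ)
        (by rw [abs_lt]; constructor <;> linarith [hτ.1, hτ.2, ht₂.1, ht₂.2])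
        (hyx τ hτ') (hQ.subset_chartSet (hsol.mem τ hτ.1))
      rw [weakExt_coe hQ.dense (isSkew_generator hs.skew a τ)] at h2
      exact h2.le
  intro η hη hηx
  have hηx' : ‖η - x‖ < δ₁ / 2 := hηx.trans_le (min_le_left _ _)
  have hne : (𝓝[Q] η).NeBot := mem_closure_iff_nhdsWithin_neBot.1 hη
  have hc : Continuous fun η => ‖Φ η - η - h • w‖ := by fun_prop
  refine le_of_tendsto (hc.continuousWithinAt (s := Q) (x := η)) ?_
  have hc' : ∀ᶠ q in 𝓝[Q] η, ‖q - x‖ < δ₁ / 2 :=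
    ((continuous_id.sub continuous_const).norm.continuousWithinAt (s := Q)
      (x := η)).eventually (gt_mem_nhds hηx')
  filter_upwards [hc', self_mem_nhdsWithin] with q h1 h2
  exact hmain ⟨q, hQ.subset h2⟩ h2 h1

/-- Propagators over short times are strongly close to the identity on the span of the states. -/
lemma exists_norm_propagator_sub_lt (hs : IsControlSystem m Q H) (t : ℝ) {p : E}
    (hp : p ∈ stateSpan Q) {ε : ℝ} (hε : 0 < ε) :
    ∃ δ > 0, ∀ h, 0 < h → h < δ → ∀ Φ, IsPropagator Q H 0 t (t + h) Φ → ‖Φ p - p‖ < ε := by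
  have hex : ∀ h : ℝ, ∃ Φ, 0 ≤ h → IsPropagator Q H 0 t (t + h) Φ := by
    intro h
    by_cases h0 : 0 ≤ h
    · obtain ⟨Φ, hΦ⟩ := hs.exists_isPropagator 0 (show t ≤ t + h by linarith)
      exact ⟨Φ, fun _ => hΦ⟩
    · exact ⟨0, fun h' => (h0 h').elim⟩
  choose Ψ hΨ using hex
  have h1 : Tendsto (fun h => Ψ h p) (𝓝[>] 0) (𝓝 (ContinuousLinearMap.id ℝ E p)) := by
    refine tendsto_of_mem_stateSpan ?_ (fun x hx => ?_) hp
    · filter_upwards [self_mem_nhdsWithin] with h h0 using (hΨ h (le_of_lt h0)).norm_le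
    · lift x to D using hs.isStateSet.subset hx
      obtain ⟨C, hC0, hC⟩ := hs.exists_bound 0 x t (t + 1)
      rw [tendsto_iff_norm_sub_tendsto_zero]
      have h2 : Tendsto (fun h : ℝ => C * h) (𝓝[>] 0) (𝓝 0) := by
        have : Tendsto (fun h : ℝ => C * h) (𝓝 0) (𝓝 (C * 0)) :=
          (continuous_const.mul continuous_id).tendsto 0
        rw [mul_zero] at this
        exact this.mono_left nhdsWithin_le_nhds
      refine squeeze_zero' (Eventually.of_forall fun _ => norm_nonneg _) ?_ h2
      filter_upwards [Ioo_mem_nhdsGT (zero_lt_one' ℝ)] with h hh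
      have := hs.norm_propagator_sub_le (hΨ h hh.1.le) hx hC0 fun s hs' => by
        simpa [generator] using hC s ⟨hs'.1.le, by linarith [hs'.2, hh.2]⟩
      simpa using this
  obtain ⟨δ, hδ, hδ'⟩ := Metric.mem_nhdsWithin_iff.1 (h1.eventually (Metric.ball_mem_nhds _ hε))
  refine ⟨δ, hδ, fun h h0 hh Φ hΦ => ?_⟩
  have h2 : dist (Ψ h p) p < ε := hδ' ⟨by
    rw [Metric.mem_ball, Real.dist_eq, sub_zero, abs_of_pos h0]; exact hh, h0⟩
  have h3 : EqOn Φ (Ψ h) (Submodule.span ℝ Q : Set E) := by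
    refine LinearMap.eqOn_span (f := Φ.toLinearMap) (g := (Ψ h).toLinearMap) fun x hx => ?_
    obtain ⟨y, hy, hsol⟩ := hs.exists_solution 0 t ⟨x, hs.isStateSet.subset hx⟩ hx
    have h4 := hΦ.apply y hsol
    have h5 := (hΨ h h0.le).apply y hsol
    rw [hy] at h4 h5
    exact h4.trans h5.symm
  rw [h3.closure Φ.continuous (Ψ h).continuous hp, ← dist_eq_norm]
  exact h2

/-- One sign of the expectation of `-[H₀, X] + ∂X/∂t`, for a family `X` of null operators: flowing
along `X` at slightly different times would otherwise increase the support functional too fast. -/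
lemma inner_le_zero_of_isNull (hs : IsControlSystem m Q H) (h0 : IsDenseStates Q₀ Q)
    (hQ₀c : Q₀.Countable) (ht : t ∈ goodTimes Q₀ Q H) {X Y : ℝ → Module.End ℝ D}
    (hX : ∀ t, IsTangent m Q (X t))
    (hd : ∀ (t : ℝ) (ψ : D), HasDerivAt (fun s => (X s ψ : E)) (Y t ψ) t)
    (hXn : ∀ t ∈ goodTimes Q₀ Q H, IsNull Q₀ Q H t (X t))
    (hcomm : IsNull Q₀ Q H t ((-(H 0 t * X t - X t * H 0 t) + Y t) * X t
      - X t * (-(H 0 t * X t - X t * H 0 t) + Y t)))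
    {t' : ℚ} (ht' : (t' : ℝ) < t) {x : E} (hx : x ∈ Q₀) {q : D} (hq : (q : E) ∈ Q₀) {p : E}
    (hp : IsOpt Q (supp Q H t' x t) q p) :
    ⟪((-(H 0 t * X t - X t * H 0 t) + Y t) q : E), p⟫_ℝ ≤ 0 := by
  have hQ := hs.isStateSet
  have hY := IsTangent.timeDeriv hX hd t
  have hK := (hs.isTangent 0 t).commutator hQ (hX t)
  set K := H 0 t * X t - X t * H 0 t with hKdef
  set Z := -K + Y t with hZdef
  have hZ : IsTangent m Q Z := hK.neg.add hY
  have hxQ : x ∈ closure Q := subset_closure (h0.subset hx)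
  have hqN := hQ.subset_chartSet (h0.subset hq)
  obtain ⟨V, hV⟩ := hs.exists_isFlow h0 (hX t) (hXn t ht)
  set c := ⟪(Z q : E), p⟫_ℝ with hc
  have hp1 : ‖p‖ ≤ 1 := hp.norm_le_one (hs.isSublinear_supp ht'.le hxQ (hQ.norm_eq_one hxQ).le)
  -- the expectation of `Z` is constant along the flow of `X t`
  have hZc : ∀ S, 0 ≤ S → ⟪weakExt Z (V S q), V S p⟫_ℝ = c := by
    intro S hS
    rcases hS.eq_or_lt with rfl | hS0
    · rw [hV.zero q hqN, hV.zero_of_mem_stateSpan hQ hp.mem, weakExt_coe hQ.dense hZ.skew]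
    have h1 := hV.hasDerivWithinAt_inner_weakExt hQ (hX t) hZ hS hqN hp.mem
    have h2 : ∀ s ∈ Icc 0 S, ⟪weakExt (Z * X t - X t * Z) (V s q), V s p⟫_ℝ = 0 := fun s hs' =>
      hs.inner_weakExt_eq_zero h0 (hZ.commutator hQ (hX t)) hcomm ht' hxQ (hV.mem hs'.1 hqN)
        (hs.isOpt_flow h0 (hX t) (hXn t ht) hV ht' (h0.subset hx) hqN hp hs'.1)
    have h3 := (convex_Icc 0 S).norm_image_sub_le_of_norm_hasDerivWithin_le (C := 0) h1
      (fun s hs' => by rw [h2 s hs', norm_zero]) (left_mem_Icc.2 hS) (right_mem_Icc.2 hS)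
    rw [zero_mul, norm_le_zero_iff, sub_eq_zero, hV.zero q hqN,
      hV.zero_of_mem_stateSpan hQ hp.mem, weakExt_coe hQ.dense hZ.skew] at h3
    exact h3
  -- the main inequality: `c S` is bounded by a constant independent of `S`
  set d := deriv (fun τ => supp Q H t' x τ q) t with hd'
  have hdd : HasDerivAt (fun τ => supp Q H t' x τ q) d t := (ht x hx q hq t' ht').hasDerivAt
  have hmain : ∀ S, 0 < S → c * S - ⟪(H 0 t q : E), p⟫_ℝ ≤ d := by
    intro S hS
    have hVq := hV.isCurve q hqN S hS.le
    have hVqN : ∀ s ∈ Icc 0 S, V s q ∈ chartSet m (closure Q) := fun s hs' => (hVq s hs').1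
    have hVS := hV.mem hS.le hqN
    obtain ⟨CY, hCY⟩ := isCompact_Icc.exists_bound_of_continuousOn
      ((hY.continuousOn_weakExt hQ).comp hVq.continuousOn hVqN)
    have key : ∀ ε > 0, c * S - ⟪(H 0 t q : E), p⟫_ℝ ≤ d + ε * (S + 3) := by
      intro ε hε
      obtain ⟨δ₁, hδ₁, hslope⟩ := exists_forall_norm_slope_sub_lt hQ hX hd t isCompact_Icc
        hVq.continuousOn hVqN hε
      obtain ⟨δ₂, hδ₂, hexp⟩ := hs.exists_norm_propagator_sub_le 0 t hVS hε
      have hgen : generator H 0 t = H 0 t := by simp [generator]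
      rw [hgen] at hexp
      set e := weakExt (H 0 t) (V S q) with he
      obtain ⟨δ₃, hδ₃, hcont⟩ := hs.exists_norm_propagator_sub_lt t
        (hV.mem_stateSpan hQ hS.le hp.mem) (show 0 < ε / (‖e‖ + 1) by positivity)
      have hdev : ∀ᶠ h in 𝓝[>] (0 : ℝ),
          supp Q H t' x (t + h) q - supp Q H t' x t q ≤ (d + ε) * h := by
        have h1 := (hasDerivAt_iff_tendsto_slope_zero.1 hdd).mono_left
          (nhdsWithin_mono _ (fun y (hy : 0 < y) => hy.ne'))
        filter_upwards [h1.eventually (gt_mem_nhds (show d < d + ε by linarith)),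
          self_mem_nhdsWithin] with h h2 h3
        have h4 : (0 : ℝ) < h := h3
        rw [smul_eq_mul, inv_mul_lt_iff₀ h4] at h2
        linarith
      obtain ⟨δ₄, hδ₄, hδ₄'⟩ := Metric.mem_nhdsWithin_iff.1 hdev
      set C := |CY| + ε with hCdef
      have hCpos : 0 < C := by positivity
      set δ := min (min δ₁ δ₂) (min (min δ₃ δ₄) (min (δ₁ / (C * S + 1)) (δ₂ / (C * S + 1)))) with hδ
      have hCS : 0 < C * S + 1 := by positivity
      have hδpos : 0 < δ := by positivity
      obtain ⟨τ, hτg, hτ1, hτ2⟩ := ((hs.dense_goodTimes hQ₀c h0.subset).exists_between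
        (show t < t + δ by linarith))
      obtain ⟨h, rfl⟩ : ∃ h, τ = t + h := ⟨τ - t, by ring⟩
      have hh0 : 0 < h := by linarith
      have hhδ : h < δ := by linarith
      have hh1 : h < δ₁ := hhδ.trans_le ((min_le_left _ _).trans (min_le_left _ _))
      have hh2 : h < δ₂ := hhδ.trans_le ((min_le_left _ _).trans (min_le_right _ _))
      have hh3 : h < δ₃ := hhδ.trans_le
        ((min_le_right _ _).trans ((min_le_left _ _).trans (min_le_left _ _)))
      have hh4 : h < δ₄ := hhδ.trans_le
        ((min_le_right _ _).trans ((min_le_left _ _).trans (min_le_right _ _)))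
      have hh5 : h * (C * S + 1) < δ₁ := by
        rw [← lt_div_iff₀ hCS]
        exact hhδ.trans_le ((min_le_right _ _).trans ((min_le_right _ _).trans (min_le_left _ _)))
      have hh6 : h * (C * S + 1) < δ₂ := by
        rw [← lt_div_iff₀ hCS]
        exact hhδ.trans_le ((min_le_right _ _).trans ((min_le_right _ _).trans (min_le_right _ _)))
      have ht'h : (t' : ℝ) < t + h := by linarith
      obtain ⟨V', hV'⟩ := hs.exists_isFlow h0 (hX (t + h)) (hXn _ hτg)
      have hV'q := hV'.isCurve q hqN S hS.le
      have hV'N : ∀ s ∈ Icc 0 S, V' s q ∈ chartSet m (closure Q) := fun s hs' => (hV'q s hs').1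
      -- the two flows are close to each other
      have hflow : ∀ s ∈ Icc 0 S, ‖V' s q - V s q‖ ≤ C * S * h := by
        intro s hs'
        have h1 := (hV'q.mono le_rfl hs'.2).norm_sub_le hQ (hX (t + h)) hs'.1
          (hVq.mono le_rfl hs'.2) (by rw [hV'.zero q hqN, hV.zero q hqN])
          (show 0 ≤ C * h by positivity) (fun u hu => ?_)
        · have h2 : C * h * s ≤ C * h * S := by
            have := hs'.2
            gcongr
          linarith
        have hu' : u ∈ Icc 0 S := ⟨hu.1, hu.2.trans hs'.2⟩
        have h2 := hslope u hu' h hh0 hh1 _ (hVqN u hu') (by simpa using hδ₁)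
        have h3 := norm_le_norm_add_norm_sub' (h⁻¹ • (weakExt (X (t + h)) (V u q)
          - weakExt (X t) (V u q))) (weakExt (Y t) (V u q))
        have h4 := hCY u hu'
        simp only [Function.comp_apply] at h4
        have h5 := le_abs_self CY
        rw [norm_smul, norm_inv, Real.norm_eq_abs, abs_of_pos hh0] at h3
        have h6 : h⁻¹ * ‖weakExt (X (t + h)) (V u q) - weakExt (X t) (V u q)‖ ≤ C := by linarith
        rwa [inv_mul_le_iff₀ hh0, mul_comm] at h6
      have hflow1 : ∀ s ∈ Icc 0 S, ‖V' s q - V s q‖ < δ₁ := fun s hs' =>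
        (hflow s hs').trans_lt (by nlinarith)
      -- the derivative of `ρ` is small
      set ρ : ℝ → ℝ := fun s => h⁻¹ * ⟪V' s q, V s p⟫_ℝ - ⟪weakExt (H 0 t) (V s q), V s p⟫_ℝ
        - c * s with hρ
      have hcX : ContinuousOn (fun s => weakExt (X (t + h)) (V' s q)) (Icc 0 S) :=
        ((hX _).continuousOn_weakExt hQ).comp hV'q.continuousOn hV'N
      have hρd : ∀ s ∈ Icc 0 S, HasDerivWithinAt ρ
          (h⁻¹ * ⟪weakExt (X (t + h)) (V' s q) - weakExt (X t) (V' s q), V s p⟫_ℝ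
            - ⟪weakExt K (V s q), V s p⟫_ℝ - c) (Icc 0 S) s := by
        intro s hs'
        have h1 := hV.hasDerivWithinAt_inner hQ (hX t) hS.le hV'N (fun s hs' => (hV'q s hs').2)
          hcX hp.mem s hs'
        have h2 := hV.hasDerivWithinAt_inner_weakExt hQ (hX t) (hs.isTangent 0 t) hS.le hqN
          hp.mem s hs'
        have h3 := ((hasDerivAt_id s).const_mul c).hasDerivWithinAt (s := Icc 0 S)
        rw [mul_one] at h3
        exact ((h1.const_mul h⁻¹).sub h2).sub h3
      have hρb : ∀ s ∈ Icc 0 S, ‖h⁻¹ * ⟪weakExt (X (t + h)) (V' s q) - weakExt (X t) (V' s q),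
          V s p⟫_ℝ - ⟪weakExt K (V s q), V s p⟫_ℝ - c‖ ≤ ε := by
        intro s hs'
        have h1 := hslope s hs' h hh0 hh1 _ (hV'N s hs') (hflow1 s hs')
        have h2 : weakExt Z (V s q) = -weakExt K (V s q) + weakExt (Y t) (V s q) := by
          rw [hZdef, hK.neg.weakExt_add hQ hY (hVqN s hs'), hK.weakExt_neg hQ (hVqN s hs')]
        have h3 := hZc s hs'.1
        rw [h2, inner_add_left, inner_neg_left] at h3
        have h4 : h⁻¹ * ⟪weakExt (X (t + h)) (V' s q) - weakExt (X t) (V' s q), V s p⟫_ℝ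
            - ⟪weakExt K (V s q), V s p⟫_ℝ - c
            = ⟪h⁻¹ • (weakExt (X (t + h)) (V' s q) - weakExt (X t) (V' s q))
              - weakExt (Y t) (V s q), V s p⟫_ℝ := by
          rw [inner_sub_left (h⁻¹ • _), real_inner_smul_left]; linarith
        rw [h4, Real.norm_eq_abs]
        refine (abs_real_inner_le_norm _ _).trans ?_
        have h5 := (hV.norm_le s p).trans hp1
        calc _ ≤ ε * 1 := mul_le_mul h1.le h5 (norm_nonneg _) hε.le
          _ = ε := mul_one _
      have hρ' := (convex_Icc 0 S).norm_image_sub_le_of_norm_hasDerivWithin_le hρd hρb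
        (left_mem_Icc.2 hS.le) (right_mem_Icc.2 hS.le)
      rw [Real.norm_eq_abs, sub_zero, Real.norm_eq_abs, abs_of_pos hS] at hρ'
      have hρ1 := (abs_le.1 hρ').1
      have hρ0 : ρ 0 = h⁻¹ * supp Q H t' x t q - ⟪(H 0 t q : E), p⟫_ℝ := by
        simp only [hρ, hV'.zero q hqN, hV.zero q hqN, hV.zero_of_mem_stateSpan hQ hp.mem,
          weakExt_coe hQ.dense (hs.skew 0 t), hp.eq]
        ring
      -- evolve `V S p` by the drift and compare with the support functional at time `t + h`
      obtain ⟨Φ, hΦ⟩ := hs.exists_isPropagator 0 (show t ≤ t + h by linarith)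
      have hw' := hs.isSublinear_supp ht'h.le hxQ (hQ.norm_eq_one hxQ).le
      have hsup : ⟪V' S q, Φ (V S p)⟫_ℝ ≤ supp Q H t' x (t + h) q := by
        have h1 := hs.supp_eq_of_isCurve h0 (hX (t + h)) (hXn _ hτg) hS.le hV'q ht'h hxQ
        simp only [hV'.zero q hqN] at h1
        rw [h1, ← ContinuousLinearMap.adjoint_inner_left]
        refine (hs.inner_flow_le_supp h0 (hX t) (hXn t ht) hV ht' (h0.subset hx) hp.le
          hS.le _).trans (hs.supp_le ht'.le fun T hT => ?_)
        rw [ContinuousLinearMap.adjoint_inner_left]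
        exact le_supp (hT.step hΦ) x _
      have hη := (hV'N S (right_mem_Icc.2 hS.le)).1
      have hexp' := hexp t h (by simpa using hδ₂) hh0.le hh2 Φ hΦ _ hη
        ((hflow S (right_mem_Icc.2 hS.le)).trans_lt (by nlinarith))
      have hcont' := hcont h hh0 hh3 Φ hΦ
      have hiso := hΦ.inner _ (closure_subset_stateSpan Q hη) _
        (hV.mem_stateSpan hQ hS.le hp.mem)
      have hΦp : ‖Φ (V S p)‖ ≤ 1 := ((hΦ.norm_le _).trans (hV.norm_le S p)).trans hp1
      have hI : ⟪V' S q, V S p⟫_ℝ - h * ⟪e, V S p⟫_ℝ - 2 * ε * h ≤ ⟪V' S q, Φ (V S p)⟫_ℝ := by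
        have h1 : ⟪Φ (V' S q), Φ (V S p)⟫_ℝ = ⟪V' S q, Φ (V S p)⟫_ℝ
            + ⟪Φ (V' S q) - V' S q - h • e, Φ (V S p)⟫_ℝ + h * ⟪e, V S p⟫_ℝ
            + h * ⟪e, Φ (V S p) - V S p⟫_ℝ := by
          rw [inner_sub_left, inner_sub_left, inner_sub_right, real_inner_smul_left]; ring
        have h2 : ⟪Φ (V' S q) - V' S q - h • e, Φ (V S p)⟫_ℝ ≤ ε * h := by
          refine (real_inner_le_norm _ _).trans ?_
          calc _ ≤ ε * h * 1 := mul_le_mul hexp' hΦp (norm_nonneg _) (by positivity)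
            _ = ε * h := mul_one _
        have h3 : ⟪e, Φ (V S p) - V S p⟫_ℝ ≤ ε := by
          refine (real_inner_le_norm _ _).trans ?_
          have h4 : ‖e‖ * ‖Φ (V S p) - V S p‖ ≤ ‖e‖ * (ε / (‖e‖ + 1)) := by gcongr
          refine h4.trans ?_
          rw [mul_div_assoc', div_le_iff₀ (by positivity)]
          nlinarith [norm_nonneg e]
        have h4 : h * ⟪e, Φ (V S p) - V S p⟫_ℝ ≤ h * ε := by gcongr
        linarith
      have hW : supp Q H t' x (t + h) q - supp Q H t' x t q ≤ (d + ε) * h := hδ₄' ⟨by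
        rw [Metric.mem_ball, Real.dist_eq, sub_zero, abs_of_pos hh0]; exact hh4, hh0⟩
      -- divide by `h`
      have hρS : ρ S = h⁻¹ * ⟪V' S q, V S p⟫_ℝ - ⟪e, V S p⟫_ℝ - c * S := rfl
      have hfin : h⁻¹ * ⟪V' S q, V S p⟫_ℝ - ⟪e, V S p⟫_ℝ - h⁻¹ * supp Q H t' x t q
          ≤ d + 3 * ε := by
        have h1 : h⁻¹ * (⟪V' S q, V S p⟫_ℝ - h * ⟪e, V S p⟫_ℝ - supp Q H t' x t q)
            ≤ d + 3 * ε := by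
          rw [inv_mul_le_iff₀ hh0]
          linarith
        rw [mul_sub, mul_sub, inv_mul_cancel_left₀ hh0.ne'] at h1
        exact h1
      rw [hρ0, hρS] at hρ1
      linarith
    refine le_of_forall_pos_le_add fun ε hε => ?_
    have h1 := key (ε / (S + 3)) (by positivity)
    rwa [div_mul_cancel₀ _ (by positivity)] at h1
  by_contra! hcon
  have h1 := hmain ((|d + ⟪(H 0 t q : E), p⟫_ℝ| + 1) / c) (by positivity)
  rw [mul_div_cancel₀ _ hcon.ne'] at h1
  have h2 := le_abs_self (d + ⟪(H 0 t q : E), p⟫_ℝ)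
  linarith

/-- If the operators of the family `X` are null, at the times at which the support functionals are
differentiable, and the commutator of `X` with `-[H₀, X] + ∂X/∂t` is null, then
`-[H₀, X] + ∂X/∂t` is null. -/
theorem isNull_drift (hs : IsControlSystem m Q H) (h0 : IsDenseStates Q₀ Q)
    (hQ₀c : Q₀.Countable) (ht : t ∈ goodTimes Q₀ Q H) {X Y : ℝ → Module.End ℝ D}
    (hX : ∀ t, IsTangent m Q (X t))
    (hd : ∀ (t : ℝ) (ψ : D), HasDerivAt (fun s => (X s ψ : E)) (Y t ψ) t)
    (hXn : ∀ t ∈ goodTimes Q₀ Q H, IsNull Q₀ Q H t (X t))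
    (hcomm : IsNull Q₀ Q H t (X t * (-(H 0 t * X t - X t * H 0 t) + Y t)
      - (-(H 0 t * X t - X t * H 0 t) + Y t) * X t)) :
    IsNull Q₀ Q H t (-(H 0 t * X t - X t * H 0 t) + Y t) := by
  intro t' ht' x hx q hq p hp
  refine le_antisymm ?_ ?_
  · refine hs.inner_le_zero_of_isNull h0 hQ₀c ht hX hd hXn ?_ ht' hx hq hp
    rw [← neg_sub]
    exact hcomm.neg
  · have h1 := hs.inner_le_zero_of_isNull h0 hQ₀c ht (X := fun t => -X t) (Y := fun t => -Y t)
      (fun t => (hX t).neg) (fun t ψ => by exact (hd t ψ).neg) (fun t ht => (hXn t ht).neg)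
      ?_ ht' hx hq hp
    · have h2 : -(H 0 t * -X t - -X t * H 0 t) + -Y t = -(-(H 0 t * X t - X t * H 0 t) + Y t) := by
        refine LinearMap.ext fun v => ?_
        simp only [LinearMap.add_apply, LinearMap.sub_apply, LinearMap.neg_apply,
          Module.End.mul_apply, map_neg]
        abel
      rw [h2, LinearMap.neg_apply, Submodule.coe_neg, inner_neg_left] at h1
      linarith
    · have h2 : -(H 0 t * -X t - -X t * H 0 t) + -Y t = -(-(H 0 t * X t - X t * H 0 t) + Y t) := by
        refine LinearMap.ext fun v => ?_
        simp only [LinearMap.add_apply, LinearMap.sub_apply, LinearMap.neg_apply,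
          Module.End.mul_apply, map_neg]
        abel
      simp only [h2]
      have h3 : ∀ A B : Module.End ℝ D, -A * -B - -B * -A = -(B * A - A * B) := by
        intro A B
        refine LinearMap.ext fun v => ?_
        simp only [LinearMap.sub_apply, LinearMap.neg_apply, Module.End.mul_apply, map_neg]
        abel
      rw [h3]
      exact hcomm.neg

end IsControlSystem
end DriftDerivative

section Density

variable {E : Type*} [NormedAddCommGroup E] [InnerProductSpace ℝ E] {m r : ℕ}
  {D : Submodule ℝ E} {Q : Set E} {H : Fin (r + 1) → ℝ → Module.End ℝ D} {Q₀ : Set E} {t : ℝ}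

/-! ### Density of the reachable sets -/

/-- A space of tangent vectors of full dimension is the whole tangent space. -/
lemma exists_coordMap_eq_of_rank {v : Fin m → E}
    {G : EuclideanSpace ℝ (Fin m) → E} {ξ : EuclideanSpace ℝ (Fin m)}
    {W : Submodule ℝ D} (hW : Module.rank ℝ W = (m : Cardinal))
    (h : ∀ z ∈ W, fderiv ℝ G ξ (coordMap v (z : E)) = z)
    (w : EuclideanSpace ℝ (Fin m)) : ∃ z ∈ W, coordMap v (z : E) = w := by
  have hfr : Module.finrank ℝ W = m := Module.finrank_eq_of_rank_eq hW
  have hfin : FiniteDimensional ℝ W := by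
    rw [FiniteDimensional, ← Module.rank_lt_aleph0_iff, hW]
    exact Cardinal.natCast_lt_aleph0
  set f : W →ₗ[ℝ] EuclideanSpace ℝ (Fin m) :=
    (coordMap v).toLinearMap ∘ₗ D.subtype ∘ₗ W.subtype with hf
  have hinj : Function.Injective f := by
    intro z z' hzz
    have h1 : coordMap v ((z : D) : E) = coordMap v ((z' : D) : E) := hzz
    have h2 := h z z.2
    rw [h1, h z' z'.2] at h2
    exact (Subtype.ext (Subtype.ext h2)).symm
  have hsurj : Function.Surjective f :=
    (LinearMap.injective_iff_surjective_of_finrank_eq_finrank (by simp [hfr])).1 hinj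
  obtain ⟨z, hz⟩ := hsurj w
  exact ⟨z, z.2, hz⟩

variable [CompleteSpace E]

/-- At time `t`, the null operators span the tangent spaces of the manifold. -/
def HasFullNull (m : ℕ) (Q₀ Q : Set E) (H : Fin (r + 1) → ℝ → Module.End ℝ D) (t : ℝ) : Prop :=
  ∀ q : D, (q : E) ∈ Q → ∃ W : Submodule ℝ D, Module.rank ℝ W = (m : Cardinal) ∧
    ∀ z ∈ W, ∃ A : Module.End ℝ D, IsTangent m Q A ∧ IsNull Q₀ Q H t A ∧ A q = z

namespace IsControlSystem

lemma supp_eventually_eq (hs : IsControlSystem m Q H) (h0 : IsDenseStates Q₀ Q)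
    (hfull : HasFullNull m Q₀ Q H t) {t' : ℚ} (ht' : (t' : ℝ) < t) {x : E} (hx : x ∈ closure Q)
    {p : E} (hp : p ∈ chartSet m (closure Q)) :
    ∀ᶠ z in 𝓝[chartSet m (closure Q)] p, supp Q H t' x t p = supp Q H t' x t z := by
  have hQ := hs.isStateSet
  obtain ⟨v, Ω, G, U, hG, hpU⟩ := hQ.exists_chart hp
  set L := coordMap (fun j => (v j : E)) with hL
  have hpS : p ∈ closure Q ∩ U := ⟨hp.1, hpU⟩
  obtain ⟨ρ, hρ, hball⟩ := Metric.isOpen_iff.1 hG.isOpen_dom _ (hG.coord_mem p hpS)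
  have hnhd : U ∩ L ⁻¹' Metric.ball (L p) ρ ∈ 𝓝 p :=
    (hG.isOpen_nhd.inter (Metric.isOpen_ball.preimage L.continuous)).mem_nhds
      ⟨hpU, Metric.mem_ball_self hρ⟩
  filter_upwards [self_mem_nhdsWithin, mem_nhdsWithin_of_mem_nhds hnhd] with z hz hzU
  have hzS : z ∈ closure Q ∩ U := ⟨hz.1, hzU.1⟩
  set w := L z - L p with hw
  set c : ℝ → EuclideanSpace ℝ (Fin m) := fun s => L p + s • w with hc
  have hcΩ : ∀ s ∈ Icc (0 : ℝ) 1, c s ∈ Ω := by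
    intro s hs'
    refine hball ?_
    have h1 := hzU.2
    rw [mem_preimage, Metric.mem_ball, dist_eq_norm, ← hw] at h1
    rw [Metric.mem_ball, dist_eq_norm, hc, add_sub_cancel_left, norm_smul, Real.norm_eq_abs,
      abs_of_nonneg hs'.1]
    exact (mul_le_of_le_one_left (norm_nonneg _) hs'.2).trans_lt h1
  have hcd : ∀ s, HasDerivAt c w s := by
    intro s
    have := ((hasDerivAt_id s).smul_const w).const_add (L p)
    rw [one_smul] at this
    exact this
  have hsub := hs.isSublinear_supp ht'.le hx (hQ.norm_eq_one hx).le
  have hmain := hsub.eq_of_curve (γ := fun s => G (c s)) (γ' := fun s => fderiv ℝ G (c s) w)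
    zero_le_one
    (fun s hs' => ((hG.hasFDerivAt (hcΩ s hs')).comp_hasDerivAt s (hcd s)).hasDerivWithinAt)
    (fun s hs' ε hε => ?_)
  · have e0 : G (c 0) = p := by simp only [hc, zero_smul, add_zero]; exact hG.apply_coord p hpS
    have e1 : G (c 1) = z := by
      simp only [hc, one_smul, hw, add_sub_cancel]; exact hG.apply_coord z hzS
    rwa [e0, e1] at hmain
  -- approximate by a state `q`, at which null operators span the tangent space
  have hyU := hG.mem _ (hcΩ s hs')
  have hev : ∀ᶠ q in 𝓝[closure Q ∩ U] (G (c s)),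
      ‖q - G (c s)‖ < ε ∧ ‖fderiv ℝ G (L q) w - fderiv ℝ G (c s) w‖ < ε := by
    have h1 : Tendsto (fun q => fderiv ℝ G (L q) w) (𝓝[closure Q ∩ U] (G (c s)))
        (𝓝 (fderiv ℝ G (c s) w)) := by
      have h2 := (hG.continuousOn_coordField.clm_apply (continuousOn_const (c := w))) _ hyU
      rwa [ContinuousWithinAt, hG.coord_apply _ (hcΩ s hs')] at h2
    simp only [← dist_eq_norm]
    exact ((tendsto_nhdsWithin_of_tendsto_nhds tendsto_id).eventually
      (Metric.ball_mem_nhds _ hε)).and (h1.eventually (Metric.ball_mem_nhds _ hε))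
  have hcl : G (c s) ∈ closure (Q ∩ U) := by
    rw [inter_comm]; exact hG.isOpen_nhd.inter_closure ⟨hyU.2, hyU.1⟩
  have hne : (𝓝[Q ∩ U] (G (c s))).NeBot := mem_closure_iff_nhdsWithin_neBot.1 hcl
  have hev' : ∀ᶠ q in 𝓝[Q ∩ U] (G (c s)),
      ‖q - G (c s)‖ < ε ∧ ‖fderiv ℝ G (L q) w - fderiv ℝ G (c s) w‖ < ε :=
    hev.filter_mono (nhdsWithin_mono _ (inter_subset_inter_left _ subset_closure))
  obtain ⟨q, ⟨h1, h2⟩, hq⟩ := (hev'.and self_mem_nhdsWithin).exists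
  lift q to D using hQ.subset hq.1
  obtain ⟨p', hp'⟩ := hs.exists_isOpt ht'.le hx (subset_closure hq.1)
  refine ⟨q, fderiv ℝ G (L q) w, h1, h2, p', hp', ?_⟩
  obtain ⟨W, hW, hWA⟩ := hfull q hq.1
  have htan : ∀ z ∈ W, fderiv ℝ G (L q) (L (z : E)) = z := by
    intro z hz
    obtain ⟨A, hA, -, rfl⟩ := hWA z hz
    exact hA.tangent q hq.1 _ Ω G U hG hq.2
  obtain ⟨z', hz', hzw⟩ := exists_coordMap_eq_of_rank hW htan w
  obtain ⟨A, hA, hAn, hAz⟩ := hWA z' hz'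
  rw [← hzw, htan z' hz', ← hAz, ← weakExt_coe hQ.dense hA.skew]
  exact hs.inner_weakExt_eq_zero h0 hA hAn ht' hx (hQ.subset_chartSet hq.1) hp'

/-- If null operators span the tangent spaces at a good time, then the set of states
reachable at that time is dense. -/
lemma exists_evo_norm_sub_lt_of_goodTimes (hs : IsControlSystem m Q H) (h0 : IsDenseStates Q₀ Q)
    (hconn : IsPreconnected (chartSet m (closure Q))) (hfull : HasFullNull m Q₀ Q H t)
    {t' : ℚ} (ht' : (t' : ℝ) < t) {x z : E} (hx : x ∈ Q) (hz : z ∈ Q) {ε : ℝ} (hε : 0 < ε) :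
    ∃ T, Evo Q H t' t T ∧ ‖T x - z‖ < ε := by
  have hQ := hs.isStateSet
  obtain ⟨T₀, hT₀⟩ := hs.exists_evo ht'.le
  have hxS : x ∈ closure Q := subset_closure hx
  have heq : supp Q H t' x t (T₀ x) = supp Q H t' x t z :=
    hconn.induction₂ (fun y z => supp Q H t' x t y = supp Q H t' x t z)
      (fun p hp => hs.supp_eventually_eq h0 hfull ht' hxS hp) (fun _ _ _ _ _ _ h h' => h.trans h')
      (fun _ _ _ _ h => h.symm) (hQ.subset_chartSet (hT₀.mapsTo hs hx)) (hQ.subset_chartSet hz)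
  have h1 := hs.one_le_supp hT₀ hxS
  rw [heq] at h1
  obtain ⟨T, hT, hlt⟩ := hs.exists_lt_inner ht'.le
    (show 1 - ε ^ 2 / 2 < supp Q H t' x t z by nlinarith [sq_pos_of_pos hε])
  have h2 := norm_sub_sq_lt_of_lt_inner (hQ.norm_eq z hz) (hQ.norm_eq _ (hT.mapsTo hs hx)) hlt
  exact ⟨T, hT, lt_of_pow_lt_pow_left₀ 2 hε.le (by linarith)⟩

/-- If null operators span the tangent spaces at all good times, then the set of states
reachable at any time is dense. -/
theorem exists_evo_norm_sub_lt (hs : IsControlSystem m Q H) (h0 : IsDenseStates Q₀ Q)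
    (hQ₀c : Q₀.Countable) (hconn : IsPreconnected (chartSet m (closure Q)))
    (hfull : ∀ t ∈ goodTimes Q₀ Q H, HasFullNull m Q₀ Q H t) {t₀ t₁ : ℝ} (h01 : t₀ < t₁) {x z : E}
    (hx : x ∈ Q) (hz : z ∈ Q) {ε : ℝ} (hε : 0 < ε) : ∃ T, Evo Q H t₀ t₁ T ∧ ‖T x - z‖ < ε := by
  have hQ := hs.isStateSet
  lift z to D using hQ.subset hz
  obtain ⟨C, hC0, hC⟩ := hs.exists_bound 0 z t₀ t₁
  obtain ⟨t', ht0, ht1⟩ := exists_rat_btwn h01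
  have hmax : max (t' : ℝ) (t₁ - ε / (2 * (C + 1))) < t₁ :=
    max_lt ht1 (by have : 0 < ε / (2 * (C + 1)) := by positivity
                   linarith)
  obtain ⟨t, htg, htl, htr⟩ := (hs.dense_goodTimes hQ₀c h0.subset).exists_between hmax
  obtain ⟨h2, h3⟩ := max_lt_iff.1 htl
  obtain ⟨T₁, hT₁⟩ := hs.exists_evo ht0.le
  obtain ⟨T₂, hT₂, hlt⟩ := hs.exists_evo_norm_sub_lt_of_goodTimes h0 hconn (hfull t htg) h2
    (hT₁.mapsTo hs hx) hz (half_pos hε)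
  obtain ⟨Φ, hΦ⟩ := hs.exists_isPropagator 0 htr.le
  refine ⟨Φ.comp (T₂.comp T₁), (hT₁.trans hT₂).step hΦ, ?_⟩
  have h4 := hs.norm_propagator_sub_le hΦ hz hC0 fun s hs' => by
    simpa [generator] using hC s ⟨by linarith [hs'.1], hs'.2.le⟩
  have h5 : C * (t₁ - t) < ε / 2 := by
    have h6 : t₁ - t < ε / (2 * (C + 1)) := by linarith
    rw [lt_div_iff₀ (by positivity)] at h6
    nlinarith
  have h6 : Φ.comp (T₂.comp T₁) x - z = Φ (T₂ (T₁ x) - z) + (Φ z - z) := by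
    rw [map_sub]; simp
  rw [h6]
  have h7 := hΦ.norm_le (T₂ (T₁ x) - z)
  exact (norm_add_le _ _).trans_lt (by linarith)

end IsControlSystem
end Density

section Switching

variable {E : Type*} [NormedAddCommGroup E] [InnerProductSpace ℝ E] {m r : ℕ}
  {D : Submodule ℝ E} {Q : Set E} {H : Fin (r + 1) → ℝ → Module.End ℝ D} {t : ℝ}

/-! ### Differentiation with respect to a switching time -/

/-- The derivative of a map with values in a closed subspace has values in that subspace. -/
lemma apply_mem_of_hasFDerivAt {P : Type*} [NormedAddCommGroup P] [NormedSpace ℝ P]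
    {K : Submodule ℝ E} (hK : IsClosed (K : Set E)) {F : P → E} {F' : P →L[ℝ] E} {p : P}
    (hF : HasFDerivAt F F' p) (h : ∀ᶠ p' in 𝓝 p, F p' ∈ K) (v : P) : F' v ∈ K := by
  have h1 : HasDerivAt (fun s : ℝ => p + s • v) v 0 := by
    simpa using ((hasDerivAt_id (0 : ℝ)).smul_const v).const_add p
  have h0 : p + (0 : ℝ) • v = p := by simp
  have h2 : HasDerivAt (fun s : ℝ => F (p + s • v)) (F' v) 0 :=
    HasFDerivAt.comp_hasDerivAt (0 : ℝ) (by rw [h0]; exact hF) h1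
  have h3 : ∀ᶠ s in 𝓝 (0 : ℝ), F (p + s • v) ∈ K :=
    h1.continuousAt.eventually (p := fun x => F x ∈ K) (by beta_reduce; rw [h0]; exact h)
  refine hK.mem_of_tendsto (hasDerivAt_iff_tendsto_slope_zero.1 h2)
    ((h3.filter_mono nhdsWithin_le_nhds).mono fun s hs => ?_)
  have h4 : F p ∈ K := h.self_of_nhds
  simp only [zero_add, zero_smul, add_zero]
  exact K.smul_mem _ (K.sub_mem hs h4)

lemma IsTangent.apply_mem_stateSpan (hQ : IsStateSet m D Q) {A : Module.End ℝ D}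
    (hA : IsTangent m Q A) {q : D} (hq : (q : E) ∈ Q) : (A q : E) ∈ stateSpan Q := by
  obtain ⟨v, Ω, G, U, hG, hqU⟩ := hQ.exists_chart (hQ.subset_chartSet hq)
  have hξ := hG.coord_mem q ⟨subset_closure hq, hqU⟩
  rw [← hA.tangent q hq _ Ω G U hG hqU]
  refine apply_mem_of_hasFDerivAt (isClosed_stateSpan Q) (hG.hasFDerivAt hξ) ?_ _
  filter_upwards [hG.isOpen_dom.mem_nhds hξ] with η hη
    using closure_subset_stateSpan Q (hG.mem η hη).1

lemma eq_of_mem_stateSpan {T T' : E →L[ℝ] E} (h : ∀ x ∈ Q, T x = T' x) {x : E}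
    (hx : x ∈ stateSpan Q) : T x = T' x := by
  have h1 : EqOn T T' (Submodule.span ℝ Q : Set E) :=
    LinearMap.eqOn_span (f := T.toLinearMap) (g := T'.toLinearMap) h
  exact h1.closure T.continuous T'.continuous hx

namespace IsPropagator

variable {a : Fin r → ℝ} {t₁ t₂ t₃ : ℝ} {Φ Φ₁₂ Φ₂₃ Φ₁₃ : E →L[ℝ] E}

lemma comp_apply (hs : IsControlSystem m Q H) (h12 : IsPropagator Q H a t₁ t₂ Φ₁₂)
    (h23 : IsPropagator Q H a t₂ t₃ Φ₂₃) (h13 : IsPropagator Q H a t₁ t₃ Φ₁₃) {x : E}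
    (hx : x ∈ stateSpan Q) : Φ₂₃ (Φ₁₂ x) = Φ₁₃ x := by
  refine eq_of_mem_stateSpan (T := Φ₂₃.comp Φ₁₂) (T' := Φ₁₃) (fun x hx => ?_) hx
  obtain ⟨y, hy, hsol⟩ := hs.exists_solution a t₁ ⟨x, hs.isStateSet.subset hx⟩ hx
  have h1 := h12.apply y hsol
  have h2 := h23.apply y (hsol.mono h12.le)
  have h3 := h13.apply y hsol
  rw [hy] at h1 h3
  rw [ContinuousLinearMap.comp_apply, h1, h2, h3]

lemma apply_self (hs : IsControlSystem m Q H) (h : IsPropagator Q H a t t Φ) {x : E}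
    (hx : x ∈ stateSpan Q) : Φ x = x := by
  refine eq_of_mem_stateSpan (T' := ContinuousLinearMap.id ℝ E) (fun x hx => ?_) hx
  obtain ⟨y, hy, hsol⟩ := hs.exists_solution a t ⟨x, hs.isStateSet.subset hx⟩ hx
  have h1 := h.apply y hsol
  rw [hy] at h1
  exact h1

end IsPropagator

variable [CompleteSpace E]

namespace IsControlSystem

lemma exists_forall_isPropagator (hs : IsControlSystem m Q H) (a : Fin r → ℝ) :
    ∃ Φ : ℝ → ℝ → E →L[ℝ] E, ∀ s t, s ≤ t → IsPropagator Q H a s t (Φ s t) := by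
  have hex : ∀ s t : ℝ, ∃ Φ, s ≤ t → IsPropagator Q H a s t Φ := by
    intro s t
    by_cases h : s ≤ t
    · obtain ⟨Φ, hΦ⟩ := hs.exists_isPropagator a h
      exact ⟨Φ, fun _ => hΦ⟩
    · exact ⟨0, fun h' => (h h').elim⟩
  choose Φ hΦ using hex
  exact ⟨Φ, hΦ⟩

lemma continuousOn_propagator_right (hs : IsControlSystem m Q H) {a : Fin r → ℝ}
    {Φ : ℝ → ℝ → E →L[ℝ] E} (hΦ : ∀ s t, s ≤ t → IsPropagator Q H a s t (Φ s t)) (t : ℝ) {x : E}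
    (hx : x ∈ stateSpan Q) : ContinuousOn (fun s => Φ t s x) (Ici t) := by
  intro s hts
  refine tendsto_of_mem_stateSpan ?_ (fun x hx => ?_) hx
  · filter_upwards [self_mem_nhdsWithin] with u hu using (hΦ t u hu).norm_le
  · obtain ⟨y, hy, hsol⟩ := hs.exists_solution a t ⟨x, hs.isStateSet.subset hx⟩ hx
    have h1 : ∀ u ∈ Ici t, Φ t u x = y u := by
      intro u hu
      have := (hΦ t u hu).apply y hsol
      rw [hy] at this
      exact this
    exact (hsol.continuousOn s hts).congr h1 (h1 s hts)

lemma continuousOn_propagator_left (hs : IsControlSystem m Q H) {a : Fin r → ℝ}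
    {Φ : ℝ → ℝ → E →L[ℝ] E} (hΦ : ∀ s t, s ≤ t → IsPropagator Q H a s t (Φ s t)) (t : ℝ) {x : E}
    (hx : x ∈ stateSpan Q) : ContinuousOn (fun s => Φ s t x) (Iic t) := by
  intro s hst
  refine tendsto_of_mem_stateSpan ?_ (fun x hx => ?_) hx
  · filter_upwards [self_mem_nhdsWithin] with u hu using (hΦ u t hu).norm_le
  lift x to D using hs.isStateSet.subset hx
  obtain ⟨C, hC⟩ := (isCompact_Icc (a := s - 1) (b := t)).exists_bound_of_continuousOn
    (hs.continuous_generator a x).continuousOn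
  have hC0 : 0 ≤ C := (norm_nonneg _).trans (hC s ⟨by linarith, hst⟩)
  have hxS := subset_stateSpan Q hx
  have key : ∀ u v, s - 1 ≤ u → u ≤ v → v ≤ t → ‖Φ u t x - Φ v t x‖ ≤ C * (v - u) := by
    intro u v hu huv hvt
    rw [← (hΦ u v huv).comp_apply hs (hΦ v t hvt) (hΦ u t (huv.trans hvt)) hxS, ← map_sub]
    refine ((hΦ v t hvt).norm_le _).trans ?_
    exact hs.norm_propagator_sub_le (hΦ u v huv) hx hC0 fun w hw =>
      hC w ⟨hu.trans hw.1.le, hw.2.le.trans hvt⟩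
  rw [tendsto_iff_norm_sub_tendsto_zero]
  have h2 : Tendsto (fun u : ℝ => C * |u - s|) (𝓝[Iic t] s) (𝓝 0) := by
    have : Tendsto (fun u : ℝ => C * |u - s|) (𝓝 s) (𝓝 (C * |s - s|)) :=
      (by fun_prop : Continuous fun u : ℝ => C * |u - s|).tendsto s
    rw [sub_self, abs_zero, mul_zero] at this
    exact this.mono_left nhdsWithin_le_nhds
  refine squeeze_zero' (Eventually.of_forall fun _ => norm_nonneg _) ?_ h2
  filter_upwards [self_mem_nhdsWithin,
    mem_nhdsWithin_of_mem_nhds (Ioi_mem_nhds (show s - 1 < s by linarith))] with u hu hu'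
  rcases le_total u s with h | h
  · rw [abs_sub_comm, abs_of_nonneg (sub_nonneg.2 h)]
    exact key u s (le_of_lt hu') h hst
  · rw [abs_of_nonneg (sub_nonneg.2 h), norm_sub_rev]
    exact key s u (by linarith) h hu

/-- A first-order expansion, uniform near a given initial state, of the effect of changing the
time at which the control switches from `a` to `b`. -/
lemma exists_norm_switch_sub_le (hs : IsControlSystem m Q H) {a b : Fin r → ℝ}
    {Φ Ψ : ℝ → ℝ → E →L[ℝ] E} (hΦ : ∀ s t, s ≤ t → IsPropagator Q H a s t (Φ s t))
    (hΨ : ∀ s t, s ≤ t → IsPropagator Q H b s t (Ψ s t)) {t₁ t₂ : ℝ} (h1 : t < t₁) (h2 : t₁ < t₂)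
    {y y₁ : D} (hy : (y : E) ∈ Q) (hy₁ : (y₁ : E) = Φ t t₁ y) {ε : ℝ} (hε : 0 < ε) :
    ∃ δ > 0, ∀ q ∈ Q, ‖q - y‖ < δ → ∀ η θ : ℝ, |η| < δ → |θ| < δ →
      ‖Ψ (t₁ + θ) t₂ (Φ t (t₁ + θ) q) - Ψ (t₁ + η) t₂ (Φ t (t₁ + η) q)
        - (θ - η) • Ψ t₁ t₂ ((generator H a t₁ y₁ : E) - generator H b t₁ y₁)‖ ≤ ε * |θ - η| := by
  have hQ := hs.isStateSet
  have hy₁Q : (y₁ : E) ∈ Q := by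
    rw [hy₁]; exact (Evo.of_isPropagator (hΦ t t₁ h1.le)).mapsTo hs hy
  set wa := (generator H a t₁ y₁ : E) with hwa
  set wb := (generator H b t₁ y₁ : E) with hwb
  have hw : wa - wb ∈ stateSpan Q :=
    (stateSpan Q).sub_mem ((hs.isTangent_generator a t₁).apply_mem_stateSpan hQ hy₁Q)
      ((hs.isTangent_generator b t₁).apply_mem_stateSpan hQ hy₁Q)
  have hε3 : 0 < ε / 3 := by positivity
  obtain ⟨δ₁, hδ₁, hexa⟩ := hs.exists_norm_propagator_sub_le a t₁ (hQ.subset_chartSet hy₁Q) hε3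
  obtain ⟨δ₂, hδ₂, hexb⟩ := hs.exists_norm_propagator_sub_le b t₁ (hQ.subset_chartSet hy₁Q) hε3
  rw [weakExt_coe hQ.dense (isSkew_generator hs.skew a t₁), ← hwa] at hexa
  rw [weakExt_coe hQ.dense (isSkew_generator hs.skew b t₁), ← hwb] at hexb
  obtain ⟨δ₃, hδ₃, hleft⟩ := Metric.continuousOn_iff.1 (hs.continuousOn_propagator_left hΨ t₂ hw)
    t₁ h2.le (ε / 3) hε3
  obtain ⟨δ₄, hδ₄, hright⟩ := Metric.continuousOn_iff.1
    (hs.continuousOn_propagator_right hΦ t (subset_stateSpan Q hy)) t₁ h1.le (min δ₁ δ₂ / 2)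
    (by positivity)
  obtain ⟨δ, hδ0, hδ⟩ := exists_between (show (0 : ℝ) < min (min (t₁ - t) (t₂ - t₁))
    (min (min (δ₁ / 2) (δ₂ / 2)) (min δ₃ δ₄)) by
      have := sub_pos.2 h1
      have := sub_pos.2 h2
      positivity)
  simp only [lt_min_iff] at hδ
  obtain ⟨⟨hd1, hd2⟩, ⟨hd3, hd4⟩, hd5, hd6⟩ := hδ
  have key : ∀ q ∈ Q, ‖q - y‖ < δ → ∀ η θ : ℝ, |η| < δ → |θ| < δ → η ≤ θ →
      ‖Ψ (t₁ + θ) t₂ (Φ t (t₁ + θ) q) - Ψ (t₁ + η) t₂ (Φ t (t₁ + η) q)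
        - (θ - η) • Ψ t₁ t₂ (wa - wb)‖ ≤ ε * (θ - η) := by
    intro q hq hqy η θ hη hθ hηθ
    have hη' := abs_lt.1 hη
    have hθ' := abs_lt.1 hθ
    have hle1 : t ≤ t₁ + η := by linarith
    have hle2 : t₁ + η ≤ t₁ + θ := by linarith
    have hle3 : t₁ + θ ≤ t₂ := by linarith
    have hqS := subset_stateSpan Q hq
    set z := Φ t (t₁ + η) q with hz
    have hzQ : z ∈ Q := (Evo.of_isPropagator (hΦ t _ hle1)).mapsTo hs hq
    have hzS := subset_stateSpan Q hzQ
    have hzy : ‖z - y₁‖ < min δ₁ δ₂ := by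
      have h3 := hright (t₁ + η) hle1 (by rw [Real.dist_eq, add_sub_cancel_left]; linarith)
      rw [dist_eq_norm, ← hy₁] at h3
      have h4 := (hΦ t _ hle1).norm_le (q - y)
      rw [map_sub] at h4
      have h5 : z - y₁ = (z - Φ t (t₁ + η) y) + (Φ t (t₁ + η) y - y₁) := by abel
      have h6 : δ < min δ₁ δ₂ / 2 := by
        rw [← min_div_div_right (by norm_num : (0 : ℝ) ≤ 2)]; exact lt_min hd3 hd4
      rw [h5]
      exact (norm_add_le _ _).trans_lt (by linarith)
    have hend : t₁ + η + (θ - η) = t₁ + θ := by ring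
    have hτ : |t₁ + η - t₁| < δ := by rwa [add_sub_cancel_left]
    have ha := hexa (t₁ + η) (θ - η) (by linarith) (by linarith) (by linarith) (Φ (t₁ + η) (t₁ + θ))
      (by rw [hend]; exact hΦ _ _ hle2) z (subset_closure hzQ) (hzy.trans_le (min_le_left _ _))
    have hb := hexb (t₁ + η) (θ - η) (by linarith) (by linarith) (by linarith) (Ψ (t₁ + η) (t₁ + θ))
      (by rw [hend]; exact hΨ _ _ hle2) z (subset_closure hzQ) (hzy.trans_le (min_le_right _ _))
    have hc := hleft (t₁ + θ) hle3 (by rw [Real.dist_eq, add_sub_cancel_left]; linarith)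
    rw [dist_eq_norm] at hc
    rw [← (hΦ _ _ hle1).comp_apply hs (hΦ _ _ hle2) (hΦ _ _ (hle1.trans hle2)) hqS, ← hz,
      ← (hΨ _ _ hle2).comp_apply hs (hΨ _ _ hle3) (hΨ _ _ (hle2.trans hle3)) hzS]
    set za := Φ (t₁ + η) (t₁ + θ) z
    set zb := Ψ (t₁ + η) (t₁ + θ) z
    set R := Ψ (t₁ + θ) t₂
    have hsplit : R za - R zb - (θ - η) • Ψ t₁ t₂ (wa - wb)
        = R ((za - z - (θ - η) • wa) - (zb - z - (θ - η) • wb))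
          + (θ - η) • (R (wa - wb) - Ψ t₁ t₂ (wa - wb)) := by
      have h3 : (za - z - (θ - η) • wa) - (zb - z - (θ - η) • wb)
          = za - zb - (θ - η) • (wa - wb) := by module
      rw [h3]
      simp only [map_sub, map_smul]
      module
    rw [hsplit]
    have h3 := (hΨ _ _ hle3).norm_le ((za - z - (θ - η) • wa) - (zb - z - (θ - η) • wb))
    have h4 := _root_.norm_sub_le (za - z - (θ - η) • wa) (zb - z - (θ - η) • wb)
    have h5 : ‖(θ - η) • (R (wa - wb) - Ψ t₁ t₂ (wa - wb))‖ ≤ (θ - η) * (ε / 3) := by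
      rw [norm_smul, Real.norm_eq_abs, abs_of_nonneg (sub_nonneg.2 hηθ)]
      exact mul_le_mul_of_nonneg_left hc.le (sub_nonneg.2 hηθ)
    refine (norm_add_le _ _).trans ?_
    linarith
  refine ⟨δ, hδ0, fun q hq hqy η θ hη hθ => ?_⟩
  rcases le_total η θ with h | h
  · rw [abs_of_nonneg (sub_nonneg.2 h)]
    exact key q hq hqy η θ hη hθ h
  · have h3 := key q hq hqy θ η hθ hη h
    rw [abs_sub_comm, abs_of_nonneg (sub_nonneg.2 h), ← norm_neg]
    refine le_of_eq_of_le (congrArg norm ?_) h3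
    module

end IsControlSystem

end Switching

section Access

variable {E : Type*} [NormedAddCommGroup E] [InnerProductSpace ℝ E] {m r : ℕ}
  {D : Submodule ℝ E} {Q : Set E} {H : Fin (r + 1) → ℝ → Module.End ℝ D} {t₀ t t' : ℝ}
  {x y : E} {V : Submodule ℝ E}

/-! ### Families of reachable states -/

/-- Strict differentiability of `(p, θ) ↦ Ψ θ (F p)` for a strongly continuous family of
contractions `Ψ` such that `θ ↦ Ψ θ (F p)` has a derivative, uniformly in `p`. -/
lemma hasStrictFDerivAt_comp_family {P : Type*} [NormedAddCommGroup P] [NormedSpace ℝ P]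
    [FiniteDimensional ℝ P] {F : P → E} {F' : P →L[ℝ] E} {p₀ : P} (hF : HasStrictFDerivAt F F' p₀)
    {Ψ : ℝ → E →L[ℝ] E} (hΨ : ∀ᶠ θ in 𝓝 0, ∀ x, ‖Ψ θ x‖ ≤ ‖x‖)
    (hc : ∀ v, ContinuousAt (fun θ => Ψ θ (F' v)) 0) {w : E}
    (hw : ∀ ε > 0, ∃ δ > 0, ∀ᶠ p in 𝓝 p₀, ∀ η θ : ℝ, |η| < δ → |θ| < δ →
      ‖Ψ θ (F p) - Ψ η (F p) - (θ - η) • w‖ ≤ ε * |θ - η|) :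
    HasStrictFDerivAt (fun z : P × ℝ => Ψ z.2 (F z.1))
      (((Ψ 0).comp F').coprod (ContinuousLinearMap.toSpanSingleton ℝ w)) (p₀, 0) := by
  refine .of_isLittleO (Asymptotics.isLittleO_iff.2 fun c hc0 => ?_)
  have hc3 : 0 < c / 3 := by positivity
  obtain ⟨δ, hδ, hδ'⟩ := hw (c / 3) hc3
  have hA := Asymptotics.isLittleO_iff.1 hF.isLittleO hc3
  have hB : ∀ᶠ θ in 𝓝 (0 : ℝ), ‖(Ψ θ).comp F' - (Ψ 0).comp F'‖ < c / 3 := by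
    have h1 : ContinuousAt (fun θ => (Ψ θ).comp F') 0 := continuousAt_clm_apply.2 hc
    simpa only [dist_eq_norm] using h1.eventually (Metric.ball_mem_nhds _ hc3)
  have hD : ∀ᶠ θ in 𝓝 (0 : ℝ), |θ| < δ := by
    filter_upwards [Metric.ball_mem_nhds (0 : ℝ) hδ] with θ hθ
    simpa [Real.dist_eq] using hθ
  have t11 : Tendsto (fun z : (P × ℝ) × (P × ℝ) => (z.1.1, z.2.1)) (𝓝 ((p₀, 0), (p₀, 0)))
      (𝓝 (p₀, p₀)) :=
    (by fun_prop : Continuous fun z : (P × ℝ) × (P × ℝ) => (z.1.1, z.2.1)).tendsto _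
  have t12 : Tendsto (fun z : (P × ℝ) × (P × ℝ) => z.1.2) (𝓝 ((p₀, 0), (p₀, 0))) (𝓝 0) :=
    (by fun_prop : Continuous fun z : (P × ℝ) × (P × ℝ) => z.1.2).tendsto _
  have t21 : Tendsto (fun z : (P × ℝ) × (P × ℝ) => z.2.1) (𝓝 ((p₀, 0), (p₀, 0))) (𝓝 p₀) :=
    (by fun_prop : Continuous fun z : (P × ℝ) × (P × ℝ) => z.2.1).tendsto _
  have t22 : Tendsto (fun z : (P × ℝ) × (P × ℝ) => z.2.2) (𝓝 ((p₀, 0), (p₀, 0))) (𝓝 0) :=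
    (by fun_prop : Continuous fun z : (P × ℝ) × (P × ℝ) => z.2.2).tendsto _
  filter_upwards [t11.eventually hA, t12.eventually hB, t12.eventually hΨ, t12.eventually hD,
    t22.eventually hD, t21.eventually hδ'] with z h1 h2 h3 h4 h5 h6
  obtain ⟨⟨p, θ⟩, q, η⟩ := z
  have hsplit : Ψ θ (F p) - Ψ η (F q)
      - (((Ψ 0).comp F').coprod (ContinuousLinearMap.toSpanSingleton ℝ w)) ((p, θ) - (q, η))
      = Ψ θ (F p - F q - F' (p - q)) + ((Ψ θ).comp F' - (Ψ 0).comp F') (p - q)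
        + (Ψ θ (F q) - Ψ η (F q) - (θ - η) • w) := by
    simp only [Prod.mk_sub_mk, ContinuousLinearMap.coprod_apply, ContinuousLinearMap.comp_apply,
      ContinuousLinearMap.toSpanSingleton_apply, sub_apply, map_sub]
    module
  have hp : ‖p - q‖ ≤ ‖(p, θ) - (q, η)‖ := norm_fst_le ((p, θ) - (q, η))
  have hθ : |θ - η| ≤ ‖(p, θ) - (q, η)‖ := norm_snd_le ((p, θ) - (q, η))
  have e1 : ‖Ψ θ (F p - F q - F' (p - q))‖ ≤ c / 3 * ‖(p, θ) - (q, η)‖ :=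
    (h3 _).trans (h1.trans (mul_le_mul_of_nonneg_left hp hc3.le))
  have e2 : ‖((Ψ θ).comp F' - (Ψ 0).comp F') (p - q)‖ ≤ c / 3 * ‖(p, θ) - (q, η)‖ :=
    (ContinuousLinearMap.le_opNorm _ _).trans (mul_le_mul h2.le hp (norm_nonneg _) hc3.le)
  have e3 := (h6 η θ h5 h4).trans (mul_le_mul_of_nonneg_left hθ hc3.le)
  change ‖Ψ θ (F p) - Ψ η (F q)
    - (((Ψ 0).comp F').coprod (ContinuousLinearMap.toSpanSingleton ℝ w)) ((p, θ) - (q, η))‖ ≤ _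
  rw [hsplit]
  refine (norm_add_le _ _).trans ((add_le_add (norm_add_le _ _) le_rfl).trans ?_)
  linarith

/-- There is a finite-dimensional family of states reachable from `x` at time `t`, strictly
differentiable at a parameter where its value is `y`, whose derivative there has range `V`. -/
def IsAccess (Q : Set E) (H : Fin (r + 1) → ℝ → Module.End ℝ D) (t₀ t : ℝ) (x y : E)
    (V : Submodule ℝ E) : Prop :=
  ∃ (P : Type) (_ : NormedAddCommGroup P) (_ : NormedSpace ℝ P) (_ : FiniteDimensional ℝ P)
    (F : P → E) (F' : P →L[ℝ] E) (p₀ : P), HasStrictFDerivAt F F' p₀ ∧ F p₀ = y ∧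
    (∀ᶠ p in 𝓝 p₀, ∃ T, Evo Q H t₀ t T ∧ F p = T x) ∧ LinearMap.range F'.toLinearMap = V

namespace Evo

variable {T : E →L[ℝ] E}

lemma injOn (hs : IsControlSystem m Q H) (hT : Evo Q H t t' T) : InjOn T (stateSpan Q) := by
  intro x hx y hy h
  have h1 := (stateSpan Q).sub_mem hx hy
  have h2 := hT.inner_eq hs h1 h1
  rw [map_sub, h, sub_self, inner_zero_left] at h2
  exact sub_eq_zero.1 (inner_self_eq_zero.1 h2.symm)

lemma finrank_map (hs : IsControlSystem m Q H) (hT : Evo Q H t t' T) (hV : V ≤ stateSpan Q) :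
    Module.finrank ℝ (V.map T.toLinearMap) = Module.finrank ℝ V := by
  rw [← LinearMap.range_domRestrict, LinearMap.finrank_range_of_inj]
  intro a b h
  exact Subtype.ext (hT.injOn hs (hV a.2) (hV b.2) h)

lemma map_le_stateSpan (hs : IsControlSystem m Q H) (hT : Evo Q H t t' T)
    (hV : V ≤ stateSpan Q) : V.map T.toLinearMap ≤ stateSpan Q := by
  rintro _ ⟨v, hv, rfl⟩
  exact hT.mapsTo_stateSpan hs (hV hv)

/-- An evolution over a time interval of positive length ends with a propagator over an interval
of positive length. -/
lemma exists_eqOn_comp (hs : IsControlSystem m Q H) (hT : Evo Q H t t' T) (htt : t < t') :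
    ∃ s T' a Φ, s < t' ∧ Evo Q H t s T' ∧ IsPropagator Q H a s t' Φ ∧
      EqOn T (Φ.comp T') (stateSpan Q) := by
  induction hT with
  | refl => exact (lt_irrefl _ htt).elim
  | @step s u T Φ a hT hΦ ih =>
    rcases hΦ.le.lt_or_eq with h | rfl
    · exact ⟨s, T, a, Φ, h, hT, hΦ, fun _ _ => rfl⟩
    · obtain ⟨s', T', a', Φ', h1, h2, h3, h4⟩ := ih htt
      refine ⟨s', T', a', Φ', h1, h2, h3, fun x hx => ?_⟩
      rw [ContinuousLinearMap.comp_apply, hΦ.apply_self hs (hT.mapsTo_stateSpan hs hx), h4 hx]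

end Evo

namespace IsAccess

lemma refl (Q : Set E) (H : Fin (r + 1) → ℝ → Module.End ℝ D) (t₀ : ℝ) (x : E) :
    IsAccess Q H t₀ t₀ x x ⊥ := by
  refine ⟨ℝ, inferInstance, inferInstance, inferInstance, fun _ => x, 0, 0,
    hasStrictFDerivAt_const _ _, rfl, Eventually.of_forall fun _ => ⟨_, .refl, rfl⟩, ?_⟩
  exact LinearMap.range_zero

lemma evo (h : IsAccess Q H t₀ t x y V) {T : E →L[ℝ] E} (hT : Evo Q H t t' T) :
    IsAccess Q H t₀ t' x (T y) (V.map T.toLinearMap) := by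
  obtain ⟨P, _, _, _, F, F', p₀, hF, hy, hev, rfl⟩ := h
  refine ⟨P, inferInstance, inferInstance, inferInstance, fun p => T (F p), T.comp F', p₀,
    T.hasStrictFDerivAt.comp p₀ hF, congrArg T hy, ?_, ?_⟩
  · filter_upwards [hev] with p ⟨S, hS, hp⟩
    exact ⟨_, hS.trans hT, by rw [hp, ContinuousLinearMap.comp_apply]⟩
  · exact LinearMap.range_comp F'.toLinearMap T.toLinearMap

lemma mem (hs : IsControlSystem m Q H) (h : IsAccess Q H t₀ t x y V) (hx : x ∈ Q) : y ∈ Q := by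
  obtain ⟨P, _, _, _, F, F', p₀, hF, hy, hev, rfl⟩ := h
  obtain ⟨T, hT, hp⟩ := hev.self_of_nhds
  rw [← hy, hp]
  exact hT.mapsTo hs hx

lemma finite (h : IsAccess Q H t₀ t x y V) : Module.Finite ℝ V := by
  obtain ⟨P, _, _, _, F, F', p₀, hF, hy, hev, rfl⟩ := h
  infer_instance

lemma le_stateSpan (hs : IsControlSystem m Q H) (h : IsAccess Q H t₀ t x y V) (hx : x ∈ Q) :
    V ≤ stateSpan Q := by
  obtain ⟨P, _, _, _, F, F', p₀, hF, hy, hev, rfl⟩ := h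
  rintro _ ⟨v, rfl⟩
  refine apply_mem_of_hasFDerivAt (isClosed_stateSpan Q) hF.hasFDerivAt ?_ v
  filter_upwards [hev] with p ⟨T, hT, hp⟩
  rw [hp]
  exact subset_stateSpan Q (hT.mapsTo hs hx)

/-- The variations of reachable states are tangent to the manifold. -/
lemma fderiv_coordMap (hs : IsControlSystem m Q H) (h : IsAccess Q H t₀ t x y V) (hx : x ∈ Q)
    {v : Fin m → E} {Ω : Set (EuclideanSpace ℝ (Fin m))} {G : EuclideanSpace ℝ (Fin m) → E}
    {U : Set E} (hG : IsGraphChart (closure Q) v Ω G U) (hyU : y ∈ U) {z : E} (hz : z ∈ V) :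
    fderiv ℝ G (coordMap v y) (coordMap v z) = z := by
  obtain ⟨P, _, _, _, F, F', p₀, hF, rfl, hev, rfl⟩ := h
  obtain ⟨e, rfl⟩ := hz
  have h1 : HasDerivAt (fun s : ℝ => p₀ + s • e) e 0 := by
    simpa using ((hasDerivAt_id (0 : ℝ)).smul_const e).const_add p₀
  have h0 : p₀ + (0 : ℝ) • e = p₀ := by simp
  have h2 : HasDerivAt (fun s : ℝ => F (p₀ + s • e)) (F' e) 0 :=
    HasFDerivAt.comp_hasDerivAt (0 : ℝ) (by rw [h0]; exact hF.hasFDerivAt) h1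
  have hQ' : ∀ᶠ p in 𝓝 p₀, F p ∈ closure Q := by
    filter_upwards [hev] with p ⟨T, hT, hp⟩
    rw [hp]
    exact subset_closure (hT.mapsTo hs hx)
  have h3 : ∀ᶠ s in 𝓝 (0 : ℝ), F (p₀ + s • e) ∈ closure Q :=
    h1.continuousAt.eventually (p := fun p => F p ∈ closure Q) (by beta_reduce; rw [h0]; exact hQ')
  have := hG.fderiv_coordMap_of_hasDerivWithinAt (mem_univ (0 : ℝ)) uniqueDiffWithinAt_univ
    h2.hasDerivWithinAt (by rw [nhdsWithin_univ]; exact h3) (by rw [h0]; exact hyU)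
  rwa [h0] at this

lemma finrank_le (hs : IsControlSystem m Q H) (h : IsAccess Q H t₀ t x y V) (hx : x ∈ Q) :
    Module.finrank ℝ V ≤ m := by
  obtain ⟨v, Ω, G, U, hG, hyU⟩ := hs.isStateSet.exists_chart
    (hs.isStateSet.subset_chartSet (h.mem hs hx))
  have hfin := h.finite
  have := LinearMap.finrank_le_finrank_of_injective
    (f := ((coordMap fun j => (v j : E)).toLinearMap).domRestrict V) (fun a b hab => by
      have hab' : coordMap (fun j => (v j : E)) a = coordMap (fun j => (v j : E)) b := hab
      have h1 := h.fderiv_coordMap hs hx hG hyU a.2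
      rw [hab', h.fderiv_coordMap hs hx hG hyU b.2] at h1
      exact Subtype.ext h1.symm)
  simpa using this

/-- If the variations fill the tangent space, then the reachable states fill a neighbourhood. -/
lemma exists_evo_of_finrank (hs : IsControlSystem m Q H) (h : IsAccess Q H t₀ t x y V)
    (hx : x ∈ Q) (hm : m ≤ Module.finrank ℝ V) :
    ∃ δ > 0, ∀ z ∈ closure Q, ‖z - y‖ < δ → ∃ T, Evo Q H t₀ t T ∧ T x = z := by
  obtain ⟨v, Ω, G, U, hG, hyU⟩ := hs.isStateSet.exists_chart
    (hs.isStateSet.subset_chartSet (h.mem hs hx))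
  set L := coordMap (fun j => (v j : E)) with hL
  have htan := fun z hz => h.fderiv_coordMap hs hx hG hyU (z := z) hz
  have hfin := h.finite
  obtain ⟨P, _, _, _, F, F', p₀, hF, rfl, hev, rfl⟩ := h
  have : CompleteSpace P := FiniteDimensional.complete ℝ P
  have hsurj : LinearMap.range (L.comp F').toLinearMap = ⊤ := by
    have hinj : Function.Injective
        (L.toLinearMap.domRestrict (LinearMap.range F'.toLinearMap)) := fun a b hab => by
      have hab' : L a = L b := hab
      have h1 := htan a a.2
      rw [hab', htan b b.2] at h1
      exact Subtype.ext h1.symm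
    have h1 := LinearMap.finrank_range_of_inj hinj
    rw [LinearMap.range_domRestrict, ← LinearMap.range_comp] at h1
    refine Submodule.eq_top_of_finrank_eq (le_antisymm (Submodule.finrank_le _) ?_)
    rw [finrank_euclideanSpace_fin]
    exact hm.trans h1.symm.le
  have hmap : map (L ∘ F) (𝓝 p₀) = 𝓝 (L (F p₀)) :=
    (L.hasStrictFDerivAt.comp p₀ hF).map_nhds_eq_of_surj hsurj
  have hQ' : ∀ᶠ p in 𝓝 p₀, (∃ T, Evo Q H t₀ t T ∧ F p = T x) ∧ F p ∈ U :=
    hev.and (hF.continuousAt.eventually_mem (hG.isOpen_nhd.mem_nhds hyU))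
  have himg : (L ∘ F) '' {p | (∃ T, Evo Q H t₀ t T ∧ F p = T x) ∧ F p ∈ U} ∈ 𝓝 (L (F p₀)) := by
    have := image_mem_map (m := L ∘ F) hQ'
    rw [hmap] at this
    exact this
  have hnhd : U ∩ L ⁻¹' ((L ∘ F) '' {p | (∃ T, Evo Q H t₀ t T ∧ F p = T x) ∧ F p ∈ U})
      ∈ 𝓝 (F p₀) :=
    inter_mem (hG.isOpen_nhd.mem_nhds hyU) (L.continuous.continuousAt.preimage_mem_nhds himg)
  obtain ⟨δ, hδ, hsub⟩ := Metric.mem_nhds_iff.1 hnhd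
  refine ⟨δ, hδ, fun z hz hzy => ?_⟩
  obtain ⟨hzU, p, ⟨⟨T, hT, hp⟩, hpU⟩, hpz⟩ := hsub (by rwa [Metric.mem_ball, dist_eq_norm])
  refine ⟨T, hT, ?_⟩
  have h1 : F p ∈ closure Q := by rw [hp]; exact subset_closure (hT.mapsTo hs hx)
  have h2 : L (F p) = L z := hpz
  rw [← hp, ← hG.apply_coord _ ⟨h1, hpU⟩, ← hL, h2, hL, hG.apply_coord _ ⟨hz, hzU⟩]

variable [CompleteSpace E]

/-- Variation of a switching time adds a direction to the variations of the final state. -/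
lemma switch (hs : IsControlSystem m Q H) (h : IsAccess Q H t₀ t x y V) (hx : x ∈ Q)
    {a b : Fin r → ℝ} {Φ Ψ : ℝ → ℝ → E →L[ℝ] E} (hΦ : ∀ s t, s ≤ t → IsPropagator Q H a s t (Φ s t))
    (hΨ : ∀ s t, s ≤ t → IsPropagator Q H b s t (Ψ s t)) {t₁ t₂ : ℝ} (h1 : t < t₁) (h2 : t₁ < t₂)
    {y₁ : D} (hy₁ : (y₁ : E) = Φ t t₁ y) :
    IsAccess Q H t₀ t₂ x (Ψ t₁ t₂ (Φ t t₁ y)) (V.map ((Ψ t₁ t₂).comp (Φ t t₁)).toLinearMap ⊔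
      Submodule.span ℝ {Ψ t₁ t₂ ((generator H a t₁ y₁ : E) - generator H b t₁ y₁)}) := by
  have hyQ := h.mem hs hx
  have hVs := h.le_stateSpan hs hx
  obtain ⟨P, _, _, _, F, F', p₀, hF, rfl, hev, rfl⟩ := h
  obtain ⟨y, hFy⟩ : ∃ y : D, (y : E) = F p₀ := ⟨⟨_, hs.isStateSet.subset hyQ⟩, rfl⟩
  rw [← hFy] at hyQ hy₁
  set R : ℝ → E →L[ℝ] E := fun θ => (Ψ (t₁ + θ) t₂).comp (Φ t (t₁ + θ)) with hR
  have hθ : ∀ᶠ θ in 𝓝 (0 : ℝ), t ≤ t₁ + θ ∧ t₁ + θ ≤ t₂ := by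
    have h3 : Tendsto (fun θ : ℝ => t₁ + θ) (𝓝 0) (𝓝 t₁) := by
      have : Tendsto (fun θ : ℝ => t₁ + θ) (𝓝 0) (𝓝 (t₁ + 0)) :=
        (by fun_prop : Continuous fun θ : ℝ => t₁ + θ).tendsto 0
      rwa [add_zero] at this
    exact h3.eventually (inter_mem (Ici_mem_nhds h1) (Iic_mem_nhds h2))
  have hRc : ∀ᶠ θ in 𝓝 (0 : ℝ), ∀ x, ‖R θ x‖ ≤ ‖x‖ := by
    filter_upwards [hθ] with θ hθ x
    exact ((hΨ _ _ hθ.2).norm_le _).trans ((hΦ _ _ hθ.1).norm_le x)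
  have hw : ∀ ε > 0, ∃ δ > 0, ∀ᶠ p in 𝓝 p₀, ∀ η θ : ℝ, |η| < δ → |θ| < δ →
      ‖R θ (F p) - R η (F p) - (θ - η) • Ψ t₁ t₂ ((generator H a t₁ y₁ : E)
        - generator H b t₁ y₁)‖ ≤ ε * |θ - η| := by
    intro ε hε
    obtain ⟨δ, hδ, hδ'⟩ := hs.exists_norm_switch_sub_le hΦ hΨ h1 h2 hyQ hy₁ hε
    refine ⟨δ, hδ, ?_⟩
    have h3 : ∀ᶠ p in 𝓝 p₀, ‖F p - y‖ < δ := by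
      rw [hFy]
      simpa only [dist_eq_norm] using hF.continuousAt.eventually (Metric.ball_mem_nhds _ hδ)
    filter_upwards [h3, hev] with p hp ⟨T, hT, hpT⟩
    exact hδ' (F p) (by rw [hpT]; exact hT.mapsTo hs hx) hp
  have hcont : ∀ q ∈ Q, ContinuousAt (fun θ => R θ q) 0 := by
    intro q hq
    lift q to D using hs.isStateSet.subset hq
    obtain ⟨q₁, hq₁⟩ : ∃ q₁ : D, (q₁ : E) = Φ t t₁ q :=
      ⟨⟨_, hs.isStateSet.subset ((Evo.of_isPropagator (hΦ t t₁ h1.le)).mapsTo hs hq)⟩, rfl⟩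
    obtain ⟨δ, hδ, hδ'⟩ := hs.exists_norm_switch_sub_le hΦ hΨ h1 h2 hq hq₁ one_pos
    set w := Ψ t₁ t₂ ((generator H a t₁ q₁ : E) - generator H b t₁ q₁)
    rw [ContinuousAt, tendsto_iff_norm_sub_tendsto_zero]
    have h3 : Tendsto (fun θ : ℝ => |θ| + |θ| * ‖w‖) (𝓝 0) (𝓝 0) := by
      have : Continuous fun θ : ℝ => |θ| + |θ| * ‖w‖ := by fun_prop
      simpa using this.tendsto 0
    refine squeeze_zero' (Eventually.of_forall fun _ => norm_nonneg _) ?_ h3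
    filter_upwards [Metric.ball_mem_nhds (0 : ℝ) hδ] with θ hθ
    rw [Metric.mem_ball, Real.dist_eq, sub_zero] at hθ
    have h4 := hδ' q hq (by simpa using hδ) 0 θ (by simpa using hδ) hθ
    rw [sub_zero, one_mul] at h4
    have h5 := norm_add_le (R θ q - R 0 q - θ • w) (θ • w)
    rw [sub_add_cancel, norm_smul, Real.norm_eq_abs] at h5
    exact h5.trans (add_le_add h4 le_rfl)
  have hc : ∀ e, ContinuousAt (fun θ => R θ (F' e)) 0 := fun e =>
    tendsto_of_mem_stateSpan hRc hcont (hVs ⟨e, rfl⟩)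
  have hmain := hasStrictFDerivAt_comp_family hF hRc hc hw
  refine ⟨P × ℝ, inferInstance, inferInstance, inferInstance, _, _, _, hmain, ?_, ?_, ?_⟩
  · simp only [hR, add_zero, ContinuousLinearMap.comp_apply]
  · have e1 : Tendsto (fun z : P × ℝ => z.1) (𝓝 (p₀, 0)) (𝓝 p₀) := continuous_fst.tendsto _
    have e2 : Tendsto (fun z : P × ℝ => z.2) (𝓝 (p₀, 0)) (𝓝 0) := continuous_snd.tendsto _
    filter_upwards [e1.eventually hev, e2.eventually hθ] with z ⟨T, hT, hz⟩ hz2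
    refine ⟨_, (hT.step (hΦ _ _ hz2.1)).step (hΨ _ _ hz2.2), ?_⟩
    rw [hz]
    rfl
  · have h3 : R 0 = (Ψ t₁ t₂).comp (Φ t t₁) := by simp only [hR, add_zero]
    rw [h3, ContinuousLinearMap.coe_coprod, LinearMap.range_coprod]
    congr 1
    · exact LinearMap.range_comp F'.toLinearMap _
    · ext z
      simp [Submodule.mem_span_singleton]

end IsAccess

end Access

section MaxAccess

variable {E : Type*} [NormedAddCommGroup E] [InnerProductSpace ℝ E] {m r : ℕ}
  {D : Submodule ℝ E} {Q : Set E} {H : Fin (r + 1) → ℝ → Module.End ℝ D} {t₀ t₁ t : ℝ}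
  {x y : E} {V : Submodule ℝ E}

/-! ### Families of maximal rank -/

/-- Among the families of states reachable before time `t₁`, the given one has a derivative of
maximal rank. -/
structure IsMaxAccess (Q : Set E) (H : Fin (r + 1) → ℝ → Module.End ℝ D) (t₀ t₁ t : ℝ) (x y : E)
    (V : Submodule ℝ E) : Prop where
  lt : t < t₁
  isAccess : IsAccess Q H t₀ t x y V
  finrank_le : ∀ t' y' V', t' < t₁ → IsAccess Q H t₀ t' x y' V' →
    Module.finrank ℝ V' ≤ Module.finrank ℝ V

lemma exists_isMaxAccess (hs : IsControlSystem m Q H) (hx : x ∈ Q) (h01 : t₀ < t₁) :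
    ∃ t y V, IsMaxAccess Q H t₀ t₁ t x y V := by
  set R : Set ℕ := {n | ∃ t y V, t < t₁ ∧ IsAccess Q H t₀ t x y V ∧ Module.finrank ℝ V = n}
  have hne : R.Nonempty := ⟨_, t₀, x, ⊥, h01, .refl Q H t₀ x, rfl⟩
  have hbdd : BddAbove R := by
    refine ⟨m, ?_⟩
    rintro _ ⟨t, y, V, -, hV, rfl⟩
    exact hV.finrank_le hs hx
  obtain ⟨t, y, V, ht, hV, hn⟩ := Nat.sSup_mem hne hbdd
  refine ⟨t, y, V, ht, hV, fun t' y' V' ht' hV' => ?_⟩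
  rw [hn]
  exact le_csSup hbdd ⟨t', y', V', ht', hV', rfl⟩

/-- At all states reached from `y` after time `t` and before time `t₁`, the values of the vector
field `X` belong to the transported space `V`. -/
def IsAlong (Q : Set E) (H : Fin (r + 1) → ℝ → Module.End ℝ D) (t t₁ : ℝ) (y : E)
    (V : Submodule ℝ E) (X : ℝ → Module.End ℝ D) : Prop :=
  ∀ τ, t < τ → τ < t₁ → ∀ T, Evo Q H t τ T → ∀ q : D, (q : E) = T y →
    (X τ q : E) ∈ V.map T.toLinearMap

namespace IsAlong

variable {X Y : ℝ → Module.End ℝ D}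

lemma zero : IsAlong Q H t t₁ y V 0 := fun τ _ _ T _ q _ => by
  simp

lemma add (hX : IsAlong Q H t t₁ y V X) (hY : IsAlong Q H t t₁ y V Y) :
    IsAlong Q H t t₁ y V (X + Y) := fun τ h1 h2 T hT q hq =>
  (V.map T.toLinearMap).add_mem (hX τ h1 h2 T hT q hq) (hY τ h1 h2 T hT q hq)

lemma smul (hX : IsAlong Q H t t₁ y V X) (c : ℝ) : IsAlong Q H t t₁ y V (c • X) :=
  fun τ h1 h2 T hT q hq => (V.map T.toLinearMap).smul_mem c (hX τ h1 h2 T hT q hq)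

end IsAlong

variable [CompleteSpace E]

/-- By maximality of the rank, a variation of a switching time adds nothing. -/
lemma IsMaxAccess.isAlong_control (hs : IsControlSystem m Q H) (h : IsMaxAccess Q H t₀ t₁ t x y V)
    (hx : x ∈ Q) (l : Fin r) : IsAlong Q H t t₁ y V (H l.succ) := by
  intro τ htτ hτ T hT q hq
  have hyS := subset_stateSpan Q (h.isAccess.mem hs hx)
  have hVS := h.isAccess.le_stateSpan hs hx
  obtain ⟨s, T', a, Φ, hsτ, hT', hΦ, hTT⟩ := hT.exists_eqOn_comp hs htτ
  have hacc := h.isAccess.evo hT'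
  obtain ⟨t₂, h2, h3⟩ := exists_between hτ
  obtain ⟨Φ', hΦ'⟩ := hs.exists_forall_isPropagator a
  set b := a - Pi.single l 1 with hb
  obtain ⟨Ψ, hΨ⟩ := hs.exists_forall_isPropagator b
  have hT'S := fun v hv => hT'.mapsTo_stateSpan (x := v) hs hv
  have hΦeq : ∀ v ∈ stateSpan Q, Φ' s τ v = Φ v := fun v hv =>
    eq_of_mem_stateSpan (Q := Q) (fun w hw => by
      obtain ⟨z, hz, hsol⟩ := hs.exists_solution a s ⟨w, hs.isStateSet.subset hw⟩ hw
      have e1 := hΦ.apply z hsol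
      have e2 := (hΦ' s τ hsτ.le).apply z hsol
      rw [hz] at e1 e2
      rw [e1, e2]) hv
  have hq' : (q : E) = Φ' s τ (T' y) := by
    rw [hq, hTT hyS, ContinuousLinearMap.comp_apply, hΦeq _ (hT'S y hyS)]
  have hqQ : (q : E) ∈ Q := by rw [hq]; exact hT.mapsTo hs (h.isAccess.mem hs hx)
  have hsw := hacc.switch hs hx hΦ' hΨ hsτ h2 hq'
  have hgen : (generator H a τ q : E) - generator H b τ q = H l.succ τ q := by
    have e1 : generator H a τ - generator H b τ = H l.succ τ := by
      have : ∀ x : Fin r, a x • H x.succ τ - b x • H x.succ τ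
          = (Pi.single l (1 : ℝ) : Fin r → ℝ) x • H x.succ τ := fun x => by
        refine LinearMap.ext fun ψ => ?_
        simp only [LinearMap.sub_apply, LinearMap.smul_apply, hb, Pi.sub_apply]
        module
      rw [generator, generator, add_sub_add_left_eq_sub, ← Finset.sum_sub_distrib,
        Finset.sum_congr rfl fun x _ => this x, Finset.sum_eq_single l]
      · simp
      · intro b _ hb; simp [hb]
      · simp
    rw [← e1]; rfl
  rw [hgen] at hsw
  set S := (Ψ τ t₂).comp (Φ' s τ) with hS
  have hSE : Evo Q H s t₂ S := (Evo.of_isPropagator (hΦ' s τ hsτ.le)).step (hΨ τ t₂ h2.le)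
  have hWS := hT'.map_le_stateSpan hs hVS
  have hfin := hsw.finite
  have hle := h.finrank_le _ _ _ h3 hsw
  have heq := Submodule.eq_of_le_of_finrank_le
    (le_sup_left : (V.map T'.toLinearMap).map S.toLinearMap ≤ _) (by
      rw [hSE.finrank_map hs hWS, hT'.finrank_map hs hVS]
      exact hle)
  have hmem : Ψ τ t₂ (H l.succ τ q : E) ∈ (V.map T'.toLinearMap).map S.toLinearMap := by
    rw [heq]
    exact Submodule.mem_sup_right (Submodule.mem_span_singleton_self _)
  obtain ⟨_, ⟨v, hv, rfl⟩, hvw⟩ := hmem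
  refine ⟨v, hv, ?_⟩
  have hvS := hVS hv
  change T v = _
  rw [hTT hvS, ContinuousLinearMap.comp_apply, ← hΦeq _ (hT'S v hvS)]
  refine (Evo.of_isPropagator (hΨ τ t₂ h2.le)).injOn hs
    ((Evo.of_isPropagator (hΦ' s τ hsτ.le)).mapsTo_stateSpan hs (hT'S v hvS))
    ((hs.isTangent l.succ τ).apply_mem_stateSpan hs.isStateSet hqQ) hvw

/-- The expectation of a family `X` along two solutions, one of them arbitrary in the span of the
states. -/
lemma IsControlSystem.hasDerivWithinAt_inner_propagator (hs : IsControlSystem m Q H)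
    {a : Fin r → ℝ} {X Y Z : ℝ → Module.End ℝ D} (hX : ∀ t, IsTangent m Q (X t))
    (hd : ∀ (t : ℝ) (ψ : D), HasDerivAt (fun s => (X s ψ : E)) (Y t ψ) t)
    (hZ : ∀ t, Z t = Y t - (generator H a t * X t - X t * generator H a t))
    (hZc : ∀ ψ : D, Continuous fun t => (Z t ψ : E))
    {Φ : ℝ → ℝ → E →L[ℝ] E} (hΦ : ∀ s t, s ≤ t → IsPropagator Q H a s t (Φ s t)) {τ b : ℝ}
    {z : ℝ → D} (hz : IsSolution Q (generator H a) τ z) {p : E}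
    (hp : p ∈ stateSpan Q) : ∀ s ∈ Icc τ b,
    HasDerivWithinAt (fun s => ⟪(X s (z s) : E), Φ τ s p⟫_ℝ) ⟪(Z s (z s) : E), Φ τ s p⟫_ℝ
      (Icc τ b) s := by
  have hQ := hs.isStateSet
  have hYt := IsTangent.timeDeriv hX hd
  have hZt : ∀ t, IsTangent m Q (Z t) := fun t => by
    rw [hZ t]
    exact (hYt t).sub ((hs.isTangent_generator a t).commutator hQ (hX t))
  -- continuity of a family along the solution
  have hcont : ∀ {W : ℝ → Module.End ℝ D}, (∀ t, IsTangent m Q (W t)) →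
      (∀ ψ : D, Continuous fun t => (W t ψ : E)) → ContinuousOn (fun s => (W s (z s) : E))
        (Icc τ b) := by
    intro W hW hWc
    have h1 := (IsTangent.continuousOn_weakExt_family hQ hW hWc).comp
      (f := fun s : ℝ => (s, (z s : E))) (s := Icc τ b)
      (continuousOn_id.prodMk (hz.continuousOn.mono Icc_subset_Ici_self))
      fun s hs' => ⟨mem_univ _, hQ.subset_chartSet (hz.mem s hs'.1)⟩
    refine h1.congr fun s _ => ?_
    exact (weakExt_coe hQ.dense (hW s).skew (z s)).symm
  have hXcont := hcont hX fun ψ => continuous_iff_continuousAt.2 fun t => (hd t ψ).continuousAt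
  have hZcont := hcont hZt hZc
  obtain ⟨C, hC⟩ := isCompact_Icc.exists_bound_of_continuousOn hZcont
  refine hasDerivWithinAt_of_mem_closure_span (X := Q)
    (g := fun s => (innerSL ℝ (X s (z s) : E)).comp (Φ τ s))
    (κ := fun s => (innerSL ℝ (Z s (z s) : E)).comp (Φ τ s)) (C := C)
    (fun s hs' x => ?_) (fun x hx s hs' => ?_) hp ?_
  · refine (abs_real_inner_le_norm _ _).trans ?_
    exact mul_le_mul (hC s hs') ((hΦ τ s hs'.1).norm_le x) (norm_nonneg _)
      ((norm_nonneg _).trans (hC s hs'))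
  · obtain ⟨w, hw, hsol⟩ := hs.exists_solution a τ ⟨x, hQ.subset hx⟩ hx
    have hΦw : ∀ u ∈ Icc τ b, Φ τ u x = w u := by
      intro u hu
      have := (hΦ τ u hu.1).apply w hsol
      rw [hw] at this
      exact this
    have hzd := (hz.deriv s hs'.1).mono (Icc_subset_Ici_self : Icc τ b ⊆ Ici τ)
    have hwd := (hsol.deriv s hs'.1).mono (Icc_subset_Ici_self : Icc τ b ⊆ Ici τ)
    set A := generator H a s with hA
    have hAskew : IsSkew A := isSkew_generator hs.skew a s
    have e1 : HasDerivWithinAt (fun u => ⟪(X u (z u) : E), (w u : E) - w s⟫_ℝ)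
        ⟪(X s (z s) : E), A (w s)⟫_ℝ (Icc τ b) s := by
      rw [hasDerivWithinAt_iff_tendsto_slope]
      have h1 := ((hXcont s hs').mono_left (nhdsWithin_mono _ sdiff_subset)).inner
        (𝕜 := ℝ) (hasDerivWithinAt_iff_tendsto_slope.1 hwd)
      refine h1.congr fun u => ?_
      simp [slope_def_module, real_inner_smul_right]
    have e2 : HasDerivWithinAt (fun u => -⟪(z u : E), (X u (w s) : E)⟫_ℝ)
        (-(⟪(z s : E), (Y s (w s) : E)⟫_ℝ + ⟪(A (z s) : E), (X s (w s) : E)⟫_ℝ)) (Icc τ b) s :=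
      (hzd.inner ℝ (hd s (w s)).hasDerivWithinAt).neg
    have e3 := e1.add e2
    have hval : ⟪(X s (z s) : E), A (w s)⟫_ℝ
        + -(⟪(z s : E), (Y s (w s) : E)⟫_ℝ + ⟪(A (z s) : E), (X s (w s) : E)⟫_ℝ)
        = ⟪(Z s (z s) : E), (w s : E)⟫_ℝ := by
      rw [hZ s]
      simp only [LinearMap.sub_apply, Module.End.mul_apply, Submodule.coe_sub, inner_sub_left]
      rw [(hYt s).skew (z s) (w s), hAskew (X s (z s)) (w s), (hX s).skew (A (z s)) (w s)]
      ring
    rw [hval] at e3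
    have e4 : EqOn (fun u => ⟪(X u (z u) : E), Φ τ u x⟫_ℝ)
        (fun u => ⟪(X u (z u) : E), (w u : E) - w s⟫_ℝ + -⟪(z u : E), (X u (w s) : E)⟫_ℝ)
        (Icc τ b) := by
      intro u hu
      simp only [hΦw u hu, inner_sub_right]
      rw [(hX u).skew (z u) (w s)]
      ring
    have e5 := e3.congr_of_mem (f₁ := fun u => ⟪(X u (z u) : E), Φ τ u x⟫_ℝ) e4 hs'
    have e6 : ((innerSL ℝ (Z s (z s) : E)).comp (Φ τ s)) x = ⟪(Z s (z s) : E), (w s : E)⟫_ℝ := by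
      rw [ContinuousLinearMap.comp_apply, hΦw s hs', innerSL_apply_apply]
    rw [e6]
    exact e5
  · exact hZcont.inner ((hs.continuousOn_propagator_right hΦ τ hp).mono Icc_subset_Ici_self)

/-- The families along `V` are stable under the derivative along the solutions. -/
lemma IsAlong.deriv (hs : IsControlSystem m Q H) (hy : y ∈ Q) (hV : V ≤ stateSpan Q)
    [Module.Finite ℝ V] {X Y Z : ℝ → Module.End ℝ D} (h : IsAlong Q H t t₁ y V X) (a : Fin r → ℝ)
    (hX : ∀ t, IsTangent m Q (X t))
    (hd : ∀ (t : ℝ) (ψ : D), HasDerivAt (fun s => (X s ψ : E)) (Y t ψ) t)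
    (hZ : ∀ t, Z t = Y t - (generator H a t * X t - X t * generator H a t))
    (hZc : ∀ ψ : D, Continuous fun t => (Z t ψ : E)) : IsAlong Q H t t₁ y V Z := by
  intro τ htτ hτ T hT q hq
  have hQ := hs.isStateSet
  have hqQ : (q : E) ∈ Q := by rw [hq]; exact hT.mapsTo hs hy
  have hWS := hT.map_le_stateSpan hs hV
  set W := V.map T.toLinearMap with hW
  have hZt : IsTangent m Q (Z τ) := by
    rw [hZ τ]
    exact (IsTangent.timeDeriv hX hd τ).sub ((hs.isTangent_generator a τ).commutator hQ (hX τ))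
  obtain ⟨z, hz, hsol⟩ := hs.exists_solution a τ q hqQ
  obtain ⟨Φ, hΦ⟩ := hs.exists_forall_isPropagator a
  have hΦq : ∀ s, τ ≤ s → (z s : E) = Φ τ s q := fun s hs' => by
    have := (hΦ τ s hs').apply z hsol
    rw [hz] at this
    exact this.symm
  have key : ∀ v ∈ stateSpan Q, (∀ w ∈ W, ⟪w, v⟫_ℝ = 0) → ⟪(Z τ q : E), v⟫_ℝ = 0 := by
    intro v hv hvW
    have h1 := hs.hasDerivWithinAt_inner_propagator hX hd hZ hZc hΦ hsol hv τ
      (left_mem_Icc.2 hτ.le)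
    have h2 : (fun s => ⟪(X s (z s) : E), Φ τ s v⟫_ℝ) =ᶠ[𝓝[Icc τ t₁] τ] fun _ => 0 := by
      filter_upwards [self_mem_nhdsWithin, mem_nhdsWithin_of_mem_nhds (Iio_mem_nhds hτ)]
        with s hs1 hs2
      obtain ⟨σ, hσ, hσe⟩ := h s (htτ.trans_le hs1.1) hs2 _ (hT.step (hΦ τ s hs1.1)) (z s)
        (by rw [hΦq s hs1.1, hq]; rfl)
      rw [← hσe]
      change ⟪Φ τ s (T σ), Φ τ s v⟫_ℝ = 0
      rw [(hΦ τ s hs1.1).inner _ (hT.mapsTo_stateSpan hs (hV hσ)) _ hv]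
      exact hvW _ ⟨σ, hσ, rfl⟩
    have h3 := (hasDerivWithinAt_const τ (Icc τ t₁) (0 : ℝ)).congr_of_eventuallyEq h2
      (h2.self_of_nhdsWithin (left_mem_Icc.2 hτ.le))
    have h4 := (uniqueDiffOn_Icc hτ τ (left_mem_Icc.2 hτ.le)).eq_deriv _ h1 h3
    rwa [hz, (hΦ τ τ le_rfl).apply_self hs hv] at h4
  have hfin : Module.Finite ℝ W := by rw [hW]; infer_instance
  have hP := W.starProjection_apply_mem (Z τ q : E)
  set P := W.starProjection (Z τ q : E) with hPdef
  have horth : ∀ w ∈ W, ⟪w, (Z τ q : E) - P⟫_ℝ = 0 := fun w hw =>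
    (W.mem_orthogonal _).1 (W.sub_starProjection_mem_orthogonal (Z τ q : E)) w hw
  have h5 := key _ ((stateSpan Q).sub_mem (hZt.apply_mem_stateSpan hQ hqQ) (hWS hP)) horth
  have h6 : ⟪(Z τ q : E) - P, (Z τ q : E) - P⟫_ℝ = 0 := by
    rw [inner_sub_left, h5, horth P hP, sub_zero]
  rw [sub_eq_zero.1 (inner_self_eq_zero.1 h6)]
  exact hP

end MaxAccess

section Exact

variable {E : Type*} [NormedAddCommGroup E] [InnerProductSpace ℝ E] {m r : ℕ}
  {D : Submodule ℝ E} {Q : Set E} {H : Fin (r + 1) → ℝ → Module.End ℝ D} {t₀ t₁ t t' : ℝ}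
  {x y : E} {V : Submodule ℝ E}

/-! ### From density to exact controllability -/

/-- An evolution operator maps neighbourhoods of points of the manifold onto neighbourhoods, by the
inverse function theorem: it is isometric, and preserves the dimension. -/
lemma Evo.exists_open_coord (hs : IsControlSystem m Q H) {T : E →L[ℝ] E} (hT : Evo Q H t t' T)
    {v : Fin m → E} {Ω : Set (EuclideanSpace ℝ (Fin m))} {G : EuclideanSpace ℝ (Fin m) → E}
    {U : Set E} (hG : IsGraphChart (closure Q) v Ω G U) {k : E} (hk : k ∈ chartSet m (closure Q))
    (hkU : T k ∈ U) {B : Set E} (hB : B ∈ 𝓝 k) :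
    ∀ᶠ η in 𝓝 (coordMap v (T k)), ∃ k' ∈ closure Q ∩ B, G η = T k' := by
  obtain ⟨v', Ω', G', U', hG', hkU'⟩ := hs.isStateSet.exists_chart hk
  set L := coordMap v with hL
  set L' := coordMap (fun j => (v' j : E)) with hL'
  have hζ := hG'.coord_mem k ⟨hk.1, hkU'⟩
  have hGk : G' (L' k) = k := hG'.apply_coord k ⟨hk.1, hkU'⟩
  set f' := L.comp (T.comp (fderiv ℝ G' (L' k))) with hf'
  have hstrict : HasStrictFDerivAt (fun ζ => L (T (G' ζ))) f' (L' k) :=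
    L.hasStrictFDerivAt.comp _ (T.hasStrictFDerivAt.comp _
      ((hG'.contDiffAt hζ).hasStrictFDerivAt (by simp)))
  have hinj : Function.Injective f' := by
    refine (injective_iff_map_eq_zero f').2 fun e he => ?_
    have hc : HasDerivAt (fun s : ℝ => L' k + s • e) e 0 := by
      simpa using ((hasDerivAt_id (0 : ℝ)).smul_const e).const_add (L' k)
    have h0 : L' k + (0 : ℝ) • e = L' k := by simp
    have hd : HasDerivAt (fun s : ℝ => T (G' (L' k + s • e))) (T (fderiv ℝ G' (L' k) e)) 0 :=
      T.hasFDerivAt.comp_hasDerivAt (0 : ℝ) (HasFDerivAt.comp_hasDerivAt (0 : ℝ)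
        (by rw [h0]; exact hG'.hasFDerivAt hζ) hc)
    have hS : ∀ᶠ s in 𝓝 (0 : ℝ), T (G' (L' k + s • e)) ∈ closure Q := by
      have : ∀ᶠ s in 𝓝 (0 : ℝ), L' k + s • e ∈ Ω' :=
        hc.continuousAt.eventually_mem (by rw [h0]; exact hG'.isOpen_dom.mem_nhds hζ)
      filter_upwards [this] with s hs' using hT.mapsTo_closure hs (hG'.mem _ hs').1
    have h1 := hG.fderiv_coordMap_of_hasDerivWithinAt (mem_univ (0 : ℝ)) uniqueDiffWithinAt_univ
      hd.hasDerivWithinAt (by rw [nhdsWithin_univ]; exact hS) (by rw [h0, hGk]; exact hkU)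
    have h2 : coordMap v (T (fderiv ℝ G' (L' k) e)) = 0 := he
    rw [h2, map_zero] at h1
    have h3 : fderiv ℝ G' (L' k) e ∈ stateSpan Q := by
      refine apply_mem_of_hasFDerivAt (isClosed_stateSpan Q) (hG'.hasFDerivAt hζ) ?_ e
      filter_upwards [hG'.isOpen_dom.mem_nhds hζ] with η hη
        using closure_subset_stateSpan Q (hG'.mem η hη).1
    have h4 := hT.injOn hs h3 (stateSpan Q).zero_mem (h1.symm.trans (map_zero T).symm)
    rw [← hG'.coordMap_fderiv hζ e, h4, map_zero]
  have hsurj : LinearMap.range f'.toLinearMap = ⊤ :=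
    LinearMap.range_eq_top.2 (LinearMap.injective_iff_surjective.1 hinj)
  have hmap : map (fun ζ => L (T (G' ζ))) (𝓝 (L' k)) = 𝓝 (L (T k)) := by
    rw [hstrict.map_nhds_eq_of_surj hsurj, hGk]
  have hcont : ContinuousAt G' (L' k) := (hG'.hasFDerivAt hζ).continuousAt
  have hgood : {ζ | ζ ∈ Ω' ∧ G' ζ ∈ B ∧ T (G' ζ) ∈ U} ∈ 𝓝 (L' k) := by
    refine inter_mem (hG'.isOpen_dom.mem_nhds hζ) (inter_mem ?_ ?_)
    · exact hcont (by rw [hGk]; exact hB)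
    · exact (T.continuous.continuousAt.comp hcont) (hG.isOpen_nhd.mem_nhds (by
        rw [Function.comp_apply, hGk]; exact hkU))
  rw [← hmap]
  filter_upwards [image_mem_map hgood]
  rintro _ ⟨ζ, ⟨h1, h2, h3⟩, rfl⟩
  exact ⟨G' ζ, ⟨(hG'.mem ζ h1).1, h2⟩,
    hG.apply_coord _ ⟨hT.mapsTo_closure hs (hG'.mem ζ h1).1, h3⟩⟩

/-- The maximal rank is the dimension of the manifold if the families along `V` fill the tangent
spaces. -/
lemma IsMaxAccess.le_finrank (hs : IsControlSystem m Q H) (h : IsMaxAccess Q H t₀ t₁ t x y V)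
    [CompleteSpace E] (hx : x ∈ Q)
    (hfull : ∀ τ, ∀ q : D, (q : E) ∈ Q → ∃ W : Submodule ℝ D, Module.rank ℝ W = (m : Cardinal) ∧
      ∀ z ∈ W, ∃ X, IsAlong Q H t t₁ y V X ∧ X τ q = z) : m ≤ Module.finrank ℝ V := by
  obtain ⟨τ, h1, h2⟩ := exists_between h.lt
  obtain ⟨T, hT⟩ := hs.exists_evo h1.le
  have hTy := hT.mapsTo hs (h.isAccess.mem hs hx)
  obtain ⟨W, hW, hWX⟩ := hfull τ ⟨T y, hs.isStateSet.subset hTy⟩ hTy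
  have hfin := h.isAccess.finite
  have hle : W.map D.subtype ≤ V.map T.toLinearMap := by
    rintro _ ⟨z, hz, rfl⟩
    obtain ⟨X, hX, rfl⟩ := hWX z hz
    exact hX τ h1 h2 T hT _ rfl
  rw [← hT.finrank_map hs (h.isAccess.le_stateSpan hs hx)]
  refine le_trans (le_of_eq ?_) (Submodule.finrank_mono hle)
  have hinj : Function.Injective (D.subtype.domRestrict W) := fun a b hab =>
    Subtype.ext (Subtype.ext hab)
  rw [← LinearMap.range_domRestrict, LinearMap.finrank_range_of_inj hinj]
  exact (Module.finrank_eq_of_rank_eq hW).symm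

variable [CompleteSpace E] {Q₀ : Set E}

/-- If the reachable sets are dense, and at an intermediate time the reachable set contains a
neighbourhood of a point, then every state is reachable. -/
theorem IsControlSystem.exists_evo_eq (hs : IsControlSystem m Q H)
    (hdense : ∀ {t₀ t₁ : ℝ}, t₀ < t₁ → ∀ x ∈ Q, ∀ z ∈ Q, ∀ ε > 0,
      ∃ T, Evo Q H t₀ t₁ T ∧ ‖T x - z‖ < ε)
    (ht : t < t₁) (hacc : IsAccess Q H t₀ t x y V) (hm : m ≤ Module.finrank ℝ V)
    (hx : x ∈ Q) {z : E} (hz : z ∈ Q) : ∃ T, Evo Q H t₀ t₁ T ∧ T x = z := by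
  have hQ := hs.isStateSet
  obtain ⟨δ, hδ, hball⟩ := hacc.exists_evo_of_finrank hs hx hm
  have hyQ := hacc.mem hs hx
  obtain ⟨r₁, hr₁, hcomp, hsub⟩ := exists_isCompact_closedBall (hQ.subset_chartSet hyQ)
  obtain ⟨ρ, hρ0, hρ⟩ := exists_between (lt_min hr₁ hδ)
  obtain ⟨hρ1, hρ2⟩ := lt_min_iff.1 hρ
  set K := closure Q ∩ Metric.closedBall y ρ with hKdef
  have hKsub : K ⊆ closure Q ∩ Metric.closedBall y r₁ :=
    inter_subset_inter_right _ (Metric.closedBall_subset_closedBall hρ1.le)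
  have hK : IsCompact K :=
    hcomp.of_isClosed_subset (isClosed_closure.inter Metric.isClosed_closedBall) hKsub
  obtain ⟨v, Ω, G, U, hG, hzU⟩ := hQ.exists_chart (hQ.subset_chartSet hz)
  set L := coordMap (fun j => (v j : E)) with hL
  have hξ := hG.coord_mem z ⟨subset_closure hz, hzU⟩
  have hGz : G (L z) = z := hG.apply_coord z ⟨subset_closure hz, hzU⟩
  have hρ4 : 0 < ρ / 4 := by positivity
  have hnhd : {η | η ∈ Ω ∧ ‖G η - z‖ < ρ / 4} ∈ 𝓝 (L z) := by
    refine inter_mem (hG.isOpen_dom.mem_nhds hξ) ?_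
    have h1 : ContinuousAt G (L z) := (hG.hasFDerivAt hξ).continuousAt
    rw [ContinuousAt, hGz] at h1
    have h2 := h1.eventually (Metric.ball_mem_nhds _ hρ4)
    simp only [dist_eq_norm] at h2
    exact h2
  obtain ⟨s, hs0, hsub'⟩ := Metric.mem_nhds_iff.1 hnhd
  have hnhd' : Metric.ball z (ρ / 4) ∩ (U ∩ L ⁻¹' Metric.ball (L z) s) ∈ 𝓝 z :=
    inter_mem (Metric.ball_mem_nhds _ hρ4) (inter_mem (hG.isOpen_nhd.mem_nhds hzU)
      (L.continuous.continuousAt.preimage_mem_nhds (Metric.ball_mem_nhds _ hs0)))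
  obtain ⟨ε, hε, hsub''⟩ := Metric.mem_nhds_iff.1 hnhd'
  obtain ⟨T, hT, hTz⟩ := hdense ht y hyQ z hz ε hε
  obtain ⟨hTy1, hTyU, hTyL⟩ := hsub'' (show T y ∈ Metric.ball z ε by
    rwa [Metric.mem_ball, dist_eq_norm])
  -- the part of the chart covered by the image of `K` is open and closed
  have hcover : Metric.ball (L z) s ⊆ {η | η ∈ Metric.ball (L z) s ∧ G η ∈ T '' K} := by
    refine (convex_ball (L z) s).isPreconnected.subset_of_closure_inter_subset ?_ ?_ ?_
    · rw [isOpen_iff_mem_nhds]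
      rintro η ⟨hη, k, hk, hkη⟩
      obtain ⟨hηΩ, hηz⟩ := hsub' hη
      have hky : dist k y < ρ := by
        have h1 := hT.inner_eq hs
          ((stateSpan Q).sub_mem (closure_subset_stateSpan Q hk.1) (subset_stateSpan Q hyQ))
          ((stateSpan Q).sub_mem (closure_subset_stateSpan Q hk.1) (subset_stateSpan Q hyQ))
        rw [real_inner_self_eq_norm_sq, real_inner_self_eq_norm_sq, map_sub, hkη] at h1
        have h2 : ‖G η - T y‖ = ‖k - y‖ := by
          rw [← abs_of_nonneg (norm_nonneg (G η - T y)), ← abs_of_nonneg (norm_nonneg (k - y))]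
          exact sq_eq_sq_iff_abs_eq_abs _ _ |>.1 h1
        rw [dist_eq_norm, ← h2]
        have h3 : G η - T y = (G η - z) - (T y - z) := by abel
        rw [Metric.mem_ball, dist_eq_norm] at hTy1
        rw [h3]
        exact (_root_.norm_sub_le _ _).trans_lt (by linarith)
      have hkN := hsub (hKsub hk)
      have hTkU : T k ∈ U := by rw [hkη]; exact (hG.mem η hηΩ).2
      have hev := hT.exists_open_coord hs hG hkN hTkU
        (Metric.isOpen_ball.mem_nhds (show k ∈ Metric.ball y ρ from hky))
      rw [hkη, hG.coord_apply η hηΩ] at hev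
      filter_upwards [hev, Metric.isOpen_ball.mem_nhds hη] with η' ⟨k', hk', hGk'⟩ hη'
      exact ⟨hη', k', ⟨hk'.1, Metric.ball_subset_closedBall hk'.2⟩, hGk'.symm⟩
    · refine ⟨L (T y), hTyL, hTyL, y, ⟨subset_closure hyQ, Metric.mem_closedBall_self hρ0.le⟩, ?_⟩
      exact (hG.apply_coord _ ⟨subset_closure (hT.mapsTo hs hyQ), hTyU⟩).symm
    · rintro η ⟨hη1, hη2⟩
      refine ⟨hη2, ?_⟩
      have hcl : IsClosed (T '' K) := (hK.image T.continuous).isClosed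
      have hc : ContinuousAt G η := (hG.hasFDerivAt (hsub' hη2).1).continuousAt
      rw [← hcl.closure_eq]
      exact hc.continuousWithinAt.mem_closure hη1 fun η' hη' => hη'.2
  obtain ⟨-, k, hk, hkz⟩ := hcover (Metric.mem_ball_self hs0)
  obtain ⟨T', hT', hT'k⟩ := hball k hk.1 (by
    have := Metric.mem_closedBall.1 hk.2
    rw [dist_eq_norm] at this
    linarith)
  refine ⟨T.comp T', hT'.trans hT, ?_⟩
  rw [ContinuousLinearMap.comp_apply, hT'k, hkz, hGz]

end Exact

section LieAlgebra

variable {L : Type*} [LieRing L] [LieAlgebra ℝ L] {ι : Type*}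

/-! ### Lie algebras with a derivation -/

/-- The Lie algebra `L` is generated by the `h i` and their images under iterates of `δ`. -/
def IsDiffGenerated (δ : L →ₗ[ℝ] L) (h : ι → L) : Prop :=
  ∀ K : LieSubalgebra ℝ L, (∀ i, h i ∈ K) → (∀ X ∈ K, δ X ∈ K) → ∀ X, X ∈ K

/-- A subspace which contains the generators and is stable under `δ` and under the bracket with the
generators is everything: its normalizer contains the generators and is stable under `δ`, so that it
is an ideal. -/
lemma IsDiffGenerated.mem_of_stable {δ : L →ₗ[ℝ] L} {h : ι → L} (hgen : IsDiffGenerated δ h)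
    (hδ : ∀ X Y, δ ⁅X, Y⁆ = ⁅δ X, Y⁆ + ⁅X, δ Y⁆) {P : Submodule ℝ L} (h1 : ∀ i, h i ∈ P)
    (h2 : ∀ X ∈ P, δ X ∈ P) (h3 : ∀ i, ∀ X ∈ P, ⁅h i, X⁆ ∈ P) (X : L) : X ∈ P := by
  let N : LieSubalgebra ℝ L :=
    { carrier := {Y | ∀ X ∈ P, ⁅Y, X⁆ ∈ P}
      add_mem' := fun {a b} ha hb X hX => by rw [add_lie]; exact P.add_mem (ha X hX) (hb X hX)
      zero_mem' := fun X _ => by rw [zero_lie]; exact P.zero_mem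
      smul_mem' := fun c Y hY X hX => by rw [smul_lie]; exact P.smul_mem c (hY X hX)
      lie_mem' := fun {a b} ha hb X hX => by
        rw [lie_lie]; exact P.sub_mem (ha _ (hb X hX)) (hb _ (ha X hX)) }
  have hN : ∀ Y, Y ∈ N := hgen N h3 fun Y hY X hX => by
    have h4 : ⁅δ Y, X⁆ = δ ⁅Y, X⁆ - ⁅Y, δ X⁆ := by rw [hδ]; abel
    rw [h4]
    exact P.sub_mem (h2 _ (hY X hX)) (hY _ (h2 X hX))
  let K : LieSubalgebra ℝ L := { P with lie_mem' := fun {a b} _ hb => hN a b hb }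
  exact hgen K h1 h2 X

/-- A subspace `P` such that `X, [X, δ X] ∈ P` implies `δ X ∈ P` is everything if it contains an
ideal that contains the generators: it contains the ideals `Fₙ₊₁ = Fₙ + δ Fₙ`. -/
lemma IsDiffGenerated.mem_of_ideal {δ : L →ₗ[ℝ] L} {h : ι → L} (hgen : IsDiffGenerated δ h)
    (hδ : ∀ X Y, δ ⁅X, Y⁆ = ⁅δ X, Y⁆ + ⁅X, δ Y⁆) {P F : Submodule ℝ L} (h1 : ∀ i, h i ∈ F)
    (hF : ∀ X ∈ F, ∀ Y, ⁅X, Y⁆ ∈ F) (hFP : F ≤ P) (hP : ∀ X ∈ P, ⁅X, δ X⁆ ∈ P → δ X ∈ P) (X : L) :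
    X ∈ P := by
  let G : ℕ → Submodule ℝ L := fun n => Nat.rec F (fun _ S => S ⊔ S.map δ) n
  have hG : ∀ n, G (n + 1) = G n ⊔ (G n).map δ := fun n => rfl
  have hideal : ∀ n, ∀ X ∈ G n, ∀ Y, ⁅X, Y⁆ ∈ G n := by
    intro n
    induction n with
    | zero => exact hF
    | succ n ih =>
      intro X hX Y
      rw [hG] at hX ⊢
      obtain ⟨U, hU, _, ⟨W, hW, rfl⟩, rfl⟩ := Submodule.mem_sup.1 hX
      have h4 : ⁅U + δ W, Y⁆ = (⁅U, Y⁆ - ⁅W, δ Y⁆) + δ ⁅W, Y⁆ := by rw [hδ, add_lie]; abel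
      rw [h4]
      exact Submodule.add_mem_sup ((G n).sub_mem (ih U hU Y) (ih W hW (δ Y)))
        (Submodule.mem_map_of_mem (ih W hW Y))
  have hle : ∀ n, G n ≤ P := by
    intro n
    induction n with
    | zero => exact hFP
    | succ n ih =>
      rw [hG]
      refine sup_le ih ?_
      rintro _ ⟨W, hW, rfl⟩
      exact hP W (ih hW) (ih (hideal n W hW _))
  have hmono : Monotone G := monotone_nat_of_le_succ fun n => by rw [hG]; exact le_sup_left
  let K : LieSubalgebra ℝ L :=
    { carrier := {X | ∃ n, X ∈ G n}
      add_mem' := fun {a b} ⟨n, hn⟩ ⟨k, hk⟩ => ⟨max n k,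
        (G _).add_mem (hmono (le_max_left n k) hn) (hmono (le_max_right n k) hk)⟩
      zero_mem' := ⟨0, (G 0).zero_mem⟩
      smul_mem' := fun c X ⟨n, hn⟩ => ⟨n, (G n).smul_mem c hn⟩
      lie_mem' := fun {a b} ⟨n, hn⟩ _ => ⟨n, hideal n a hn b⟩ }
  obtain ⟨n, hn⟩ := hgen K (fun i => ⟨0, h1 i⟩) (fun X ⟨n, hn⟩ => ⟨n + 1, by
    rw [hG]; exact Submodule.mem_sup_right (Submodule.mem_map_of_mem hn)⟩) X
  exact hle n hn

end LieAlgebra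

section TimeDeriv

variable {E : Type*} [NormedAddCommGroup E] [InnerProductSpace ℝ E] {D : Submodule ℝ E}

/-- The Leibniz rule for the strong derivative of a commutator of skew families, provided that
derivative exists. -/
lemma eq_of_hasDerivAt_commutator (hD : Dense (D : Set E)) {X X' Y Y' : ℝ → Module.End ℝ D}
    (hX : ∀ t, IsSkew (X t)) (hX' : ∀ t, IsSkew (X' t)) (hY : ∀ t, IsSkew (Y t))
    (hY' : ∀ t, IsSkew (Y' t)) (hd : ∀ (t : ℝ) (ψ : D), HasDerivAt (fun s => (X s ψ : E)) (Y t ψ) t)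
    (hd' : ∀ (t : ℝ) (ψ : D), HasDerivAt (fun s => (X' s ψ : E)) (Y' t ψ) t) {t : ℝ} {ψ : D} {z : E}
    (h : HasDerivAt (fun s => (X s (X' s ψ) : E) - X' s (X s ψ)) z t) :
    z = (Y t (X' t ψ) : E) - X' t (Y t ψ) + ((X t (Y' t ψ) : E) - Y' t (X t ψ)) := by
  refine hD.eq_of_inner_right ℝ fun w hw => ?_
  lift w to D using hw
  have h1 := (hasDerivAt_const t (w : E)).inner ℝ h
  have h2 := (((hd t w).inner ℝ (hd' t ψ)).neg).add ((hd' t w).inner ℝ (hd t ψ))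
  have h3 : (fun s => ⟪(w : E), (X s (X' s ψ) : E) - X' s (X s ψ)⟫_ℝ)
      = fun s => -⟪(X s w : E), (X' s ψ : E)⟫_ℝ + ⟪(X' s w : E), (X s ψ : E)⟫_ℝ := by
    funext s
    rw [inner_sub_right, hX s w, hX' s w]
    ring
  rw [h3] at h1
  have h4 := h1.unique h2
  rw [inner_zero_left, add_zero] at h4
  rw [h4]
  simp only [inner_add_right, inner_sub_right, hX t w, hX' t w, hY t w, hY' t w]
  ring

end TimeDeriv

section Families

variable {E : Type*} [NormedAddCommGroup E] [InnerProductSpace ℂ E] {D : Submodule ℂ E} {m r : ℕ}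

attribute [local instance] InnerProductSpace.complexToReal

/-! ### The Lie algebra of operator families -/

/-- A complex operator, regarded as a real one. -/
def toReal (X : Module.End ℂ D) : Module.End ℝ (D.restrictScalars ℝ) where
  toFun ψ := ⟨X ⟨ψ, ψ.2⟩, (X ⟨ψ, ψ.2⟩).2⟩
  map_add' φ ψ := Subtype.ext (by
    have := congrArg Subtype.val (X.map_add ⟨φ, φ.2⟩ ⟨ψ, ψ.2⟩)
    exact this)
  map_smul' c ψ := Subtype.ext (by
    have := congrArg Subtype.val (X.map_smul (c : ℂ) ⟨ψ, ψ.2⟩)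
    exact this)

lemma toReal_add (X Y : Module.End ℂ D) : toReal (X + Y) = toReal X + toReal Y := rfl

lemma toReal_lie (X Y : Module.End ℂ D) :
    toReal ⁅X, Y⁆ = toReal X * toReal Y - toReal Y * toReal X := rfl

lemma toReal_neg (X : Module.End ℂ D) : toReal (-X) = -toReal X := rfl

lemma IsSkewHermitian.isSkew_toReal {X : Module.End ℂ D} (hX : IsSkewHermitian X) :
    IsSkew (toReal X) := by
  intro φ ψ
  have := congrArg Complex.re (hX ⟨φ, φ.2⟩ ⟨ψ, ψ.2⟩)
  exact this

lemma IsTimeDeriv.hasDerivAt_toReal {X Y : OpFamily D} (h : IsTimeDeriv X Y) (t : ℝ)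
    (ψ : D.restrictScalars ℝ) :
    HasDerivAt (fun s => (toReal (X s) ψ : E)) (toReal (Y t) ψ) t := h t ⟨ψ, ψ.2⟩

lemma IsTimeDeriv.unique {X Y Y' : OpFamily D} (h : IsTimeDeriv X Y) (h' : IsTimeDeriv X Y') :
    Y = Y' := by
  funext t
  exact LinearMap.ext fun ψ => Subtype.ext ((h t ψ).unique (h' t ψ))

lemma IsTimeDeriv.add {X Y X' Y' : OpFamily D} (h : IsTimeDeriv X Y) (h' : IsTimeDeriv X' Y') :
    IsTimeDeriv (X + X') (Y + Y') := fun t ψ => (h t ψ).add (h' t ψ)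

lemma IsTimeDeriv.smul {X Y : OpFamily D} (h : IsTimeDeriv X Y) (c : ℝ) :
    IsTimeDeriv (c • X) (c • Y) := fun t ψ => (h t ψ).const_smul c

lemma IsTimeDeriv.zero : IsTimeDeriv (0 : OpFamily D) 0 := fun t _ => hasDerivAt_const t (0 : E)

variable {H : Fin (r + 1) → OpFamily D} {Q : Set E}

lemma setB_subset_algC (n : ℕ) : setB H n ⊆ algC H :=
  (subset_iUnion (setB H) n).trans LieSubalgebra.subset_lieSpan

lemma control_mem_algB (l : Fin r) : H l.succ ∈ algB H :=
  LieSubalgebra.subset_lieSpan (mem_range_self l)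

lemma control_mem_algC (l : Fin r) : H l.succ ∈ algC H :=
  setB_subset_algC 0 (control_mem_algB l)

lemma exists_mem_algB {t : ℝ} {x : Module.End ℂ D} (hx : x ∈ algBAt H t) :
    ∃ X ∈ algB H, X t = x := by
  induction hx using LieSubalgebra.lieSpan_induction with
  | mem x hx =>
    obtain ⟨l, rfl⟩ := hx
    exact ⟨_, control_mem_algB l, rfl⟩
  | zero => exact ⟨0, (algB H).zero_mem, rfl⟩
  | add x y _ _ hx hy =>
    obtain ⟨X, hX, rfl⟩ := hx
    obtain ⟨Y, hY, rfl⟩ := hy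
    exact ⟨X + Y, (algB H).add_mem hX hY, rfl⟩
  | smul c x _ hx =>
    obtain ⟨X, hX, rfl⟩ := hx
    exact ⟨c • X, (algB H).smul_mem c hX, rfl⟩
  | lie x y _ _ hx hy =>
    obtain ⟨X, hX, rfl⟩ := hx
    obtain ⟨Y, hY, rfl⟩ := hy
    exact ⟨⁅X, Y⁆, (algB H).lie_mem hX hY, rfl⟩

/-- The Lie algebra generated by families of tangent operators consists of such families. -/
lemma isTangent_of_mem_lieSpan {s : Set (OpFamily D)} (hQ : IsStateSet m (D.restrictScalars ℝ) Q)
    (hs : ∀ X ∈ s, ∀ t, IsTangent m Q (toReal (X t))) {X : OpFamily D}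
    (hX : X ∈ LieSubalgebra.lieSpan ℝ (OpFamily D) s) (t : ℝ) : IsTangent m Q (toReal (X t)) := by
  induction hX using LieSubalgebra.lieSpan_induction with
  | mem x hx => exact hs x hx t
  | zero => exact IsTangent.zero
  | add x y _ _ hx hy => exact hx.add hy
  | smul c x _ hx => exact hx.smul c
  | lie x y _ _ hx hy => exact hx.commutator hQ hy

lemma isTangent_of_mem_algC (hs : IsControlSystem m Q fun i t => toReal (H i t)) {X : OpFamily D}
    (hX : X ∈ algC H) (t : ℝ) : IsTangent m Q (toReal (X t)) := by
  have hQ := hs.isStateSet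
  refine isTangent_of_mem_lieSpan hQ (fun X hX t => ?_) hX t
  obtain ⟨n, hn⟩ := mem_iUnion.1 hX
  clear hX
  induction n generalizing X t with
  | zero =>
    refine isTangent_of_mem_lieSpan hQ ?_ hn t
    rintro _ ⟨l, rfl⟩ t
    exact hs.isTangent l.succ t
  | succ n ih =>
    obtain ⟨X', hX', Y, hY, rfl⟩ := hn
    have h1 : IsTangent m Q (toReal (Y t)) :=
      IsTangent.timeDeriv (fun t => ih X' t hX') hY.hasDerivAt_toReal t
    exact (((hs.isTangent 0 t).commutator hQ (ih X' t hX')).neg).add h1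

lemma algC_le (hsmooth : HasSmoothTimeDependence H) : ∃ S : LieSubalgebra ℝ (OpFamily D),
    algC H ≤ S ∧ (∀ i, H i ∈ S) ∧ ∀ X ∈ S, ∃ Y ∈ S, IsTimeDeriv X Y := by
  obtain ⟨S, hHS, hS⟩ := hsmooth
  refine ⟨S, LieSubalgebra.lieSpan_le.2 (iUnion_subset fun n => ?_), hHS, hS⟩
  induction n with
  | zero => exact LieSubalgebra.lieSpan_le.2 (range_subset_iff.2 fun l => hHS l.succ)
  | succ n ih =>
    rintro _ ⟨X, hX, Y, hY, rfl⟩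
    obtain ⟨Y', hY'S, hY'⟩ := hS X (ih hX)
    rw [hY.unique hY']
    exact S.add_mem (S.neg_mem (S.lie_mem (hHS 0) (ih hX))) hY'S

/-- The Leibniz rule for the time derivative of a commutator. -/
lemma IsTimeDeriv.lie (hQ : IsStateSet m (D.restrictScalars ℝ) Q) {X Y X' Y' Z : OpFamily D}
    (hX : ∀ t, IsTangent m Q (toReal (X t))) (hX' : ∀ t, IsTangent m Q (toReal (X' t)))
    (h : IsTimeDeriv X Y) (h' : IsTimeDeriv X' Y') (hZ : IsTimeDeriv ⁅X, X'⁆ Z) :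
    IsTimeDeriv ⁅X, X'⁆ (⁅Y, X'⁆ + ⁅X, Y'⁆) := by
  have hY := IsTangent.timeDeriv hX h.hasDerivAt_toReal
  have hY' := IsTangent.timeDeriv hX' h'.hasDerivAt_toReal
  have h1 : Z = ⁅Y, X'⁆ + ⁅X, Y'⁆ := by
    funext t
    refine LinearMap.ext fun ψ => Subtype.ext ?_
    exact eq_of_hasDerivAt_commutator hQ.dense (fun t => (hX t).skew) (fun t => (hX' t).skew)
      (fun t => (hY t).skew) (fun t => (hY' t).skew) h.hasDerivAt_toReal h'.hasDerivAt_toReal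
      (hZ.hasDerivAt_toReal t ⟨ψ, ψ.2⟩)
  rw [← h1]
  exact hZ

/-- On the Lie algebra `𝓒`, the map `X ↦ -[H₀, X] + ∂X/∂t` is a derivation, which generates `𝓒`
from the control operators. -/
theorem exists_derivation (hs : IsControlSystem m Q fun i t => toReal (H i t))
    (hsmooth : HasSmoothTimeDependence H) : ∃ δ : algC H →ₗ[ℝ] algC H,
    (∀ X : algC H, IsTimeDeriv (X : OpFamily D) ((δ X : OpFamily D) + ⁅H 0, (X : OpFamily D)⁆)) ∧
    (∀ X Y, δ ⁅X, Y⁆ = ⁅δ X, Y⁆ + ⁅X, δ Y⁆) ∧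
    IsDiffGenerated δ fun l : Fin r => (⟨H l.succ, control_mem_algC l⟩ : algC H) := by
  have hQ := hs.isStateSet
  obtain ⟨S, hCS, -, hS⟩ := algC_le hsmooth
  have hlie : ∀ {X X' Z Z' : OpFamily D}, X ∈ algC H → X' ∈ algC H →
      IsTimeDeriv X (Z + ⁅H 0, X⁆) → IsTimeDeriv X' (Z' + ⁅H 0, X'⁆) →
      IsTimeDeriv ⁅X, X'⁆ ((⁅Z, X'⁆ + ⁅X, Z'⁆) + ⁅H 0, ⁅X, X'⁆⁆) := by
    intro X X' Z Z' hX hX' h h'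
    obtain ⟨W, -, hW⟩ := hS _ (hCS ((algC H).lie_mem hX hX'))
    have h1 := IsTimeDeriv.lie hQ (isTangent_of_mem_algC hs hX) (isTangent_of_mem_algC hs hX') h h' hW
    have h2 : (⁅Z, X'⁆ + ⁅X, Z'⁆) + ⁅H 0, ⁅X, X'⁆⁆
        = ⁅Z + ⁅H 0, X⁆, X'⁆ + ⁅X, Z' + ⁅H 0, X'⁆⁆ := by
      rw [leibniz_lie (H 0) X X', add_lie, lie_add]; abel
    rw [h2]
    exact h1
  have hex : ∀ X ∈ algC H, ∃ Z ∈ algC H, IsTimeDeriv X (Z + ⁅H 0, X⁆) := by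
    intro X hX
    induction hX using LieSubalgebra.lieSpan_induction with
    | mem X hX =>
      obtain ⟨n, hn⟩ := mem_iUnion.1 hX
      obtain ⟨Y, -, hY⟩ := hS X (hCS (setB_subset_algC n hn))
      refine ⟨-⁅H 0, X⁆ + Y, setB_subset_algC (n + 1) ⟨X, hn, Y, hY, rfl⟩, ?_⟩
      rwa [neg_add_cancel_comm]
    | zero =>
      refine ⟨0, (algC H).zero_mem, ?_⟩
      rw [lie_zero, add_zero]; exact IsTimeDeriv.zero
    | add X Y _ _ hX hY =>
      obtain ⟨Z, hZ, h⟩ := hX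
      obtain ⟨Z', hZ', h'⟩ := hY
      refine ⟨Z + Z', (algC H).add_mem hZ hZ', ?_⟩
      rw [lie_add, add_add_add_comm]
      exact h.add h'
    | smul c X _ hX =>
      obtain ⟨Z, hZ, h⟩ := hX
      refine ⟨c • Z, (algC H).smul_mem c hZ, ?_⟩
      rw [lie_smul, ← smul_add]
      exact h.smul c
    | lie X Y hXC hYC hX hY =>
      obtain ⟨Z, hZ, h⟩ := hX
      obtain ⟨Z', hZ', h'⟩ := hY
      exact ⟨⁅Z, Y⁆ + ⁅X, Z'⁆, (algC H).add_mem ((algC H).lie_mem hZ hYC)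
        ((algC H).lie_mem hXC hZ'), hlie hXC hYC h h'⟩
  choose f hfC hf using fun X : algC H => hex X X.2
  have huniq : ∀ (X : algC H) {Z : OpFamily D}, IsTimeDeriv (X : OpFamily D) (Z + ⁅H 0, (X : OpFamily D)⁆) →
      f X = Z := fun X Z hZ => add_right_cancel ((hf X).unique hZ)
  let δ : algC H →ₗ[ℝ] algC H :=
    { toFun := fun X => ⟨f X, hfC X⟩
      map_add' := fun X Y => Subtype.ext (huniq (X + Y) (by
        have := (hf X).add (hf Y)
        rw [add_add_add_comm, ← lie_add] at this
        exact this))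
      map_smul' := fun c X => Subtype.ext (huniq (c • X) (by
        have := (hf X).smul c
        rw [smul_add, ← lie_smul] at this
        exact this)) }
  refine ⟨δ, hf, fun X Y => Subtype.ext (huniq ⁅X, Y⁆ (hlie X.2 Y.2 (hf X) (hf Y))), ?_⟩
  intro K hK hδ X
  have hle : algC H ≤ K.map (algC H).incl := by
    refine LieSubalgebra.lieSpan_le.2 (iUnion_subset fun n => ?_)
    induction n with
    | zero =>
      refine LieSubalgebra.lieSpan_le.2 (range_subset_iff.2 fun l => ?_)
      exact ⟨_, hK l, rfl⟩
    | succ n ih =>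
      rintro _ ⟨X, hX, Y, hY, rfl⟩
      obtain ⟨k, hk, rfl⟩ := ih hX
      refine ⟨δ k, hδ k hk, ?_⟩
      have h1 := (hf k).unique hY
      rw [← h1]
      change f k = -⁅H 0, (k : OpFamily D)⁆ + (f k + ⁅H 0, (k : OpFamily D)⁆)
      abel
  obtain ⟨k, hk, hkX⟩ := hle X.2
  exact (Subtype.ext hkX : k = X) ▸ hk

end Families

section Reach

variable {E : Type*} [NormedAddCommGroup E] [InnerProductSpace ℂ E] {D : Submodule ℂ E} {m r : ℕ}
  {H : Fin (r + 1) → OpFamily D} {Q Q₀ : Set E} {t : ℝ}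

attribute [local instance] InnerProductSpace.complexToReal

/-! ### Reachability of all states by evolution operators -/

/-- The space `𝓒(t)q`, as a subspace of the real form of the domain. -/
lemma exists_submodule_of_algC {q : D.restrictScalars ℝ}
    (hC : Module.rank ℝ (algCAt H t ⟨q, q.2⟩) = (m : Cardinal)) :
    ∃ W : Submodule ℝ (D.restrictScalars ℝ), Module.rank ℝ W = (m : Cardinal) ∧
      ∀ z ∈ W, ∃ X ∈ algC H, toReal (X t) q = z := by
  let e : D ≃ₗ[ℝ] D.restrictScalars ℝ :=
    { toFun := fun ψ => ⟨ψ, ψ.2⟩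
      invFun := fun ψ => ⟨ψ, ψ.2⟩
      map_add' := fun _ _ => rfl
      map_smul' := fun _ _ => rfl
      left_inv := fun _ => rfl
      right_inv := fun _ => rfl }
  refine ⟨(algCAt H t ⟨q, q.2⟩).map e.toLinearMap, (e.rank_map_eq _).trans hC, ?_⟩
  rintro _ ⟨_, ⟨X, hX, rfl⟩, rfl⟩
  exact ⟨X, hX, rfl⟩

variable [CompleteSpace E]

/-- All operators of `𝓒` are null. -/
theorem isNull_of_mem_algC (hs : IsControlSystem m Q fun i t => toReal (H i t))
    (hsmooth : HasSmoothTimeDependence H) (h0 : IsDenseStates Q₀ Q) (hQ₀c : Q₀.Countable)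
    (hBC : ∀ t : ℝ, ∀ X ∈ algB H, ∀ Y ∈ algC H, ⁅X, Y⁆ t ∈ algBAt H t)
    (ht : t ∈ IsControlSystem.goodTimes Q₀ Q fun i t => toReal (H i t)) {X : OpFamily D}
    (hX : X ∈ algC H) : IsNull Q₀ Q (fun i t => toReal (H i t)) t (toReal (X t)) := by
  obtain ⟨δ, hd, hδ, hgen⟩ := exists_derivation hs hsmooth
  -- the families with null values at all good times
  let P : Submodule ℝ (algC H) :=
    { carrier := {X | ∀ t ∈ IsControlSystem.goodTimes Q₀ Q fun i t => toReal (H i t),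
        IsNull Q₀ Q (fun i t => toReal (H i t)) t (toReal ((X : OpFamily D) t))}
      add_mem' := fun hX hY t ht => (hX t ht).add (hY t ht)
      zero_mem' := fun t _ => IsNull.zero
      smul_mem' := fun c X hX t ht => (hX t ht).smul c }
  -- the ideal of families with values in `𝓑(t)` at every time `t`
  let F : Submodule ℝ (algC H) :=
    { carrier := {X | ∀ t, (X : OpFamily D) t ∈ algBAt H t}
      add_mem' := fun hX hY t => (algBAt H t).add_mem (hX t) (hY t)
      zero_mem' := fun t => (algBAt H t).zero_mem
      smul_mem' := fun c X hX t => (algBAt H t).smul_mem c (hX t) }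
  have hFP : F ≤ P := by
    intro X hX t ht
    have hB : ∀ {x : Module.End ℂ D}, x ∈ algBAt H t → IsTangent m Q (toReal x) ∧
        IsNull Q₀ Q (fun i t => toReal (H i t)) t (toReal x) := by
      intro x hx
      induction hx using LieSubalgebra.lieSpan_induction with
      | mem x hx =>
        obtain ⟨l, rfl⟩ := hx
        exact ⟨hs.isTangent l.succ t, hs.isNull_control h0 ht l⟩
      | zero => exact ⟨IsTangent.zero, IsNull.zero⟩
      | add x y _ _ hx hy => exact ⟨hx.1.add hy.1, hx.2.add hy.2⟩
      | smul c x _ hx => exact ⟨hx.1.smul c, hx.2.smul c⟩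
      | lie x y _ _ hx hy =>
        exact ⟨hx.1.commutator hs.isStateSet hy.1, IsNull.commutator hs h0 hy.1 hx.1 hy.2 hx.2⟩
    exact (hB (hX t)).2
  refine hgen.mem_of_ideal hδ (P := P) (F := F)
    (fun l t => LieSubalgebra.subset_lieSpan (mem_range_self l)) ?_ hFP ?_ ⟨X, hX⟩ t ht
  · intro X hX Y t
    obtain ⟨Z, hZ, hZX⟩ := exists_mem_algB (hX t)
    have h1 := hBC t Z hZ Y Y.2
    have h2 : ⁅Z, (Y : OpFamily D)⁆ t = ((⁅X, Y⁆ : algC H) : OpFamily D) t := by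
      change ⁅Z t, (Y : OpFamily D) t⁆ = ⁅(X : OpFamily D) t, (Y : OpFamily D) t⁆
      rw [hZX]
    rwa [h2] at h1
  · intro X hX hcomm t ht
    have h1 : ∀ t, (δ X : OpFamily D) t
        = -⁅H 0 t, (X : OpFamily D) t⁆ + ((δ X : OpFamily D) + ⁅H 0, (X : OpFamily D)⁆) t := by
      intro t
      change _ = -⁅H 0 t, (X : OpFamily D) t⁆ + ((δ X : OpFamily D) t + ⁅H 0 t, (X : OpFamily D) t⁆)
      abel
    have h2 := hcomm t ht
    have h3 : ((⁅X, δ X⁆ : algC H) : OpFamily D) t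
        = ⁅(X : OpFamily D) t, (δ X : OpFamily D) t⁆ := rfl
    rw [h3, h1, toReal_lie, toReal_add, toReal_neg, toReal_lie] at h2
    rw [h1, toReal_add, toReal_neg, toReal_lie]
    exact hs.isNull_drift h0 hQ₀c ht (X := fun t => toReal ((X : OpFamily D) t))
      (Y := fun t => toReal (((δ X : OpFamily D) + ⁅H 0, (X : OpFamily D)⁆) t))
      (isTangent_of_mem_algC hs X.2) (hd X).hasDerivAt_toReal hX h2

/-- The values of the operators of `𝓒` along the solutions are variations of the final state. -/
theorem IsMaxAccess.isAlong_of_mem_algC (hs : IsControlSystem m Q fun i t => toReal (H i t))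
    (hsmooth : HasSmoothTimeDependence H) {t₀ t₁ : ℝ} {x y : E} {V : Submodule ℝ E}
    (h : IsMaxAccess Q (fun i t => toReal (H i t)) t₀ t₁ t x y V) (hx : x ∈ Q) {X : OpFamily D}
    (hX : X ∈ algC H) :
    IsAlong Q (fun i t => toReal (H i t)) t t₁ y V fun τ => toReal (X τ) := by
  obtain ⟨δ, hd, hδ, hgen⟩ := exists_derivation hs hsmooth
  have hy := h.isAccess.mem hs hx
  have hV := h.isAccess.le_stateSpan hs hx
  have hfin := h.isAccess.finite
  let P : Submodule ℝ (algC H) :=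
    { carrier := {X | IsAlong Q (fun i t => toReal (H i t)) t t₁ y V
        fun τ => toReal ((X : OpFamily D) τ)}
      add_mem' := fun hX hY => hX.add hY
      zero_mem' := IsAlong.zero
      smul_mem' := fun c X hX => hX.smul c }
  -- the derivative of `X` along the solutions for the control `a`
  have hstep : ∀ (X Z : algC H) (a : Fin r → ℝ), X ∈ P →
      (∀ t, toReal ((Z : OpFamily D) t)
        = toReal (((δ X : OpFamily D) + ⁅H 0, (X : OpFamily D)⁆) t)
          - (generator (fun i t => toReal (H i t)) a t * toReal ((X : OpFamily D) t)
            - toReal ((X : OpFamily D) t) * generator (fun i t => toReal (H i t)) a t)) →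
      Z ∈ P := by
    intro X Z a hX hZ
    refine IsAlong.deriv hs hy hV hX a (isTangent_of_mem_algC hs X.2) (hd X).hasDerivAt_toReal
      hZ fun ψ => ?_
    exact continuous_iff_continuousAt.2 fun t => ((hd Z).hasDerivAt_toReal t ψ).continuousAt
  have hδP : ∀ X ∈ P, δ X ∈ P := by
    intro X hX
    refine hstep X (δ X) 0 hX fun t => ?_
    have h1 : generator (fun i t => toReal (H i t)) 0 t = toReal (H 0 t) := by simp [generator]
    rw [h1]
    change _ = toReal ((δ X : OpFamily D) t + ⁅H 0 t, (X : OpFamily D) t⁆) - _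
    rw [toReal_add, toReal_lie]
    refine LinearMap.ext fun v => ?_
    simp only [LinearMap.add_apply, LinearMap.sub_apply]
    abel
  refine hgen.mem_of_stable hδ (P := P) (fun l => h.isAlong_control hs hx l) hδP
    (fun l X hX => ?_) ⟨X, hX⟩
  set B : algC H := ⟨H l.succ, control_mem_algC l⟩ with hB
  have h2 : δ X - ⁅B, X⁆ ∈ P := by
    refine hstep X _ (Pi.single l 1) hX fun t => ?_
    have h1 : generator (fun i t => toReal (H i t)) (Pi.single l 1) t
        = toReal (H 0 t) + toReal (H l.succ t) := by
      rw [generator, Finset.sum_eq_single l]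
      · simp
      · intro b _ hb; simp [hb]
      · simp
    rw [h1]
    refine LinearMap.ext fun v => Subtype.ext ?_
    change (((δ X : OpFamily D) t ⟨v, v.2⟩ : D) : E)
        - (H l.succ t ((X : OpFamily D) t ⟨v, v.2⟩) - (X : OpFamily D) t (H l.succ t ⟨v, v.2⟩) : E)
      = ((δ X : OpFamily D) t ⟨v, v.2⟩ : E)
        + ((H 0 t ((X : OpFamily D) t ⟨v, v.2⟩) : E) - (X : OpFamily D) t (H 0 t ⟨v, v.2⟩))
        - (((H 0 t ((X : OpFamily D) t ⟨v, v.2⟩) : E) + H l.succ t ((X : OpFamily D) t ⟨v, v.2⟩))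
          - (X : OpFamily D) t (H 0 t ⟨v, v.2⟩ + H l.succ t ⟨v, v.2⟩))
    rw [map_add, Submodule.coe_add]
    abel
  have h3 := P.sub_mem (hδP X hX) h2
  rwa [sub_sub_cancel] at h3

/-- Under the hypotheses on the Lie algebras, the evolution operators act transitively on the
states. -/
theorem exists_evo_eq_of_algC (hs : IsControlSystem m Q fun i t => toReal (H i t))
    (hsmooth : HasSmoothTimeDependence H) (h0 : IsDenseStates Q₀ Q) (hQ₀c : Q₀.Countable)
    (hconn : IsPreconnected (chartSet m (closure Q)))
    (hC : ∀ (t : ℝ) (ψ : D), (ψ : E) ∈ Q → Module.rank ℝ (algCAt H t ψ) = (m : Cardinal))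
    (hBC : ∀ t : ℝ, ∀ X ∈ algB H, ∀ Y ∈ algC H, ⁅X, Y⁆ t ∈ algBAt H t) {t₀ t₁ : ℝ} (h01 : t₀ < t₁)
    {x z : E} (hx : x ∈ Q) (hz : z ∈ Q) :
    ∃ T, Evo Q (fun i t => toReal (H i t)) t₀ t₁ T ∧ T x = z := by
  have hfull : ∀ t ∈ IsControlSystem.goodTimes Q₀ Q fun i t => toReal (H i t),
      HasFullNull m Q₀ Q (fun i t => toReal (H i t)) t := by
    intro t ht q hq
    obtain ⟨W, hW, hWX⟩ := exists_submodule_of_algC (hC t ⟨q, q.2⟩ hq)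
    refine ⟨W, hW, fun z hz => ?_⟩
    obtain ⟨X, hX, hXz⟩ := hWX z hz
    exact ⟨_, isTangent_of_mem_algC hs hX t, isNull_of_mem_algC hs hsmooth h0 hQ₀c hBC ht hX, hXz⟩
  obtain ⟨t, y, V, hmax⟩ := exists_isMaxAccess hs hx h01
  refine hs.exists_evo_eq (fun h x hx z hz ε hε =>
    hs.exists_evo_norm_sub_lt h0 hQ₀c hconn hfull h hx hz hε) hmax.lt hmax.isAccess
    (hmax.le_finrank hs hx fun τ q hq => ?_) hx hz
  obtain ⟨W, hW, hWX⟩ := exists_submodule_of_algC (hC τ ⟨q, q.2⟩ hq)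
  refine ⟨W, hW, fun z hz => ?_⟩
  obtain ⟨X, hX, hXz⟩ := hWX z hz
  exact ⟨_, hmax.isAlong_of_mem_algC hs hsmooth hx hX, hXz⟩

end Reach

section Controls

variable {E : Type*} [NormedAddCommGroup E] [InnerProductSpace ℂ E] {D : Submodule ℂ E} {m r : ℕ}
  {H : Fin (r + 1) → OpFamily D} {M : Set E}

attribute [local instance] InnerProductSpace.complexToReal

/-! ### Piecewise constant controls -/

lemma generator_toReal_apply (a : Fin r → ℝ) (t : ℝ) (ψ : D) :
    (generator (fun i t => toReal (H i t)) a t (⟨ψ, ψ.2⟩ : D.restrictScalars ℝ) : E)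
      = ((H 0 t ψ + ∑ l : Fin r, a l • H l.succ t ψ : D) : E) := by
  simp only [generator, LinearMap.add_apply, LinearMap.sum_apply, LinearMap.smul_apply,
    Submodule.coe_add, Submodule.coe_sum]
  rfl

lemma switchingTimes_const (a : Fin r → ℝ) : switchingTimes (fun _ => a) = ∅ := by
  ext t
  simp [switchingTimes]

/-- The control `u` before time `t'`, and the constant control `a` from then on. -/
noncomputable def concatControl (u : ℝ → Fin r → ℝ) (t' : ℝ) (a : Fin r → ℝ) : ℝ → Fin r → ℝ :=
  fun t => if t < t' then u t else a

lemma concatControl_eventuallyEq {u : ℝ → Fin r → ℝ} {t t' : ℝ} (a : Fin r → ℝ) (h : t < t') :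
    concatControl u t' a =ᶠ[𝓝 t] u := by
  filter_upwards [Iio_mem_nhds h] with s hs using if_pos hs

lemma concatControl_eventuallyEq_const (u : ℝ → Fin r → ℝ) {t t' : ℝ} (a : Fin r → ℝ)
    (h : t' < t) : concatControl u t' a =ᶠ[𝓝 t] fun _ => a := by
  filter_upwards [Ioi_mem_nhds h] with s hs using if_neg (not_lt.2 (le_of_lt hs))

lemma notMem_switchingTimes_of_eventuallyEq {u v : ℝ → Fin r → ℝ} {t : ℝ} (h : u =ᶠ[𝓝 t] v)
    (hv : t ∉ switchingTimes v) : t ∉ switchingTimes u := by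
  simp only [switchingTimes, mem_ofPred_eq, not_not] at hv ⊢
  filter_upwards [h, hv] with s h1 h2
  rw [h1, h2, h.self_of_nhds]

lemma IsPiecewiseConstant.concatControl {u : ℝ → Fin r → ℝ} (hu : IsPiecewiseConstant u) (t' : ℝ)
    (a : Fin r → ℝ) : IsPiecewiseConstant (concatControl u t' a) := by
  intro b c
  refine ((hu b c).union (finite_singleton t')).subset ?_
  rintro t ⟨ht, htI⟩
  by_contra hcon
  simp only [mem_union, mem_inter_iff, mem_singleton_iff, not_or, not_and] at hcon
  rcases lt_trichotomy t t' with h | h | h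
  · exact notMem_switchingTimes_of_eventuallyEq (concatControl_eventuallyEq a h)
      (fun h' => hcon.1 h' htI) ht
  · exact hcon.2 h
  · refine notMem_switchingTimes_of_eventuallyEq (concatControl_eventuallyEq_const u a h) ?_ ht
    rw [switchingTimes_const]
    exact notMem_empty t

lemma isPiecewiseConstant_const (a : Fin r → ℝ) : IsPiecewiseConstant (fun _ => a) := by
  intro b c
  rw [switchingTimes_const, empty_inter]
  exact finite_empty

/-- The uniqueness of solutions, for a skew generator and a locally finite set of switching times. -/
lemma eq_of_hasDerivAt_generator [CompleteSpace E] (hH : ∀ i t, IsSkewHermitian (H i t))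
    {u : ℝ → Fin r → ℝ} {c : Set ℝ} (hc : c.Countable) {φ ψ : ℝ → D} {a b : ℝ} (hab : a ≤ b)
    (hφ : ContinuousOn (fun t => (φ t : E)) (Icc a b))
    (hψ : ContinuousOn (fun t => (ψ t : E)) (Icc a b))
    (hφd : ∀ t ∈ Ioo a b \ c, HasDerivAt (fun s => (φ s : E))
      ((H 0 t (φ t) + ∑ l : Fin r, u t l • H l.succ t (φ t) : D) : E) t)
    (hψd : ∀ t ∈ Ioo a b \ c, HasDerivAt (fun s => (ψ s : E))
      ((H 0 t (ψ t) + ∑ l : Fin r, u t l • H l.succ t (ψ t) : D) : E) t)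
    (h0 : φ a = ψ a) : φ b = ψ b := by
  have h1 : ∀ t ∈ Ioo a b \ c, HasDerivAt (fun s => (φ s : E) - ψ s)
      (generator (fun i t => toReal (H i t)) (u t) t
        (⟨(φ t - ψ t : D), (φ t - ψ t).2⟩ : D.restrictScalars ℝ) : E) t := by
    intro t ht
    have h2 := (hφd t ht).sub (hψd t ht)
    rw [← generator_toReal_apply, ← generator_toReal_apply, ← Submodule.coe_sub, ← map_sub] at h2
    exact h2
  have h2 := inner_eq_of_deriv_skew hab hc (hφ.sub hψ) (hφ.sub hψ) h1 h1 fun t ht => by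
    have h3 := isSkew_generator (H := fun i t => toReal (H i t))
      (fun i t => (hH i t).isSkew_toReal) (u t) t
      (⟨(φ t - ψ t : D), (φ t - ψ t).2⟩ : D.restrictScalars ℝ) ⟨(φ t - ψ t : D), (φ t - ψ t).2⟩
    exact eq_neg_iff_add_eq_zero.1 h3
  simp only [Pi.sub_apply, h0, sub_self, inner_zero_left] at h2
  exact Subtype.ext (sub_eq_zero.1 (inner_self_eq_zero.1 h2))

lemma IsTrajectory.hasDerivAt {t₀ : ℝ} {u : ℝ → Fin r → ℝ} {ψ : ℝ → D}
    (h : IsTrajectory H M t₀ u ψ) {t : ℝ} (ht : t₀ < t) (htu : t ∉ switchingTimes u) :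
    HasDerivAt (fun s => (ψ s : E)) ((H 0 t (ψ t) + ∑ l : Fin r, u t l • H l.succ t (ψ t) : D) : E)
      t :=
  (h.deriv t ht.le htu).hasDerivAt (Ici_mem_nhds ht)

/-- A system driven by piecewise constant controls is a system driven by constant controls. -/
lemma IsSystemOn.exists_isSolution (hsys : IsSystemOn H M) (a : Fin r → ℝ) (t₀ : ℝ)
    (q : D.restrictScalars ℝ) (hq : (q : E) ∈ M ∩ D) : ∃ y, y t₀ = q ∧
      IsSolution (M ∩ D) (generator (fun i t => toReal (H i t)) a) t₀ y := by
  obtain ⟨ψ, hψ, htr⟩ := hsys t₀ ⟨q, q.2⟩ hq.1 (fun _ => a) (isPiecewiseConstant_const a)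
  refine ⟨fun t => ⟨ψ t, (ψ t).2⟩, Subtype.ext (congrArg Subtype.val hψ),
    fun t ht => ⟨htr.mem t ht, (ψ t).2⟩, fun t ht => ?_⟩
  have h1 := htr.deriv t ht (by rw [switchingTimes_const]; exact notMem_empty t)
  rw [← generator_toReal_apply] at h1
  exact h1

/-- Every evolution operator is realized by a piecewise constant control. -/
lemma IsSystemOn.exists_control [CompleteSpace E] (hsys : IsSystemOn H M)
    (hH : ∀ i t, IsSkewHermitian (H i t))
    (hs : IsControlSystem m (M ∩ D) fun i t => toReal (H i t)) {t₀ t : ℝ} {T : E →L[ℝ] E}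
    (hT : Evo (M ∩ D) (fun i t => toReal (H i t)) t₀ t T) :
    ∃ u : ℝ → Fin r → ℝ, IsPiecewiseConstant u ∧ ∀ (x : D), (x : E) ∈ M → ∀ ψ : ℝ → D,
      ψ t₀ = x → IsTrajectory H M t₀ u ψ → (ψ t : E) = T x := by
  induction hT with
  | refl =>
    refine ⟨fun _ => 0, isPiecewiseConstant_const 0, fun x _ ψ hψ _ => ?_⟩
    rw [hψ]
    rfl
  | @step t' t'' T Φ a hT hΦ ih =>
    obtain ⟨u, hu, hux⟩ := ih
    refine ⟨concatControl u t' a, hu.concatControl t' a, fun x hx ψ hψ htr => ?_⟩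
    -- before `t'`, the trajectory agrees with one for the control `u`
    obtain ⟨χ, hχ, hχtr⟩ := hsys t₀ x hx u hu
    have h1 : ψ t' = χ t' := by
      refine eq_of_hasDerivAt_generator hH (u := u) (hu t₀ t').countable hT.le
        (htr.continuousOn.mono Icc_subset_Ici_self) (hχtr.continuousOn.mono Icc_subset_Ici_self)
        (fun t ht => ?_) (fun t ht => ?_) (hψ.trans hχ.symm)
      · have htu : t ∉ switchingTimes u := fun h => ht.2 ⟨h, Ioo_subset_Icc_self ht.1⟩
        have hev := concatControl_eventuallyEq (u := u) a ht.1.2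
        have h2 := htr.hasDerivAt ht.1.1 (notMem_switchingTimes_of_eventuallyEq hev htu)
        rwa [hev.self_of_nhds] at h2
      · exact hχtr.hasDerivAt ht.1.1 fun h => ht.2 ⟨h, Ioo_subset_Icc_self ht.1⟩
    have h2 : (ψ t' : E) = T x := by rw [h1]; exact hux x hx χ hχ hχtr
    -- from then on, it agrees with the solution for the constant control `a`
    obtain ⟨y, hy, hsol⟩ := hs.exists_solution a t' ⟨ψ t', (ψ t').2⟩
      ⟨htr.mem t' hT.le, (ψ t').2⟩
    have h3 : ψ t'' = ⟨y t'', (y t'').2⟩ := by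
      refine eq_of_hasDerivAt_generator hH (u := fun _ => a) (φ := ψ)
        (ψ := fun t => ⟨y t, (y t).2⟩) countable_empty hΦ.le
        (htr.continuousOn.mono fun t ht => hT.le.trans ht.1)
        (hsol.continuousOn.mono Icc_subset_Ici_self) (fun t ht => ?_) (fun t ht => ?_)
        (Subtype.ext (congrArg Subtype.val hy).symm)
      · have hev := concatControl_eventuallyEq_const u a ht.1.1
        have h4 := htr.hasDerivAt (hT.le.trans_lt ht.1.1)
          (notMem_switchingTimes_of_eventuallyEq hev (by
            rw [switchingTimes_const]; exact notMem_empty t))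
        rwa [hev.self_of_nhds] at h4
      · rw [← generator_toReal_apply]
        exact hsol.hasDerivAt ht.1.1
    have h5 := hΦ.apply y hsol
    rw [hy] at h5
    rw [ContinuousLinearMap.comp_apply, ← h2, h3]
    exact h5.symm

/-- The states of a quantum control system, with their real structure. -/
lemma IsSystemOn.isControlSystem (hsys : IsSystemOn H M) (hH : ∀ i t, IsSkewHermitian (H i t))
    (hsmooth : HasSmoothTimeDependence H) (hD : Dense (D : Set E))
    (hsphere : M ⊆ Metric.sphere (0 : E) 1) (hM : IsEmbeddedSubmanifold m M)
    (hMD : M ⊆ closure (M ∩ D)) : IsControlSystem m (M ∩ D) fun i t => toReal (H i t) where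
  isStateSet :=
    { dense := hD
      subset := inter_subset_right
      subset_chartSet := by
        have hcl : closure (M ∩ D) = closure M :=
          (closure_mono inter_subset_left).antisymm (closure_minimal hMD isClosed_closure)
        rw [hcl]
        exact fun p hp => ⟨subset_closure hp.1, LocalChart.closure hp.1 (hM p hp.1)⟩
      norm_eq := fun x hx => by simpa using hsphere hx.1 }
  skew := fun i t => (hH i t).isSkew_toReal
  continuous := fun i ψ => by
    obtain ⟨S, hHS, hS⟩ := hsmooth
    obtain ⟨Y, -, hY⟩ := hS _ (hHS i)
    exact continuous_iff_continuousAt.2 fun t => (hY.hasDerivAt_toReal t ψ).continuousAt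
  exists_solution := hsys.exists_isSolution

/-- The set of points near which the closure of a connected submanifold is a submanifold is
connected. -/
lemma isPreconnected_chartSet (hM : IsEmbeddedSubmanifold m M) (hconn : IsPreconnected M) :
    IsPreconnected (chartSet m (closure M)) :=
  hconn.subset_closure (fun p hp => ⟨subset_closure hp, LocalChart.closure hp (hM p hp)⟩)
    fun _ hp => hp.1

end Controls

end QuantumControl

theorem theorem4p7 {E : Type*} [NormedAddCommGroup E] [InnerProductSpace ℂ E] [CompleteSpace E]
    (D : Submodule ℂ E) {r : ℕ} (H : Fin (r + 1) → QuantumControl.OpFamily D)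
    (hskew : ∀ i t, QuantumControl.IsSkewHermitian (H i t))
    (hsmooth : QuantumControl.HasSmoothTimeDependence H)
    (hD : ∀ t, QuantumControl.IsAnalyticDomain D (fun i => H i t))
    (m : ℕ) (M : Set E)
    (hMsphere : M ⊆ Metric.sphere (0 : E) 1)
    (hM : QuantumControl.IsEmbeddedSubmanifold m M)
    (hMconn : IsConnected M)
    (hMD : M ⊆ closure (M ∩ (D : Set E)))
    (hsys : QuantumControl.IsSystemOn H M)
    (hC : ∀ (t : ℝ) (ψ : D), (ψ : E) ∈ M →
      Module.rank ℝ (QuantumControl.algCAt H t ψ) = (m : Cardinal))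
    (hBC : ∀ t : ℝ, ∀ X ∈ QuantumControl.algB H, ∀ Y ∈ QuantumControl.algC H,
      ⁅X, Y⁆ t ∈ QuantumControl.algBAt H t) :
    ∀ t₀ : ℝ, QuantumControl.StronglyAnalyticallyControllable H M t₀ := by
  intro t₀ ψ₀ hψ₀ t ht
  let _ := InnerProductSpace.complexToReal (G := E)
  set Q : Set E := M ∩ (D : Set E) with hQdef
  have hs := hsys.isControlSystem hskew hsmooth (hD 0).dense hMsphere hM hMD
  have hcl : closure Q = closure M :=
    (closure_mono inter_subset_left).antisymm (closure_minimal hMD isClosed_closure)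
  have hconn : IsPreconnected (QuantumControl.chartSet m (closure Q)) := by
    rw [hcl]
    exact QuantumControl.isPreconnected_chartSet hM hMconn.isPreconnected
  -- a countable dense set of states
  obtain ⟨Q₀, hQ₀, hQ₀c, hQ₀d⟩ := ((QuantumControl.isSeparable_chartSet hconn).mono
    hs.isStateSet.subset_chartSet).exists_countable_dense_subset
  refine Subset.antisymm ?_ fun φ hφ => ?_
  · rintro _ ⟨u, -, ψ, -, htr, rfl⟩
    exact ⟨htr.mem t ht.le, (ψ t).2⟩
  · obtain ⟨T, hT, hTφ⟩ := QuantumControl.exists_evo_eq_of_algC hs hsmooth ⟨hQ₀, hQ₀d⟩ hQ₀c hconn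
      (fun t ψ hψ => hC t ψ hψ.1) hBC ht ⟨hψ₀, ψ₀.2⟩ hφ
    obtain ⟨u, hu, hux⟩ := hsys.exists_control hskew hs hT
    obtain ⟨ψ, hψ, htr⟩ := hsys t₀ ψ₀ hψ₀ u hu
    exact ⟨u, hu, ψ, hψ, htr, (hux ψ₀ hψ₀ ψ hψ htr).trans hTφ⟩
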